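/- Let $d\ge 1$ and $\widehat f(\xi)=(2\pi)^{-d/2}\int_{\mathbf R^d}e^{-ix\cdot\xi}f(x)\,dx$. Let $W=\{f\in\mathcal S'(\mathbf R^d;\mathbf C):\widehat f\in L^1(\mathbf R^d)\}$ with $\|f\|_W=\|\widehat f\|_{L^1}$, and give $L^2\cap W$ the norm $\max(\|f\|_{L^2},\|f\|_W)$. For a tempered distribution $K$ whose Fourier transform is a function, consider the Hartree equation $$i\partial_t u+\Delta u=(K*|u|^2)u,\qquad u|_{t=0}=u_0, \tag{H}$$ where $\widehat{K*h}=(2\pi)^{d/2}\widehat K\,\widehat h$. A solution on a time interval $I\ni 0$ is a $u\in C(I;W)$ such that $K*|u|^2\in L^1([0,t];W)$ and $u(t)=e^{it\Delta}u_0-i\int_0^te^{i(t-\tau)\Delta}\big((K*|u|^2)u\big)(\tau)\,d\tau$ for all $t\in I$. For $S=W$ or $S=L^2\cap W$, (H) is called locally well-posed in $S$ if for every bounded $B\subset S$ there are $T>0$ and a Banach space $X\hookrightarrow C([0,T];S)$ such that for each $\varphi\in B$ there is a unique solution $\psi\in X$ on $[0,T]$ with $\psi(0)=\varphi$, and $B\ni\varphi\mapsto\psi\in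 C([0,T];S)$ is uniformly continuous. (i) Let $p\in[1,\infty]$ and $\widehat K\in L^p(\mathbf R^d)$. Then (H) is locally well-posed in $L^2\cap W$, and for every $u_0\in L^2\cap W$ there is $T>0$ such that (H) has a unique solution $u\in C([-T,T];L^2\cap W)$. If $K$ is real-valued, then $\|u(t)\|_{L^2}=\|u_0\|_{L^2}$ for all $t\in[-T,T]$. If $K$ is real-valued and $p=1$, then (H) has a unique global solution $u\in C(\mathbf R;L^2\cap W)$, and its $L^2$ norm is conserved. (ii) Let $\widehat K\in L^\infty(\mathbf R^d)$. Then (H) is locally well-posed in $W$, and for every $u_0\in W$ there is $T>0$ such that (H) has a unique solution $u\in C([-T,T];W)$. (iii) For every $p\in[1,\infty)$ there is $\gamma\in(0,d)$ such that the (real-valued) $K$ with $\widehat K(\xi)=|\xi|^{-(d-\gamma)}\mathbf 1_{\{|\xi|\le 1\}}$ satisfies $\widehat K\in L^p\setminus L^\infty$, and (H) is locally well-posed in $L^2\cap W$ but not in $W$. More precisely, for every $T>0$ each $\varphi\in L^2\cap W$ is the initial datum of exactly one solution $\psi\in C([0,T];W)$, and for every ball $B$ of $W$ (with any centre and any positive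 radius) the solution map $\varphi\mapsto\psi$, from $B\cap L^2$ with the $W$ norm to $C([0,T];W)$, is not uniformly continuous. -/

import Mathlib

open MeasureTheory Set
open scoped ENNReal SchwartzMap

noncomputable section

namespace Hartree

/-- The Euclidean space `ℝ^d`. -/
abbrev E (d : ℕ) : Type := EuclideanSpace ℝ (Fin d)

/-! ### Fourier transform, with the normalization `(2π)^{-d/2} ∫ e^{-i x·ξ} f(x) dx` -/

/-- `f̂(ξ) = (2π)^{-d/2} ∫ e^{-i x·ξ} f(x) dx`. -/
def fourier {d : ℕ} (f : E d → ℂ) (ξ : E d) : ℂ :=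
  (((2 * Real.pi) ^ (-(d : ℝ) / 2) : ℝ) : ℂ) *
    ∫ x, Complex.exp (-(Complex.I * ((inner ℝ x ξ : ℝ) : ℂ))) * f x

/-- `(2π)^{-d/2} ∫ e^{i x·ξ} g(ξ) dξ`. -/
def invFourier {d : ℕ} (g : E d → ℂ) (x : E d) : ℂ :=
  (((2 * Real.pi) ^ (-(d : ℝ) / 2) : ℝ) : ℂ) *
    ∫ ξ, Complex.exp (Complex.I * ((inner ℝ x ξ : ℝ) : ℂ)) * g ξ

/-- The Fourier transform of the tempered distribution `K` is the function `κ` :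
`⟨K, φ̂⟩ = ∫ κ φ` for all Schwartz functions `φ` (here `ψ = φ̂`). -/
def HasFourierTransform {d : ℕ} (K : 𝓢'(E d, ℂ)) (κ : E d → ℂ) : Prop :=
  ∀ φ ψ : 𝓢(E d, ℂ), (∀ ξ, ψ ξ = fourier φ ξ) → K ψ = ∫ ξ, κ ξ * φ ξ

/-- The tempered distribution `K` is real-valued. -/
def IsRealValued {d : ℕ} (K : 𝓢'(E d, ℂ)) : Prop :=
  ∀ φ : 𝓢(E d, ℂ), (∀ x, (φ x).im = 0) → (K φ).im = 0

/-! ### The Wiener algebra -/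

theorem integrable_exp_mul {d : ℕ} {g : E d → ℂ} (hg : Integrable g) (x : E d) :
    Integrable (fun ξ => Complex.exp (Complex.I * ((inner ℝ x ξ : ℝ) : ℂ)) * g ξ) := by
  refine hg.bdd_mul (c := 1) ?_ ?_
  · exact Continuous.aestronglyMeasurable (by fun_prop)
  · refine Filter.Eventually.of_forall fun ξ => ?_
    rw [mul_comm, Complex.norm_exp_ofReal_mul_I]

/-- The inverse Fourier transform on `L¹`, with values in functions on `ℝ^d`. -/
def invFourierL1 (d : ℕ) : Lp ℂ 1 (volume : Measure (E d)) →ₗ[ℂ] (E d → ℂ) where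
  toFun g := invFourier g
  map_add' g h := by
    funext x
    simp only [invFourier, Pi.add_apply]
    rw [← mul_add, ← integral_add (integrable_exp_mul (L1.integrable_coeFn g) x)
      (integrable_exp_mul (L1.integrable_coeFn h) x)]
    congr 1
    refine integral_congr_ae ?_
    filter_upwards [Lp.coeFn_add g h] with ξ hξ
    rw [hξ, Pi.add_apply, mul_add]
  map_smul' c g := by
    funext x
    simp only [invFourier, Pi.smul_apply, smul_eq_mul, RingHom.id_apply]
    have h : ∫ ξ, Complex.exp (Complex.I * ((inner ℝ x ξ : ℝ) : ℂ)) * (c • g) ξ =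
        c * ∫ ξ, Complex.exp (Complex.I * ((inner ℝ x ξ : ℝ) : ℂ)) * g ξ := by
      rw [← integral_const_mul]
      refine integral_congr_ae ?_
      filter_upwards [Lp.coeFn_smul c g] with ξ hξ
      rw [hξ, Pi.smul_apply, smul_eq_mul, mul_left_comm]
    rw [h, mul_left_comm]

/-- The inverse Fourier transform is injective on `L¹`. -/
theorem invFourierL1_injective (d : ℕ) : Function.Injective (invFourierL1 d) := by
  rw [← LinearMap.ker_eq_bot, LinearMap.ker_eq_bot']
  intro g hg
  have hint : Integrable (g : E d → ℂ) := L1.integrable_coeFn g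
  have h0 : ∀ x : E d, VectorFourier.fourierIntegral Real.fourierChar volume
      (innerₗ (E d)) g x = 0 := by
    intro x
    have h1 := congrFun hg ((-(2 * Real.pi)) • x)
    have hc : (((2 * Real.pi) ^ (-(d : ℝ) / 2) : ℝ) : ℂ) ≠ 0 := by
      exact_mod_cast (Real.rpow_pos_of_pos (by positivity) _).ne'
    simp only [invFourierL1, LinearMap.coe_mk, AddHom.coe_mk, invFourier, Pi.zero_apply,
      mul_eq_zero, hc, false_or] at h1
    rw [← h1]
    unfold VectorFourier.fourierIntegral
    refine integral_congr_ae (Filter.Eventually.of_forall fun ξ => ?_)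
    simp only [Circle.smul_def, Real.fourierChar_apply, smul_eq_mul, innerₗ_apply_apply,
      inner_smul_left]
    congr 2
    rw [real_inner_comm]
    push_cast
    simp
    ring
  have h2 : ∀ φ : 𝓢(E d, ℂ), ∫ ξ, g ξ * φ ξ = 0 := by
    intro φ
    obtain ⟨ψ, rfl⟩ : ∃ ψ : 𝓢(E d, ℂ), FourierTransform.fourier ψ = φ :=
      ⟨FourierTransformInv.fourierInv φ, FourierTransform.fourier_fourierInv_eq φ⟩
    have h3 := VectorFourier.integral_fourierIntegral_smul_eq_flip (L := innerₗ (E d))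
      Real.continuous_fourierChar (continuous_inner (𝕜 := ℝ) (E := E d)) hint ψ.integrable (μ := volume) (ν := volume)
    simp only [h0, zero_mul, integral_zero, flip_innerₗ, smul_eq_mul] at h3
    exact h3.symm
  have h4 : (g : E d → ℂ) =ᵐ[volume] 0 := by
    refine ae_eq_zero_of_integral_contDiff_smul_eq_zero hint.locallyIntegrable ?_
    intro φ hφ hφc
    have hc : HasCompactSupport (fun x => (φ x : ℂ)) := hφc.comp_left (g := Complex.ofReal) rfl
    have hs : ContDiff ℝ ((⊤ : ℕ∞) : WithTop ℕ∞) (fun x => (φ x : ℂ)) := Complex.ofRealCLM.contDiff.comp hφ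
    rw [← h2 (hc.toSchwartzMap hs)]
    refine integral_congr_ae (Filter.Eventually.of_forall fun ξ => ?_)
    simp [mul_comm]
  exact (Lp.eq_zero_iff_ae_eq_zero).2 h4

/-- The set `W` of (continuous) functions whose Fourier transform is integrable. -/
def wienerSubmodule (d : ℕ) : Submodule ℂ (E d → ℂ) := LinearMap.range (invFourierL1 d)

/-- The Wiener algebra `W = {f : f̂ ∈ L¹}`; its norm is `‖f‖_W = ‖f̂‖_{L¹}`. -/
def Wiener (d : ℕ) : Type := ↥(wienerSubmodule d)

namespace Wiener

variable {d : ℕ}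

instance : AddCommGroup (Wiener d) := inferInstanceAs (AddCommGroup ↥(wienerSubmodule d))
instance : Module ℂ (Wiener d) := inferInstanceAs (Module ℂ ↥(wienerSubmodule d))
instance : CoeFun (Wiener d) (fun _ => E d → ℂ) := ⟨fun f => f.1⟩

/-- The Fourier transform `W → L¹`, a linear bijection. -/
def hat : Wiener d ≃ₗ[ℂ] Lp ℂ 1 (volume : Measure (E d)) :=
  (LinearEquiv.ofInjective (invFourierL1 d) (invFourierL1_injective d)).symm

/-- `f = (2π)^{-d/2} ∫ e^{i x·ξ} f̂(ξ) dξ` for `f ∈ W`. -/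
theorem eq_invFourier_hat (f : Wiener d) (x : E d) : f x = invFourier (hat f) x := by
  have h := congrArg Subtype.val
    ((LinearEquiv.ofInjective (invFourierL1 d) (invFourierL1_injective d)).apply_symm_apply f)
  exact (congrFun h x).symm

instance : NormedAddCommGroup (Wiener d) :=
  NormedAddCommGroup.induced (Wiener d) (Lp ℂ 1 (volume : Measure (E d))) hat hat.injective

instance : NormedSpace ℂ (Wiener d) :=
  NormedSpace.induced ℂ (Wiener d) (Lp ℂ 1 (volume : Measure (E d))) hat

theorem norm_eq_integral (f : Wiener d) : ‖f‖ = ∫ ξ, ‖hat f ξ‖ := L1.norm_eq_integral_norm _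

theorem integrable_schrodinger_symbol (t : ℝ) (f : Wiener d) :
    Integrable (fun ξ : E d => Complex.exp (-(Complex.I * t * (‖ξ‖ : ℂ) ^ 2)) * hat f ξ) := by
  refine (L1.integrable_coeFn (hat f)).bdd_mul (c := 1) ?_ ?_
  · exact Continuous.aestronglyMeasurable (by fun_prop)
  · refine Filter.Eventually.of_forall fun ξ => ?_
    rw [Complex.norm_exp]
    simp [← Complex.ofReal_pow]

/-- The free Schrödinger group `e^{itΔ}` on `W` : multiplication by `e^{-it|ξ|²}` on the
Fourier side. -/
def schrodinger (t : ℝ) (f : Wiener d) : Wiener d :=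
  hat.symm ((integrable_schrodinger_symbol t f).toL1 _)

end Wiener

/-! ### The space `L² ∩ W` -/

/-- The functions of `W` that are square integrable. -/
def l2WienerSubmodule (d : ℕ) : Submodule ℂ (E d → ℂ) where
  carrier := {f | f ∈ wienerSubmodule d ∧ MemLp f 2 volume}
  add_mem' hf hg := ⟨add_mem hf.1 hg.1, hf.2.add hg.2⟩
  zero_mem' := ⟨zero_mem _, MemLp.zero⟩
  smul_mem' c _ hf := ⟨Submodule.smul_mem _ c hf.1, hf.2.const_smul c⟩

/-- The space `L² ∩ W`, with the norm `max (‖f‖_W) (‖f‖_{L²})`. -/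
def L2Wiener (d : ℕ) : Type := ↥(l2WienerSubmodule d)

namespace L2Wiener

variable {d : ℕ}

instance : AddCommGroup (L2Wiener d) := inferInstanceAs (AddCommGroup ↥(l2WienerSubmodule d))
instance : Module ℂ (L2Wiener d) := inferInstanceAs (Module ℂ ↥(l2WienerSubmodule d))

/-- The inclusion `L² ∩ W ⊆ W`. -/
def toW : L2Wiener d →ₗ[ℂ] Wiener d where
  toFun f := ⟨f.1, f.2.1⟩
  map_add' _ _ := rfl
  map_smul' _ _ := rfl

/-- The inclusion `L² ∩ W ⊆ L²`. -/
def toL2 : L2Wiener d →ₗ[ℂ] Lp ℂ 2 (volume : Measure (E d)) where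
  toFun f := f.2.2.toLp f.1
  map_add' f g := MemLp.toLp_add f.2.2 g.2.2
  map_smul' c f := MemLp.toLp_const_smul c f.2.2

theorem prod_injective : Function.Injective ((toW (d := d)).prod toL2) := fun _ _ h =>
  Subtype.ext (congrArg (fun z : Wiener d × Lp ℂ 2 (volume : Measure (E d)) => z.1.1) h)

instance : NormedAddCommGroup (L2Wiener d) :=
  NormedAddCommGroup.induced (L2Wiener d) (Wiener d × Lp ℂ 2 (volume : Measure (E d)))
    ((toW (d := d)).prod toL2) prod_injective

instance : NormedSpace ℂ (L2Wiener d) :=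
  NormedSpace.induced ℂ (L2Wiener d) (Wiener d × Lp ℂ 2 (volume : Measure (E d)))
    ((toW (d := d)).prod toL2)

theorem norm_eq (f : L2Wiener d) : ‖f‖ = max ‖toW f‖ ‖toL2 f‖ := rfl

end L2Wiener

/-! ### The Hartree equation -/

/-- `K * h = v`, where `κ = K̂` and `h`, `v` belong to `W` : the Fourier transform of `v` is
`(2π)^{d/2} K̂ ĥ`. -/
def IsConvolution {d : ℕ} (κ : E d → ℂ) (h : E d → ℂ) (v : Wiener d) : Prop :=
  ∃ g : Wiener d, (∀ x, g x = h x) ∧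
    (Wiener.hat v : E d → ℂ) =ᵐ[volume]
      fun ξ => (((2 * Real.pi) ^ ((d : ℝ) / 2) : ℝ) : ℂ) * κ ξ * Wiener.hat g ξ

/-- `u` solves `i ∂ₜu + Δu = (K * |u|²) u`, `u(0) = u₀`, on the time interval `I ∋ 0`, in the
sense of Duhamel's formula
`u(t) = e^{itΔ} u₀ - i ∫₀ᵗ e^{i(t-τ)Δ} ((K * |u|²) u)(τ) dτ` for `t ∈ I`.
Here `κ = K̂`, `V(τ) = K * |u(τ)|²`, `N(τ) = V(τ) u(τ)`, and the integral is a Bochner integral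
in `W`. -/
def IsSolution {d : ℕ} (κ : E d → ℂ) (I : Set ℝ) (u₀ : Wiener d) (u : I → Wiener d) : Prop :=
  ∃ V N : ℝ → Wiener d,
    (∀ᵐ τ : ℝ, ∀ hτ : τ ∈ I,
      IsConvolution κ (fun x => ((‖u ⟨τ, hτ⟩ x‖ ^ 2 : ℝ) : ℂ)) (V τ) ∧
        ∀ x, N τ x = V τ x * u ⟨τ, hτ⟩ x) ∧
    ∀ t : I,
      IntervalIntegrable V volume 0 t ∧
      IntervalIntegrable (fun τ => Wiener.schrodinger (t - τ) (N τ)) volume 0 t ∧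
      u t = Wiener.schrodinger t u₀
        - Complex.I • ∫ τ in (0 : ℝ)..t, Wiener.schrodinger (t - τ) (N τ)

/-- Local well-posedness of the Hartree equation in a space `S` of initial data, `j` being the
inclusion of `S` in `W`: for every bounded `B ⊆ S` there are `T > 0` and a Banach space
`X ↪ C([0,T]; S)` such that every `φ ∈ B` is the initial datum of a unique solution `Ψ φ ∈ X`,
and `Ψ : B → C([0,T]; S)` is uniformly continuous. -/
def LocallyWellPosed {d : ℕ} (κ : E d → ℂ) (S : Type) [NormedAddCommGroup S] [NormedSpace ℂ S]
    (j : S →ₗ[ℂ] Wiener d) : Prop :=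
  ∀ B : Set S, Bornology.IsBounded B →
    ∃ T : ℝ, 0 < T ∧
    ∃ (X : Type) (_ : NormedAddCommGroup X) (_ : NormedSpace ℂ X) (_ : CompleteSpace X)
      (ι : X →L[ℂ] C(Icc (0 : ℝ) T, S)), Function.Injective ι ∧
    ∃ Ψ : S → X,
      (∀ φ ∈ B, ∀ ψ : X, IsSolution κ (Icc 0 T) (j φ) (fun t => j (ι ψ t)) ↔ ψ = Ψ φ) ∧
      UniformContinuousOn (fun φ => ι (Ψ φ)) B

/-- The function `|ξ|^{-(d-γ)}` restricted to the unit ball `|ξ| ≤ 1`. -/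
def truncatedRiesz (d : ℕ) (γ : ℝ) : E d → ℂ :=
  (Metric.closedBall (0 : E d) 1).indicator fun ξ => ((‖ξ‖ ^ (-((d : ℝ) - γ)) : ℝ) : ℂ)

end Hartree

end

/-!
The Fourier transform is an isometry of `W` onto `L¹`, so `W` is a Banach space and, as
convolution is bounded on `L¹`, an algebra under the pointwise product; `e^{itΔ}`, whose symbol has
modulus one, acts on it by isometries. By Plancherel's theorem (`Wiener.eLpNorm_hat`) the `L²` norm
is the `L²` norm of the Fourier transform, so `L² ∩ W` is complete, the free group is isometric on
it too, and `W` acts on it by multiplication. A space with these properties is a `StateSpace`, and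
a bounded bilinear map `(u, v) ↦ K * (u v̄)` from it to `W` is an `Interaction`.

**Well-posedness.** Given an interaction on `S`, the substitution `v(t) = e^{-itΔ} u(t)` turns
Duhamel's formula into an ordinary differential equation in `S` whose vector field is cubic, hence
bounded and Lipschitz on balls. Composed with the radial projection on a ball it is globally
Lipschitz, and Picard–Lindelöf gives a solution, on a time interval that depends only on the size
of the datum (`Interaction.exists_isMild_local`). Uniqueness and Lipschitz dependence on the datum
are Gronwall's inequality (`Interaction.IsMild.unique`, `Interaction.locallyWellPosed`). There is an
interaction on `W` if `K̂ ∈ L^∞`, as then `‖K * h‖_W ≲ ‖h‖_W`, and one on `L² ∩ W` if `K̂ ∈ L^p`, as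
the Fourier transform of `u v̄` is both integrable and bounded by `‖u‖_{L²} ‖v‖_{L²}`
(`nonempty_interaction_wiener`, `nonempty_interaction_l2`). If `K` is real-valued, then
`K * |u|²` is real and the `L²` norm is conserved (`Interaction.IsMild.norm_toL2_eq`). If moreover
`K̂ ∈ L¹`, then `‖K * |u|²‖_W ≤ ‖K̂‖_{L¹} ‖u‖²_{L²}` is bounded a priori, so the norm of the solution
grows at most exponentially and the solution is global
(`Interaction.exists_isMild_of_integrable`).

**Ill-posedness.** Let `K̂(ξ) = |ξ|^{-(d-γ)} 1_{|ξ| ≤ 1}`; it is in `L¹`. A solution in `C([0,T]; W)`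
with datum in `L² ∩ W` solves a linear Schrödinger equation with a potential in `L¹([0,T]; W)`.
That equation has a unique solution in `W` and one in `L² ∩ W`, so they coincide and the nonlinear
solution is the global one in `L² ∩ W` (`Interaction.isSolution_wiener_iff_eq`).

To see that the flow is not uniformly continuous in the `W` norm, take a band-limited `f` with
`f(0) ≠ 0` in the given ball, and add `± a`, where `â` is a multiple of the indicator function of
the ball of radius `μ` and `‖a‖_W = ε`. The potential `K * |a|²` at the origin is at least of order
`ε² μ^{-(d-γ)}` (`Interaction.le_re_pot_bump`), and by the parallelogram identity one sign gives a
datum `φ = f ± a` whose potential `V = K * |φ|²` has this size at the origin. In the norm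
`max (‖·‖_W) (μ^{d/2} ‖·‖_{L²})` the datum is bounded uniformly in `μ`, and the interaction has norm
of the order of `μ^{-(d-γ)}` (`Interaction.norm_pot_le_scaled`). Hence, over times
`t = O(μ^{d-γ})`, the solution differs from `e^{-itV} φ` by `O(t)`, since the Laplacian acts on
functions that are nearly band limited (`Interaction.exists_phase_approx`). At `t = π / V(0)` the
solution is therefore close to `-f(0)` at the origin, whereas uniform continuity would keep it,
for small `ε` and all `μ`, near the solution with datum `f`, which is still close to `f(0)`
(`Interaction.not_uniformContinuousOn`).
-/

noncomputable section

namespace Hartree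

open scoped FourierTransform Convolution

set_option linter.unusedSectionVars false

variable {d : ℕ}

/-! ### The Fourier transform on `W` -/

/-- The normalization constant `(2π)^{-d/2}`. -/
def fc (d : ℕ) : ℝ := (2 * Real.pi) ^ (-(d : ℝ) / 2)

theorem fc_pos (d : ℕ) : 0 < fc d := Real.rpow_pos_of_pos (by positivity) _

theorem rpow_half_eq_inv_fc (d : ℕ) : ((2 * Real.pi) ^ ((d : ℝ) / 2) : ℝ) = (fc d)⁻¹ := by
  rw [fc, ← Real.rpow_neg (by positivity)]
  congr 1
  ring

theorem invFourier_eq (g : E d → ℂ) (x : E d) :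
    invFourier g x = (fc d : ℂ) * 𝓕 g ((-(2 * Real.pi)⁻¹) • x) := by
  rw [invFourier, ← fc, Real.fourier_eq']
  congr 2
  ext ξ
  rw [smul_eq_mul, inner_smul_right, real_inner_comm]
  congr 2
  push_cast
  field_simp

theorem invFourier_congr {g h : E d → ℂ} (hgh : g =ᵐ[volume] h) : invFourier g = invFourier h := by
  funext x
  unfold invFourier
  congr 1
  refine integral_congr_ae ?_
  filter_upwards [hgh] with ξ hξ
  rw [hξ]

theorem norm_invFourier_le (g : E d → ℂ) (x : E d) :
    ‖invFourier g x‖ ≤ fc d * ∫ ξ, ‖g ξ‖ := by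
  rw [invFourier, ← fc, norm_mul, Complex.norm_real, Real.norm_of_nonneg (fc_pos d).le]
  refine mul_le_mul_of_nonneg_left ?_ (fc_pos d).le
  refine (norm_integral_le_integral_norm _).trans_eq ?_
  refine integral_congr_ae (Filter.Eventually.of_forall fun ξ => ?_)
  simp only [norm_mul]
  rw [mul_comm Complex.I, Complex.norm_exp_ofReal_mul_I, one_mul]

theorem continuous_invFourier {g : E d → ℂ} (hg : Integrable g) : Continuous (invFourier g) := by
  have h : invFourier g = fun x => (fc d : ℂ) * 𝓕 g ((-(2 * Real.pi)⁻¹) • x) :=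
    funext (invFourier_eq g)
  rw [h]
  have h2 : Continuous (𝓕 g) := VectorFourier.fourierIntegral_continuous
    Real.continuous_fourierChar (continuous_inner (𝕜 := ℝ) (E := E d)) hg
  fun_prop

theorem invFourier_const_mul (a : ℂ) (g : E d → ℂ) (x : E d) :
    invFourier (fun ξ => a * g ξ) x = a * invFourier g x := by
  simp only [invFourier]
  rw [mul_left_comm, ← integral_const_mul a]
  congr 2
  funext ξ
  ring

/-- The function of `W` with a given integrable Fourier transform. -/
def Wiener.ofIntegrable (g : E d → ℂ) (hg : Integrable g) : Wiener d :=
  Wiener.hat.symm (hg.toL1 g)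

namespace Wiener

theorem ext {f g : Wiener d} (h : ∀ x, f x = g x) : f = g := Subtype.ext (funext h)

@[simp] theorem add_apply (f g : Wiener d) (x : E d) : (f + g) x = f x + g x := rfl
@[simp] theorem sub_apply (f g : Wiener d) (x : E d) : (f - g) x = f x - g x := rfl
@[simp] theorem neg_apply (f : Wiener d) (x : E d) : (-f) x = -f x := rfl
@[simp] theorem zero_apply (x : E d) : (0 : Wiener d) x = 0 := rfl
@[simp] theorem smul_apply (a : ℂ) (f : Wiener d) (x : E d) : (a • f) x = a * f x := rfl

theorem integrable_hat (f : Wiener d) : Integrable (hat f) := L1.integrable_coeFn (hat f)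

theorem hat_ofIntegrable {g : E d → ℂ} (hg : Integrable g) :
    (hat (ofIntegrable g hg) : E d → ℂ) =ᵐ[volume] g := by
  rw [ofIntegrable, LinearEquiv.apply_symm_apply]
  exact hg.coeFn_toL1

theorem ofIntegrable_apply {g : E d → ℂ} (hg : Integrable g) (x : E d) :
    ofIntegrable g hg x = invFourier g x := by
  rw [eq_invFourier_hat, invFourier_congr (hat_ofIntegrable hg)]

theorem norm_ofIntegrable {g : E d → ℂ} (hg : Integrable g) :
    ‖ofIntegrable g hg‖ = ∫ ξ, ‖g ξ‖ := by
  rw [norm_eq_integral]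
  refine integral_congr_ae ?_
  filter_upwards [hat_ofIntegrable hg] with ξ hξ
  rw [hξ]

theorem eq_of_hat_ae_eq {f g : Wiener d}
    (h : (hat f : E d → ℂ) =ᵐ[volume] (hat g : E d → ℂ)) : f = g :=
  hat.injective (Lp.ext h)

theorem hat_add (f g : Wiener d) :
    (hat (f + g) : E d → ℂ) =ᵐ[volume] fun ξ => hat f ξ + hat g ξ := by
  rw [map_add]
  exact Lp.coeFn_add _ _

theorem hat_sub (f g : Wiener d) :
    (hat (f - g) : E d → ℂ) =ᵐ[volume] fun ξ => hat f ξ - hat g ξ := by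
  rw [map_sub]
  exact Lp.coeFn_sub _ _

theorem hat_smul (a : ℂ) (f : Wiener d) :
    (hat (a • f) : E d → ℂ) =ᵐ[volume] fun ξ => a * hat f ξ := by
  rw [map_smul]
  exact Lp.coeFn_smul _ _

/-- The Fourier transform as an isometry of `W` onto `L¹`. -/
def hatₗᵢ : Wiener d ≃ₗᵢ[ℂ] Lp ℂ 1 (volume : Measure (E d)) :=
  { hat with norm_map' := fun _ => rfl }

instance : CompleteSpace (Wiener d) :=
  (hatₗᵢ (d := d)).toIsometryEquiv.completeSpace

theorem norm_apply_le (f : Wiener d) (x : E d) : ‖f x‖ ≤ fc d * ‖f‖ := by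
  rw [eq_invFourier_hat, norm_eq_integral]
  exact norm_invFourier_le _ _

theorem continuous_apply (f : Wiener d) : Continuous fun x => f x := by
  have : (fun x => f x) = invFourier (hat f) := funext (eq_invFourier_hat f)
  rw [this]
  exact continuous_invFourier (integrable_hat f)

/-- Evaluation at a point, as a continuous linear form on `W`. -/
def evalCLM (x : E d) : Wiener d →L[ℂ] ℂ :=
  LinearMap.mkContinuous
    { toFun := fun f => f x, map_add' := fun _ _ => rfl, map_smul' := fun _ _ => rfl }
    (fc d) fun f => norm_apply_le f x

/-! ### Products -/

/-- The convolution of the Fourier transforms, `(2π)^{d/2}` times the Fourier transform of the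
product. -/
def hatConv (f g : Wiener d) : E d → ℂ :=
  (hat f : E d → ℂ) ⋆[ContinuousLinearMap.mul ℂ ℂ, volume] (hat g : E d → ℂ)

theorem integrable_hatConv (f g : Wiener d) : Integrable (hatConv f g) :=
  (integrable_hat f).integrable_convolution _ (integrable_hat g)

theorem integral_norm_hatConv_le (f g : Wiener d) : ∫ ξ, ‖hatConv f g ξ‖ ≤ ‖f‖ * ‖g‖ := by
  have hf := (integrable_hat f).norm
  have hg := (integrable_hat g).norm
  have h := integral_convolution (ContinuousLinearMap.mul ℝ ℝ) hf hg
  rw [norm_eq_integral f, norm_eq_integral g]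
  simp only [ContinuousLinearMap.mul_apply'] at h
  rw [← h]
  refine integral_mono_ae (integrable_hatConv f g).norm
    (hf.integrable_convolution (ContinuousLinearMap.mul ℝ ℝ) hg)
    (Filter.Eventually.of_forall fun ξ => ?_)
  simp only [hatConv, convolution_def, ContinuousLinearMap.mul_apply']
  refine (norm_integral_le_integral_norm _).trans_eq ?_
  simp only [norm_mul]

theorem invFourier_hatConv (f g : Wiener d) (x : E d) :
    (fc d : ℂ) * invFourier (hatConv f g) x = f x * g x := by
  rw [eq_invFourier_hat f, eq_invFourier_hat g, invFourier_eq, invFourier_eq, invFourier_eq,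
    hatConv, Real.fourier_mul_convolution_eq (integrable_hat f) (integrable_hat g)]
  ring

/-- The pointwise product in `W`. -/
def prod (f g : Wiener d) : Wiener d :=
  ofIntegrable (fun ξ => (fc d : ℂ) * hatConv f g ξ) ((integrable_hatConv f g).const_mul _)

@[simp] theorem prod_apply (f g : Wiener d) (x : E d) : prod f g x = f x * g x := by
  rw [prod, ofIntegrable_apply, invFourier_const_mul, invFourier_hatConv]

theorem hat_prod (f g : Wiener d) :
    (hat (prod f g) : E d → ℂ) =ᵐ[volume] fun ξ => (fc d : ℂ) * hatConv f g ξ :=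
  hat_ofIntegrable _

theorem norm_prod_le (f g : Wiener d) : ‖prod f g‖ ≤ fc d * ‖f‖ * ‖g‖ := by
  rw [prod, norm_ofIntegrable]
  simp only [norm_mul, Complex.norm_real, Real.norm_of_nonneg (fc_pos d).le]
  rw [integral_const_mul, mul_assoc]
  exact mul_le_mul_of_nonneg_left (integral_norm_hatConv_le f g) (fc_pos d).le

/-- The pointwise product in `W`, as a continuous bilinear map. -/
def mul : Wiener d →L[ℂ] Wiener d →L[ℂ] Wiener d :=
  LinearMap.mkContinuous₂
    (LinearMap.mk₂ ℂ prod
      (fun _ _ _ => ext fun x => by simp [add_mul])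
      (fun _ _ _ => ext fun x => by simp [mul_assoc])
      (fun _ _ _ => ext fun x => by simp [mul_add])
      (fun _ _ _ => ext fun x => by simp [mul_left_comm]))
    (fc d) norm_prod_le

theorem mul_def (f g : Wiener d) : mul f g = prod f g := rfl

@[simp] theorem mul_apply (f g : Wiener d) (x : E d) : mul f g x = f x * g x := prod_apply f g x

/-! ### Complex conjugation -/

theorem invFourier_conj_neg (g : E d → ℂ) (x : E d) :
    invFourier (fun ξ => starRingEnd ℂ (g (-ξ))) x = starRingEnd ℂ (invFourier g x) := by
  simp only [invFourier, map_mul, Complex.conj_ofReal]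
  rw [← integral_conj]
  congr 1
  rw [← integral_neg_eq_self]
  congr 1
  ext ξ
  rw [map_mul, ← Complex.exp_conj]
  simp

theorem integrable_conj_neg {g : E d → ℂ} (hg : Integrable g) :
    Integrable fun ξ => starRingEnd ℂ (g (-ξ)) :=
  Complex.conjLIE.toContinuousLinearEquiv.toContinuousLinearMap.integrable_comp hg.comp_neg

/-- Complex conjugation on `W`. -/
def conj (f : Wiener d) : Wiener d :=
  ofIntegrable (fun ξ => starRingEnd ℂ (hat f (-ξ)))
    (integrable_conj_neg (integrable_hat f))

@[simp] theorem conj_apply (f : Wiener d) (x : E d) : conj f x = starRingEnd ℂ (f x) := by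
  rw [conj, ofIntegrable_apply, invFourier_conj_neg, ← eq_invFourier_hat]

theorem hat_conj (f : Wiener d) :
    (hat (conj f) : E d → ℂ) =ᵐ[volume] fun ξ => starRingEnd ℂ (hat f (-ξ)) :=
  hat_ofIntegrable _

@[simp] theorem norm_conj (f : Wiener d) : ‖conj f‖ = ‖f‖ := by
  rw [conj, norm_ofIntegrable, norm_eq_integral]
  simp only [RCLike.norm_conj]
  exact integral_neg_eq_self (fun ξ => ‖hat f ξ‖) volume

/-! ### The free group -/

/-- The symbol `e^{-it|ξ|²}`. -/
def symbol (t : ℝ) (ξ : E d) : ℂ := Complex.exp (-(Complex.I * t * (‖ξ‖ : ℂ) ^ 2))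

theorem norm_symbol (t : ℝ) (ξ : E d) : ‖symbol t ξ‖ = 1 := by
  rw [symbol, Complex.norm_exp]
  simp [← Complex.ofReal_pow]

theorem symbol_zero (ξ : E d) : symbol 0 ξ = 1 := by simp [symbol]

theorem symbol_add (s t : ℝ) (ξ : E d) : symbol (s + t) ξ = symbol s ξ * symbol t ξ := by
  rw [symbol, symbol, symbol, ← Complex.exp_add]
  congr 1
  push_cast
  ring

theorem continuous_symbol_right (t : ℝ) : Continuous (symbol t : E d → ℂ) := by
  unfold symbol; fun_prop

theorem continuous_symbol_left (ξ : E d) : Continuous fun t => symbol t ξ := by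
  unfold symbol; fun_prop

/-- Multiplication by the symbol on the Fourier side. -/
theorem hat_schrodinger (t : ℝ) (f : Wiener d) :
    (hat (schrodinger t f) : E d → ℂ) =ᵐ[volume] fun ξ => symbol t ξ * hat f ξ := by
  rw [schrodinger, LinearEquiv.apply_symm_apply]
  exact Integrable.coeFn_toL1 _

/-- The free group `e^{itΔ}` on `W`, as a linear isometry. -/
def group (t : ℝ) : Wiener d →ₗᵢ[ℂ] Wiener d where
  toFun := schrodinger t
  map_add' f g := eq_of_hat_ae_eq <| by
    filter_upwards [hat_schrodinger t (f + g), hat_add f g, hat_schrodinger t f,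
      hat_schrodinger t g, hat_add (schrodinger t f) (schrodinger t g)] with ξ h1 h2 h3 h4 h5
    rw [h1, h2, h5, h3, h4, mul_add]
  map_smul' a f := eq_of_hat_ae_eq <| by
    filter_upwards [hat_schrodinger t (a • f), hat_smul a f, hat_schrodinger t f,
      hat_smul a (schrodinger t f)] with ξ h1 h2 h3 h4
    rw [h1, h2, RingHom.id_apply, h4, h3, mul_left_comm]
  norm_map' f := by
    change ‖schrodinger t f‖ = ‖f‖
    rw [norm_eq_integral, norm_eq_integral]
    refine integral_congr_ae ?_
    filter_upwards [hat_schrodinger t f] with ξ h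
    rw [h, norm_mul, norm_symbol, one_mul]

theorem group_apply (t : ℝ) (f : Wiener d) : group t f = schrodinger t f := rfl

theorem hat_group (t : ℝ) (f : Wiener d) :
    (hat (group t f) : E d → ℂ) =ᵐ[volume] fun ξ => symbol t ξ * hat f ξ := hat_schrodinger t f

theorem group_zero (f : Wiener d) : group 0 f = f := eq_of_hat_ae_eq <| by
  filter_upwards [hat_group 0 f] with ξ h
  rw [h, symbol_zero, one_mul]

theorem group_add (s t : ℝ) (f : Wiener d) : group (s + t) f = group s (group t f) :=
  eq_of_hat_ae_eq <| by
    filter_upwards [hat_group (s + t) f, hat_group t f, hat_group s (group t f)] with ξ h1 h2 h3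
    rw [h1, h3, h2, symbol_add, mul_assoc]

theorem continuous_group (f : Wiener d) : Continuous fun t => group t f := by
  refine continuous_iff_continuousAt.2 fun s => ?_
  rw [ContinuousAt, tendsto_iff_norm_sub_tendsto_zero]
  have h : ∀ t, ‖group t f - group s f‖ = ∫ ξ, ‖(symbol t ξ - symbol s ξ) * hat f ξ‖ := by
    intro t
    rw [norm_eq_integral]
    refine integral_congr_ae ?_
    filter_upwards [hat_sub (group t f) (group s f), hat_group t f, hat_group s f] with ξ h1 h2 h3
    rw [h1, h2, h3, sub_mul]
  simp only [h]
  have h0 : ∫ ξ, ‖(symbol s ξ - symbol s ξ) * hat f ξ‖ = 0 := by simp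
  rw [← h0]
  refine tendsto_integral_filter_of_dominated_convergence (fun ξ => 2 * ‖hat f ξ‖) ?_ ?_ ?_ ?_
  · refine Filter.Eventually.of_forall fun t => ?_
    exact ((((continuous_symbol_right t).sub
      (continuous_symbol_right s)).aestronglyMeasurable).mul
      (integrable_hat f).aestronglyMeasurable).norm
  · refine Filter.Eventually.of_forall fun t => Filter.Eventually.of_forall fun ξ => ?_
    rw [norm_norm, norm_mul]
    refine mul_le_mul_of_nonneg_right ?_ (norm_nonneg _)
    refine (norm_sub_le _ _).trans ?_
    rw [norm_symbol, norm_symbol]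
    norm_num
  · exact (integrable_hat f).norm.const_mul 2
  · refine Filter.Eventually.of_forall fun ξ => ?_
    exact ((((continuous_symbol_left ξ).sub continuous_const).mul
      continuous_const).norm).tendsto s

end Wiener

/-! ### Plancherel's theorem on `L¹` -/

/-- The `L¹` and the `L²` Fourier transforms, tested against Schwartz functions, are both given by
the multiplication formula; they agree on `L¹ ∩ L²` because of it. -/
theorem integral_schwartz_mul_fourier {g : E d → ℂ} (hg : Integrable g) (φ : 𝓢(E d, ℂ)) :
    ∫ x, φ x * 𝓕 g x = ∫ ξ, 𝓕 φ ξ * g ξ := by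
  have h3 := VectorFourier.integral_fourierIntegral_smul_eq_flip (L := innerₗ (E d))
    Real.continuous_fourierChar (continuous_inner (𝕜 := ℝ) (E := E d)) φ.integrable hg
    (μ := volume) (ν := volume)
  simp only [flip_innerₗ, smul_eq_mul] at h3
  exact h3.symm

theorem integral_schwartz_mul_fourier_L2 (G : Lp ℂ 2 (volume : Measure (E d))) (φ : 𝓢(E d, ℂ)) :
    ∫ x, φ x * (𝓕 G : Lp ℂ 2 (volume : Measure (E d))) x = ∫ ξ, 𝓕 φ ξ * G ξ := by
  have h := congrArg (fun T : 𝓢'(E d, ℂ) => T φ) (Lp.fourier_toTemperedDistribution_eq G)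
  simp only [TemperedDistribution.fourier_apply, Lp.toTemperedDistribution_apply,
    smul_eq_mul] at h
  exact h.symm

theorem ae_eq_of_integral_schwartz_mul_eq {f g : E d → ℂ} (hf : LocallyIntegrable f)
    (hg : LocallyIntegrable g) (h : ∀ φ : 𝓢(E d, ℂ), ∫ x, φ x * f x = ∫ x, φ x * g x) :
    f =ᵐ[volume] g := by
  refine ae_eq_of_integral_contDiff_smul_eq hf hg fun φ hφ hφc => ?_
  have hc : HasCompactSupport (fun x => (φ x : ℂ)) := hφc.comp_left (g := Complex.ofReal) rfl
  have hs : ContDiff ℝ ((⊤ : ℕ∞) : WithTop ℕ∞) (fun x => (φ x : ℂ)) :=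
    Complex.ofRealCLM.contDiff.comp hφ
  simpa using h (hc.toSchwartzMap hs)

theorem fourier_ae_eq_of_memLp {g : E d → ℂ} (hg : Integrable g) (h2 : MemLp g 2) :
    𝓕 g =ᵐ[volume] (𝓕 (h2.toLp g) : Lp ℂ 2 (volume : Measure (E d))) := by
  have hc : Continuous (𝓕 g) := VectorFourier.fourierIntegral_continuous
    Real.continuous_fourierChar (continuous_inner (𝕜 := ℝ) (E := E d)) hg
  refine ae_eq_of_integral_schwartz_mul_eq hc.locallyIntegrable
    ((Lp.memLp _).locallyIntegrable (by norm_num)) fun φ => ?_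
  rw [integral_schwartz_mul_fourier hg, integral_schwartz_mul_fourier_L2]
  refine integral_congr_ae ?_
  filter_upwards [h2.coeFn_toLp] with x hx
  rw [hx]

/-- The converse of Plancherel: without it the `L²` norms could not be compared when one of them
is not known to be finite. -/
theorem memLp_of_memLp_fourier {g : E d → ℂ} (hg : Integrable g) (h2 : MemLp (𝓕 g) 2) :
    MemLp g 2 := by
  set H : Lp ℂ 2 (volume : Measure (E d)) := h2.toLp _
  have h : g =ᵐ[volume] (𝓕⁻ H : Lp ℂ 2 (volume : Measure (E d))) := by
    refine ae_eq_of_integral_schwartz_mul_eq hg.locallyIntegrable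
      ((Lp.memLp _).locallyIntegrable (by norm_num)) fun χ => ?_
    obtain ⟨φ, rfl⟩ : ∃ φ : 𝓢(E d, ℂ), 𝓕 φ = χ := ⟨𝓕⁻ χ, FourierTransform.fourier_fourierInv_eq χ⟩
    rw [← integral_schwartz_mul_fourier hg, ← integral_schwartz_mul_fourier_L2,
      FourierTransform.fourier_fourierInv_eq]
    refine integral_congr_ae ?_
    filter_upwards [h2.coeFn_toLp] with x hx
    rw [hx]
  exact (memLp_congr_ae h).2 (Lp.memLp _)

theorem eLpNorm_fourier {g : E d → ℂ} (hg : Integrable g) :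
    eLpNorm (𝓕 g) 2 volume = eLpNorm g 2 volume := by
  have hc : Continuous (𝓕 g) := VectorFourier.fourierIntegral_continuous
    Real.continuous_fourierChar (continuous_inner (𝕜 := ℝ) (E := E d)) hg
  by_cases h2 : MemLp g 2
  · rw [eLpNorm_congr_ae (fourier_ae_eq_of_memLp hg h2), ← Lp.enorm_def,
      ← eLpNorm_congr_ae h2.coeFn_toLp, ← Lp.enorm_def]
    rw [← ofReal_norm, ← ofReal_norm, Lp.norm_fourier_eq]
  · have h3 : ¬ MemLp (𝓕 g) 2 := fun h => h2 (memLp_of_memLp_fourier hg h)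
    have e1 : eLpNorm g 2 volume = ∞ := by
      by_contra h; exact h2 ⟨hg.aestronglyMeasurable, lt_top_iff_ne_top.2 h⟩
    have e2 : eLpNorm (𝓕 g) 2 volume = ∞ := by
      by_contra h; exact h3 ⟨hc.aestronglyMeasurable, lt_top_iff_ne_top.2 h⟩
    rw [e1, e2]

/-- Plancherel's theorem, in the form that an integrable function and its inverse Fourier
transform have the same `L²` norm, finite or not. -/
theorem eLpNorm_invFourier {g : E d → ℂ} (hg : Integrable g) :
    eLpNorm (invFourier g) 2 volume = eLpNorm g 2 volume := by
  have hc : Continuous (𝓕 g) := VectorFourier.fourierIntegral_continuous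
    Real.continuous_fourierChar (continuous_inner (𝕜 := ℝ) (E := E d)) hg
  set a : ℝ := -(2 * Real.pi)⁻¹ with ha
  have ha0 : a ≠ 0 := by rw [ha]; exact neg_ne_zero.2 (by positivity)
  have h : invFourier g = (fc d : ℂ) • ((𝓕 g) ∘ fun x => a • x) := by
    funext x
    rw [invFourier_eq]
    rfl
  have hm : eLpNorm ((𝓕 g) ∘ fun x => a • x) 2 volume
      = ENNReal.ofReal ((fc d)⁻¹) * eLpNorm (𝓕 g) 2 volume := by
    rw [← eLpNorm_map_measure (by exact hc.aestronglyMeasurable) (by fun_prop),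
      Measure.map_addHaar_smul _ ha0, eLpNorm_smul_measure_of_ne_top (by norm_num),
      smul_eq_mul]
    congr 1
    rw [ENNReal.ofReal_rpow_of_nonneg (by positivity) (by norm_num), finrank_euclideanSpace_fin]
    congr 1
    rw [← rpow_half_eq_inv_fc, ha, ← inv_pow, inv_neg, inv_inv, abs_pow, abs_neg,
      abs_of_pos (by positivity), ← Real.rpow_natCast, ← Real.rpow_mul (by positivity)]
    congr 1
    simp
    ring
  rw [h, eLpNorm_const_smul, hm, eLpNorm_fourier hg, ← mul_assoc]
  have : ‖(fc d : ℂ)‖ₑ * ENNReal.ofReal ((fc d)⁻¹) = 1 := by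
    rw [← ofReal_norm, Complex.norm_real, Real.norm_of_nonneg (fc_pos d).le,
      ← ENNReal.ofReal_mul (fc_pos d).le, mul_inv_cancel₀ (fc_pos d).ne', ENNReal.ofReal_one]
  rw [this, one_mul]

theorem Wiener.eLpNorm_hat (f : Wiener d) :
    eLpNorm (fun x => f x) 2 volume = eLpNorm (hat f) 2 volume := by
  have : (fun x => f x) = invFourier (hat f) := funext (eq_invFourier_hat f)
  rw [this, eLpNorm_invFourier (integrable_hat f)]

/-! ### The space `L² ∩ W` -/

namespace L2Wiener

open Wiener (hat)

instance : CoeFun (L2Wiener d) (fun _ => E d → ℂ) := ⟨fun f => f.1⟩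

theorem ext {f g : L2Wiener d} (h : ∀ x, f x = g x) : f = g := Subtype.ext (funext h)

@[simp] theorem toW_apply (f : L2Wiener d) (x : E d) : toW f x = f x := rfl
@[simp] theorem add_apply (f g : L2Wiener d) (x : E d) : (f + g) x = f x + g x := rfl
@[simp] theorem smul_apply (a : ℂ) (f : L2Wiener d) (x : E d) : (a • f) x = a * f x := rfl

theorem toW_injective : Function.Injective (toW (d := d)) := fun _ _ h =>
  ext fun x => congrArg (fun z : Wiener d => z x) h

theorem memLp (f : L2Wiener d) : MemLp (fun x => f x) 2 volume := f.2.2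

theorem memLp_hat (f : L2Wiener d) : MemLp (hat f.toW) 2 volume :=
  ⟨(Wiener.integrable_hat _).aestronglyMeasurable,
    (Wiener.eLpNorm_hat f.toW).symm ▸ f.memLp.2⟩

/-- The Fourier transform of `f ∈ L² ∩ W`, as an element of `L²`. -/
def hatL2 (f : L2Wiener d) : Lp ℂ 2 (volume : Measure (E d)) := (memLp_hat f).toLp _

theorem coeFn_hatL2 (f : L2Wiener d) :
    (hatL2 f : E d → ℂ) =ᵐ[volume] (hat f.toW : E d → ℂ) := MemLp.coeFn_toLp _

theorem coeFn_toL2 (f : L2Wiener d) : (toL2 f : E d → ℂ) =ᵐ[volume] fun x => f x :=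
  MemLp.coeFn_toLp f.2.2

theorem norm_hatL2 (f : L2Wiener d) : ‖hatL2 f‖ = ‖toL2 f‖ := by
  have h : ‖hatL2 f‖ = (eLpNorm (hat f.toW) 2 volume).toReal := Lp.norm_toLp _ _
  rw [h, ← Wiener.eLpNorm_hat]
  exact (Lp.norm_toLp _ f.2.2).symm

theorem norm_toL2 (f : L2Wiener d) : ‖toL2 f‖ = (eLpNorm (fun x => f x) 2 volume).toReal :=
  Lp.norm_toLp _ f.2.2

/-- An element of `W` with square integrable Fourier transform, as an element of `L² ∩ W`. -/
def ofW (f : Wiener d) (h : MemLp (hat f) 2 volume) : L2Wiener d :=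
  ⟨f.1, f.2, ⟨(Wiener.continuous_apply f).aestronglyMeasurable,
    (Wiener.eLpNorm_hat f) ▸ h.2⟩⟩

theorem norm_toW_le (f : L2Wiener d) : ‖toW f‖ ≤ ‖f‖ := le_max_left _ _
theorem norm_toL2_le (f : L2Wiener d) : ‖toL2 f‖ ≤ ‖f‖ := le_max_right _ _

/-- The inclusion `L² ∩ W ⊆ W`, as a continuous linear map. -/
def toWL : L2Wiener d →L[ℂ] Wiener d :=
  toW.mkContinuous 1 fun f => by simpa using norm_toW_le f

/-- The inclusion `L² ∩ W ⊆ L²`, as a continuous linear map. -/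
def toL2L : L2Wiener d →L[ℂ] Lp ℂ 2 (volume : Measure (E d)) :=
  toL2.mkContinuous 1 fun f => by simpa using norm_toL2_le f

theorem isometry_prod : Isometry ((toW (d := d)).prod toL2) :=
  AddMonoidHomClass.isometry_of_norm _ fun _ => rfl

/-- The embedding in `W × L²` has a closed range: the two components of a limit of pairs `(f, f)`
agree almost everywhere, as convergence in `W` is uniform. -/
instance : CompleteSpace (L2Wiener d) := by
  rw [completeSpace_iff_isComplete_range (isometry_prod (d := d)).isUniformInducing]
  refine IsClosed.isComplete (IsSeqClosed.isClosed fun x p hx hp => ?_)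
  choose f hf using hx
  have h1 : Filter.Tendsto (fun n => toW (f n)) Filter.atTop (nhds p.1) := by
    have := (continuous_fst.tendsto p).comp hp
    refine this.congr fun n => ?_
    simp [← hf n]
  have h2 : Filter.Tendsto (fun n => toL2 (f n)) Filter.atTop (nhds p.2) := by
    have := (continuous_snd.tendsto p).comp hp
    refine this.congr fun n => ?_
    simp [← hf n]
  obtain ⟨ns, hns, hae⟩ := (tendstoInMeasure_of_tendsto_Lp h2).exists_seq_tendsto_ae
  have hpe : (p.2 : E d → ℂ) =ᵐ[volume] fun x => p.1 x := by
    filter_upwards [hae, ae_all_iff.2 fun n => coeFn_toL2 (f n)] with x hx hx2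
    have h3 : Filter.Tendsto (fun n => toL2 (f (ns n)) x) Filter.atTop (nhds (p.1 x)) := by
      have := ((Wiener.evalCLM x).continuous.tendsto p.1).comp (h1.comp hns.tendsto_atTop)
      refine this.congr fun n => ?_
      rw [hx2]
      rfl
    exact tendsto_nhds_unique hx h3
  have hm : MemLp (fun x => p.1 x) 2 volume := (memLp_congr_ae hpe).1 (Lp.memLp _)
  refine ⟨⟨p.1.1, p.1.2, hm⟩, Prod.ext rfl ?_⟩
  exact Lp.ext ((MemLp.coeFn_toLp hm).trans hpe.symm)

/-! ### The module structure over `W` and the free group -/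

theorem norm_le_iff {f : L2Wiener d} {a : ℝ} : ‖f‖ ≤ a ↔ ‖toW f‖ ≤ a ∧ ‖toL2 f‖ ≤ a := max_le_iff

theorem eLpNorm_mul_le (g : Wiener d) (f : L2Wiener d) :
    eLpNorm (fun x => g x * f x) 2 volume
      ≤ ENNReal.ofReal (fc d * ‖g‖) * eLpNorm (fun x => f x) 2 volume := by
  refine eLpNorm_le_mul_eLpNorm_of_ae_le_mul (Filter.Eventually.of_forall fun x => ?_) 2
  rw [norm_mul]
  exact mul_le_mul_of_nonneg_right (Wiener.norm_apply_le g x) (norm_nonneg _)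

/-- The product of `g ∈ W` and `f ∈ L² ∩ W`. -/
def smulW (g : Wiener d) (f : L2Wiener d) : L2Wiener d :=
  ⟨(Wiener.prod g (toW f)).1, (Wiener.prod g (toW f)).2, by
    have h : (Wiener.prod g (toW f)).1 = fun x => g x * f x := funext fun x => by
      rw [Wiener.prod_apply]; rfl
    rw [h]
    exact ⟨((Wiener.continuous_apply g).mul
        (Wiener.continuous_apply (toW f))).aestronglyMeasurable,
      (eLpNorm_mul_le g f).trans_lt (ENNReal.mul_lt_top ENNReal.ofReal_lt_top f.memLp.2)⟩⟩

@[simp] theorem smulW_apply (g : Wiener d) (f : L2Wiener d) (x : E d) :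
    smulW g f x = g x * f x := Wiener.prod_apply g (toW f) x

theorem toW_smulW (g : Wiener d) (f : L2Wiener d) : toW (smulW g f) = Wiener.mul g (toW f) := rfl

theorem norm_toL2_smulW_le (g : Wiener d) (f : L2Wiener d) :
    ‖toL2 (smulW g f)‖ ≤ fc d * ‖g‖ * ‖toL2 f‖ := by
  have h0 : 0 ≤ fc d * ‖g‖ := mul_nonneg (fc_pos d).le (norm_nonneg _)
  rw [norm_toL2, norm_toL2]
  have h := ENNReal.toReal_mono (ENNReal.mul_ne_top ENNReal.ofReal_ne_top f.memLp.2.ne)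
    (eLpNorm_mul_le g f)
  rw [ENNReal.toReal_mul, ENNReal.toReal_ofReal h0] at h
  simpa only [smulW_apply] using h

theorem norm_smulW_le (g : Wiener d) (f : L2Wiener d) : ‖smulW g f‖ ≤ fc d * ‖g‖ * ‖f‖ := by
  have h0 : 0 ≤ fc d * ‖g‖ := mul_nonneg (fc_pos d).le (norm_nonneg _)
  refine norm_le_iff.2 ⟨?_, ?_⟩
  · exact (Wiener.norm_prod_le g (toW f)).trans (mul_le_mul_of_nonneg_left (norm_toW_le f) h0)
  · exact (norm_toL2_smulW_le g f).trans (mul_le_mul_of_nonneg_left (norm_toL2_le f) h0)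

/-- The product `W × (L² ∩ W) → L² ∩ W`, as a continuous bilinear map. -/
def mul : Wiener d →L[ℂ] L2Wiener d →L[ℂ] L2Wiener d :=
  LinearMap.mkContinuous₂
    (LinearMap.mk₂ ℂ smulW
      (fun _ _ _ => ext fun x => by simp [add_mul])
      (fun _ _ _ => ext fun x => by simp [mul_assoc])
      (fun _ _ _ => ext fun x => by simp [mul_add])
      (fun _ _ _ => ext fun x => by simp [mul_left_comm]))
    (fc d) norm_smulW_le

theorem mul_def (g : Wiener d) (f : L2Wiener d) : mul g f = smulW g f := rfl

@[simp] theorem mul_apply (g : Wiener d) (f : L2Wiener d) (x : E d) :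
    mul g f x = g x * f x := smulW_apply g f x

theorem eLpNorm_hat_group (t : ℝ) (f : Wiener d) :
    eLpNorm (hat (Wiener.group t f)) 2 volume = eLpNorm (hat f) 2 volume := by
  refine eLpNorm_congr_norm_ae ?_
  filter_upwards [Wiener.hat_group t f] with ξ h
  rw [h, norm_mul, Wiener.norm_symbol, one_mul]

theorem norm_toL2_eq_hat (f : L2Wiener d) :
    ‖toL2 f‖ = (eLpNorm (hat f.toW) 2 volume).toReal := by
  rw [norm_toL2, ← Wiener.eLpNorm_hat]
  rfl

theorem memLp_hat_group (t : ℝ) (f : L2Wiener d) :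
    MemLp (hat (Wiener.group t (toW f))) 2 volume :=
  ⟨(Wiener.integrable_hat _).aestronglyMeasurable,
    (eLpNorm_hat_group t (toW f)).symm ▸ (memLp_hat f).2⟩

theorem norm_toL2_ofW_group (t : ℝ) (f : L2Wiener d) :
    ‖toL2 (ofW (Wiener.group t (toW f)) (memLp_hat_group t f))‖ = ‖toL2 f‖ := by
  rw [norm_toL2_eq_hat, norm_toL2_eq_hat]
  exact congrArg _ (eLpNorm_hat_group t (toW f))

/-- The free group `e^{itΔ}` on `L² ∩ W`, as a linear map. -/
def groupLin (t : ℝ) : L2Wiener d →ₗ[ℂ] L2Wiener d where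
  toFun f := ofW (Wiener.group t (toW f)) (memLp_hat_group t f)
  map_add' f g := toW_injective (by
    change Wiener.group t (toW (f + g)) = Wiener.group t (toW f) + Wiener.group t (toW g)
    rw [map_add, map_add])
  map_smul' a f := toW_injective (by
    change Wiener.group t (toW (a • f)) = a • Wiener.group t (toW f)
    rw [map_smul, map_smul])

/-- The free group `e^{itΔ}` on `L² ∩ W`, as a linear isometry. -/
def group (t : ℝ) : L2Wiener d →ₗᵢ[ℂ] L2Wiener d :=
  ⟨groupLin t, fun f => by
    rw [norm_eq, norm_eq]
    exact congrArg₂ max ((Wiener.group t).norm_map _) (norm_toL2_ofW_group t f)⟩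

theorem toW_group (t : ℝ) (f : L2Wiener d) : toW (group t f) = Wiener.group t (toW f) :=
  rfl

theorem norm_toL2_group (t : ℝ) (f : L2Wiener d) : ‖toL2 (group t f)‖ = ‖toL2 f‖ :=
  norm_toL2_ofW_group t f

theorem norm_toL2_sq (f : L2Wiener d) : ‖toL2 f‖ ^ 2 = ∫ ξ, ‖hat (toW f) ξ‖ ^ 2 := by
  rw [← norm_hatL2]
  have h := L2.inner_def (𝕜 := ℂ) (hatL2 f) (hatL2 f)
  simp only [inner_self_eq_norm_sq_to_K, Complex.coe_algebraMap] at h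
  have h2 : ∫ ξ, ((‖hatL2 f ξ‖ : ℂ)) ^ 2 = ((∫ ξ, ‖hatL2 f ξ‖ ^ 2 : ℝ) : ℂ) := by
    rw [← integral_complex_ofReal]
    simp
  rw [h2] at h
  have h3 : ‖hatL2 f‖ ^ 2 = ∫ ξ, ‖hatL2 f ξ‖ ^ 2 := by exact_mod_cast h
  rw [h3]
  refine integral_congr_ae ?_
  filter_upwards [coeFn_hatL2 f] with ξ hξ
  rw [hξ]

theorem integrable_norm_hat_sq (f : L2Wiener d) :
    Integrable fun ξ => ‖hat (toW f) ξ‖ ^ 2 := (memLp_hat f).integrable_norm_pow (by norm_num)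

theorem group_zero (f : L2Wiener d) : group 0 f = f :=
  toW_injective (by rw [toW_group, Wiener.group_zero])

theorem group_add (s t : ℝ) (f : L2Wiener d) : group (s + t) f = group s (group t f) :=
  toW_injective (by rw [toW_group, toW_group, toW_group, Wiener.group_add])

theorem continuous_group (f : L2Wiener d) : Continuous fun t => group t f := by
  refine continuous_iff_continuousAt.2 fun s => ?_
  rw [ContinuousAt, tendsto_iff_norm_sub_tendsto_zero]
  have hW : Filter.Tendsto (fun t => ‖toW (group t f - group s f)‖) (nhds s) (nhds 0) := by
    have := tendsto_iff_norm_sub_tendsto_zero.1 ((Wiener.continuous_group (toW f)).tendsto s)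
    refine this.congr fun t => ?_
    rw [map_sub, toW_group, toW_group]
  have h : ∀ t, ‖toL2 (group t f - group s f)‖ ^ 2 =
      ∫ ξ, ‖(Wiener.symbol t ξ - Wiener.symbol s ξ) * hat (toW f) ξ‖ ^ 2 := by
    intro t
    rw [norm_toL2_sq]
    refine integral_congr_ae ?_
    rw [map_sub, toW_group, toW_group]
    filter_upwards [Wiener.hat_sub (Wiener.group t (toW f)) (Wiener.group s (toW f)),
      Wiener.hat_group t (toW f), Wiener.hat_group s (toW f)] with ξ h1 h2 h3
    rw [h1, h2, h3, sub_mul]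
  have hL : Filter.Tendsto (fun t => ‖toL2 (group t f - group s f)‖) (nhds s) (nhds 0) := by
    have hsq : Filter.Tendsto (fun t => ‖toL2 (group t f - group s f)‖ ^ 2) (nhds s) (nhds 0) := by
      simp only [h]
      have h0 : ∫ ξ, ‖(Wiener.symbol s ξ - Wiener.symbol s ξ) * hat (toW f) ξ‖ ^ 2 = 0 := by simp
      rw [← h0]
      refine tendsto_integral_filter_of_dominated_convergence
        (fun ξ => 4 * ‖hat (toW f) ξ‖ ^ 2) ?_ ?_ ?_ ?_
      · refine Filter.Eventually.of_forall fun t => ?_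
        exact (((((Wiener.continuous_symbol_right t).sub
          (Wiener.continuous_symbol_right s)).aestronglyMeasurable).mul
          (Wiener.integrable_hat (toW f)).aestronglyMeasurable).norm).pow 2
      · refine Filter.Eventually.of_forall fun t => Filter.Eventually.of_forall fun ξ => ?_
        rw [norm_pow, norm_norm, norm_mul, mul_pow]
        refine mul_le_mul_of_nonneg_right ?_ (by positivity)
        have : ‖Wiener.symbol t ξ - Wiener.symbol s ξ‖ ≤ 2 := by
          refine (norm_sub_le _ _).trans ?_
          rw [Wiener.norm_symbol, Wiener.norm_symbol]
          norm_num
        nlinarith [norm_nonneg (Wiener.symbol t ξ - Wiener.symbol s ξ)]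
      · exact (integrable_norm_hat_sq f).const_mul 4
      · refine Filter.Eventually.of_forall fun ξ => ?_
        exact (((((Wiener.continuous_symbol_left ξ).sub continuous_const).mul
          continuous_const).norm).pow 2).tendsto s
    have := hsq.sqrt
    rw [Real.sqrt_zero] at this
    refine this.congr fun t => ?_
    rw [Real.sqrt_sq (norm_nonneg _)]
  have := hW.max hL
  rw [max_self] at this
  exact this

/-! ### Fourier transforms of products of square integrable functions -/

/-- By the Cauchy–Schwarz inequality; this is where the `L²` norm gains over the `W` norm. -/
theorem norm_hatConv_le (f g : L2Wiener d) (ξ : E d) :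
    ‖Wiener.hatConv (toW f) (toW g) ξ‖ ≤ ‖toL2 f‖ * ‖toL2 g‖ := by
  rw [Wiener.hatConv, convolution_def]
  refine (norm_integral_le_integral_norm _).trans ?_
  simp only [ContinuousLinearMap.mul_apply', norm_mul]
  have hp : (2 : ℝ).HolderConjugate 2 := by
    rw [Real.holderConjugate_iff]; norm_num
  have e2 : ENNReal.ofReal 2 = 2 := by norm_num
  have hg := (memLp_hat g).comp_measurePreserving (Measure.measurePreserving_sub_left volume ξ)
  have h := integral_mul_norm_le_Lp_mul_Lq hp (μ := volume) (f := hat (toW f))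
    (g := fun t => hat (toW g) (ξ - t)) (by rw [e2]; exact memLp_hat f) (by rw [e2]; exact hg)
  refine h.trans_eq ?_
  rw [integral_sub_left_eq_self (fun t => ‖hat (toW g) t‖ ^ (2 : ℝ)) volume ξ]
  simp only [Real.rpow_two]
  rw [← norm_toL2_sq, ← norm_toL2_sq, ← Real.sqrt_eq_rpow, ← Real.sqrt_eq_rpow, Real.sqrt_sq (norm_nonneg _),
    Real.sqrt_sq (norm_nonneg _)]

end L2Wiener

/-! ### Spaces of initial data and interactions -/

/-- A space of initial data `S ⊆ W` on which the free group acts by isometries, strongly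
continuously, and on which the functions of `W` act by multiplication. -/
structure StateSpace (d : ℕ) (S : Type) [NormedAddCommGroup S] [NormedSpace ℂ S] where
  /-- The inclusion in `W`. -/
  toW : S →L[ℂ] Wiener d
  injective : Function.Injective toW
  /-- The free group on `S`. -/
  group : ℝ → S →ₗᵢ[ℂ] S
  toW_group : ∀ t f, toW (group t f) = Wiener.group t (toW f)
  continuous_group : ∀ f, Continuous fun t => group t f
  /-- The multiplication by functions of `W`. -/
  mul : Wiener d →L[ℂ] S →L[ℂ] S
  toW_mul : ∀ g f, toW (mul g f) = Wiener.mul g (toW f)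

/-- `W` as a space of initial data. -/
def wienerSpace (d : ℕ) : StateSpace d (Wiener d) where
  toW := ContinuousLinearMap.id ℂ _
  injective := Function.injective_id
  group := Wiener.group
  toW_group _ _ := rfl
  continuous_group := Wiener.continuous_group
  mul := Wiener.mul
  toW_mul _ _ := rfl

/-- `L² ∩ W` as a space of initial data. -/
def l2WienerSpace (d : ℕ) : StateSpace d (L2Wiener d) where
  toW := L2Wiener.toWL
  injective := L2Wiener.toW_injective
  group := L2Wiener.group
  toW_group _ _ := rfl
  continuous_group := L2Wiener.continuous_group
  mul := L2Wiener.mul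
  toW_mul _ _ := rfl

section

variable {S : Type} [NormedAddCommGroup S] [NormedSpace ℂ S]

namespace StateSpace

variable (A : StateSpace d S)

theorem group_zero (f : S) : A.group 0 f = f :=
  A.injective (by rw [A.toW_group, Wiener.group_zero])

theorem group_add (s t : ℝ) (f : S) : A.group (s + t) f = A.group s (A.group t f) :=
  A.injective (by rw [A.toW_group, A.toW_group, A.toW_group, Wiener.group_add])

theorem group_neg_group (t : ℝ) (f : S) : A.group (-t) (A.group t f) = f := by
  rw [← A.group_add, neg_add_cancel, A.group_zero]

theorem group_group_neg (t : ℝ) (f : S) : A.group t (A.group (-t) f) = f := by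
  rw [← A.group_add, add_neg_cancel, A.group_zero]

/-- Joint continuity, from strong continuity and the isometry property. -/
theorem continuousAt_group_comp {X : Type*} [TopologicalSpace X] {a : X → ℝ} {f : X → S} {x : X}
    (ha : ContinuousAt a x) (hf : ContinuousAt f x) :
    ContinuousAt (fun y => A.group (a y) (f y)) x := by
  rw [ContinuousAt, tendsto_iff_norm_sub_tendsto_zero]
  have h1 : Filter.Tendsto (fun y => ‖f y - f x‖ + ‖A.group (a y) (f x) - A.group (a x) (f x)‖)
      (nhds x) (nhds 0) := by
    have e1 := tendsto_iff_norm_sub_tendsto_zero.1 hf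
    have e2 := tendsto_iff_norm_sub_tendsto_zero.1
      (((A.continuous_group (f x)).continuousAt (x := a x)).comp ha)
    simpa using e1.add e2
  refine squeeze_zero (fun _ => norm_nonneg _) (fun y => ?_) h1
  calc ‖A.group (a y) (f y) - A.group (a x) (f x)‖
      = ‖A.group (a y) (f y - f x) + (A.group (a y) (f x) - A.group (a x) (f x))‖ := by
        rw [map_sub]; congr 1; abel
    _ ≤ _ := (norm_add_le _ _).trans_eq (by rw [LinearIsometry.norm_map])

theorem continuous_group_comp {X : Type*} [TopologicalSpace X] {a : X → ℝ} {f : X → S}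
    (ha : Continuous a) (hf : Continuous f) : Continuous fun y => A.group (a y) (f y) :=
  continuous_iff_continuousAt.2 fun _ =>
    A.continuousAt_group_comp ha.continuousAt hf.continuousAt

end StateSpace

/-- The interaction `(u, v) ↦ K * (u v̄)` on `S`, with `κ = K̂`, as a bounded map. It is bilinear
over `ℝ` only, being antilinear in `v`; the factor `(fc d)⁻¹` is `(2π)^{d/2}`. -/
structure Interaction (κ : E d → ℂ) (A : StateSpace d S) where
  /-- The potential `K * (u v̄)`. -/
  pot : S →L[ℝ] S →L[ℝ] Wiener d
  hat_pot : ∀ u v, (Wiener.hat (pot u v) : E d → ℂ) =ᵐ[volume] fun ξ =>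
    ((fc d)⁻¹ : ℂ) * κ ξ * Wiener.hat (Wiener.mul (A.toW u) (Wiener.conj (A.toW v))) ξ

/-- A bilinear interaction from a bound on `K * (u v̄)` in `W`. -/
def Interaction.ofBound {κ : E d → ℂ} {A : StateSpace d S} (C : ℝ)
    (hκ : ∀ u v, Integrable fun ξ =>
      ((fc d)⁻¹ : ℂ) * κ ξ * Wiener.hat (Wiener.mul (A.toW u) (Wiener.conj (A.toW v))) ξ)
    (hC : ∀ u v, ∫ ξ, ‖((fc d)⁻¹ : ℂ) * κ ξ *
      Wiener.hat (Wiener.mul (A.toW u) (Wiener.conj (A.toW v))) ξ‖ ≤ C * ‖u‖ * ‖v‖) :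
    Interaction κ A where
  pot := LinearMap.mkContinuous₂
    (LinearMap.mk₂ ℝ (fun u v => Wiener.ofIntegrable _ (hκ u v))
      (fun u u' v => Wiener.eq_of_hat_ae_eq <| by
        filter_upwards [Wiener.hat_ofIntegrable (hκ (u + u') v), Wiener.hat_ofIntegrable (hκ u v),
          Wiener.hat_ofIntegrable (hκ u' v), Wiener.hat_add (Wiener.ofIntegrable _ (hκ u v))
            (Wiener.ofIntegrable _ (hκ u' v)),
          Wiener.hat_add (Wiener.mul (A.toW u) (Wiener.conj (A.toW v)))
            (Wiener.mul (A.toW u') (Wiener.conj (A.toW v)))] with ξ h1 h2 h3 h4 h5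
        rw [h1, h4, h2, h3, map_add, map_add, _root_.add_apply, h5, mul_add])
      (fun a u v => Wiener.eq_of_hat_ae_eq <| by
        have e : Wiener.mul (A.toW (a • u)) (Wiener.conj (A.toW v)) =
            (a : ℂ) • Wiener.mul (A.toW u) (Wiener.conj (A.toW v)) := by
          rw [← Complex.coe_smul, map_smul, map_smul, _root_.smul_apply]
        filter_upwards [Wiener.hat_ofIntegrable (hκ (a • u) v), Wiener.hat_ofIntegrable (hκ u v),
          Wiener.hat_smul (a : ℂ) (Wiener.ofIntegrable _ (hκ u v)),
          Wiener.hat_smul (a : ℂ) (Wiener.mul (A.toW u) (Wiener.conj (A.toW v)))]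
          with ξ h1 h2 h3 h4
        rw [h1, e, h4, ← Complex.coe_smul, h3, h2, mul_left_comm])
      (fun u v v' => Wiener.eq_of_hat_ae_eq <| by
        have e : Wiener.conj (A.toW (v + v')) =
            Wiener.conj (A.toW v) + Wiener.conj (A.toW v') := by
          refine Wiener.ext fun x => ?_
          simp
        filter_upwards [Wiener.hat_ofIntegrable (hκ u (v + v')), Wiener.hat_ofIntegrable (hκ u v),
          Wiener.hat_ofIntegrable (hκ u v'), Wiener.hat_add (Wiener.ofIntegrable _ (hκ u v))
            (Wiener.ofIntegrable _ (hκ u v')),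
          Wiener.hat_add (Wiener.mul (A.toW u) (Wiener.conj (A.toW v)))
            (Wiener.mul (A.toW u) (Wiener.conj (A.toW v')))] with ξ h1 h2 h3 h4 h5
        rw [h1, h4, h2, h3, e, map_add, h5, mul_add])
      (fun a u v => Wiener.eq_of_hat_ae_eq <| by
        have e : Wiener.mul (A.toW u) (Wiener.conj (A.toW (a • v))) =
            (a : ℂ) • Wiener.mul (A.toW u) (Wiener.conj (A.toW v)) := by
          have e' : A.toW (a • v) = (a : ℂ) • A.toW v := by rw [← Complex.coe_smul, map_smul]
          refine Wiener.ext fun x => ?_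
          rw [e', Wiener.mul_apply, Wiener.conj_apply, Wiener.smul_apply, Wiener.smul_apply,
            Wiener.mul_apply, Wiener.conj_apply, map_mul, Complex.conj_ofReal, mul_left_comm]
        filter_upwards [Wiener.hat_ofIntegrable (hκ u (a • v)), Wiener.hat_ofIntegrable (hκ u v),
          Wiener.hat_smul (a : ℂ) (Wiener.ofIntegrable _ (hκ u v)),
          Wiener.hat_smul (a : ℂ) (Wiener.mul (A.toW u) (Wiener.conj (A.toW v)))]
          with ξ h1 h2 h3 h4
        rw [h1, e, h4, ← Complex.coe_smul, h3, h2, mul_left_comm]))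
    C (fun u v => by
      rw [LinearMap.mk₂_apply, Wiener.norm_ofIntegrable]
      exact hC u v)
  hat_pot u v := Wiener.hat_ofIntegrable (hκ u v)

namespace Interaction

variable {κ : E d → ℂ} {A : StateSpace d S} (P : Interaction κ A)

theorem mul_conj_apply (f : Wiener d) (x : E d) :
    Wiener.mul f (Wiener.conj f) x = ((‖f x‖ ^ 2 : ℝ) : ℂ) := by
  rw [Wiener.mul_apply, Wiener.conj_apply, Complex.mul_conj, Complex.normSq_eq_norm_sq]

/-- The potential `P.pot u u` is `K * |u|²` in the sense of `IsConvolution`. -/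
theorem isConvolution (u : S) :
    IsConvolution κ (fun x => ((‖A.toW u x‖ ^ 2 : ℝ) : ℂ)) (P.pot u u) := by
  refine ⟨Wiener.mul (A.toW u) (Wiener.conj (A.toW u)), fun x => mul_conj_apply _ _, ?_⟩
  rw [rpow_half_eq_inv_fc]
  filter_upwards [P.hat_pot u u] with ξ h
  rw [h]
  push_cast
  rfl

theorem eq_pot_of_isConvolution {u : S} {V : Wiener d}
    (h : IsConvolution κ (fun x => ((‖A.toW u x‖ ^ 2 : ℝ) : ℂ)) V) : V = P.pot u u := by
  obtain ⟨g, hg, hV⟩ := h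
  have : g = Wiener.mul (A.toW u) (Wiener.conj (A.toW u)) :=
    Wiener.ext fun x => by rw [hg, mul_conj_apply]
  subst this
  refine Wiener.eq_of_hat_ae_eq ?_
  filter_upwards [hV, P.hat_pot u u] with ξ h1 h2
  rw [h1, h2, rpow_half_eq_inv_fc]
  push_cast
  rfl

/-- The nonlinearity `(K * |u|²) u`. -/
def nonlin (u : S) : S := A.mul (P.pot u u) u

/-- The constant in the cubic bounds on the nonlinearity. -/
def const : ℝ := ‖A.mul‖ * ‖P.pot‖

theorem const_nonneg : 0 ≤ P.const := by unfold const; positivity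

theorem norm_mul_pot_le (u v w : S) : ‖A.mul (P.pot u v) w‖ ≤ P.const * ‖u‖ * ‖v‖ * ‖w‖ := by
  refine (A.mul.le_opNorm₂ _ _).trans ?_
  have h := P.pot.le_opNorm₂ u v
  calc ‖A.mul‖ * ‖P.pot u v‖ * ‖w‖ ≤ ‖A.mul‖ * (‖P.pot‖ * ‖u‖ * ‖v‖) * ‖w‖ := by gcongr
    _ = _ := by unfold const; ring

theorem nonlin_sub (u v : S) : P.nonlin u - P.nonlin v =
    A.mul (P.pot (u - v) u) u + A.mul (P.pot v (u - v)) u + A.mul (P.pot v v) (u - v) := by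
  simp only [nonlin, map_sub, _root_.sub_apply]
  abel

theorem norm_nonlin_sub_le {R : ℝ} {u v : S} (hu : ‖u‖ ≤ R) (hv : ‖v‖ ≤ R) :
    ‖P.nonlin u - P.nonlin v‖ ≤ 3 * P.const * R ^ 2 * ‖u - v‖ := by
  have hR : 0 ≤ R := (norm_nonneg u).trans hu
  have hc := P.const_nonneg
  rw [nonlin_sub]
  have h1 : ‖A.mul (P.pot (u - v) u) u‖ ≤ P.const * ‖u - v‖ * R * R :=
    (P.norm_mul_pot_le _ _ _).trans (by gcongr)
  have h2 : ‖A.mul (P.pot v (u - v)) u‖ ≤ P.const * R * ‖u - v‖ * R :=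
    (P.norm_mul_pot_le _ _ _).trans (by gcongr)
  have h3 : ‖A.mul (P.pot v v) (u - v)‖ ≤ P.const * R * R * ‖u - v‖ :=
    (P.norm_mul_pot_le _ _ _).trans (by gcongr)
  refine (norm_add₃_le).trans ?_
  nlinarith

theorem norm_nonlin_le {R : ℝ} {u : S} (hu : ‖u‖ ≤ R) : ‖P.nonlin u‖ ≤ P.const * R ^ 3 := by
  have hR : 0 ≤ R := (norm_nonneg u).trans hu
  have hc := P.const_nonneg
  refine (P.norm_mul_pot_le u u u).trans ?_
  calc P.const * ‖u‖ * ‖u‖ * ‖u‖ ≤ P.const * R * R * R := by gcongr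
    _ = _ := by ring

theorem continuous_nonlin : Continuous P.nonlin := by
  unfold nonlin
  fun_prop

/-- The vector field of the equation in the interaction picture, `v(t) = e^{-itΔ} u(t)`. -/
def field (t : ℝ) (v : S) : S := -Complex.I • A.group (-t) (P.nonlin (A.group t v))

theorem continuous_field_comp {v : ℝ → S} (hv : Continuous v) :
    Continuous fun t => P.field t (v t) := by
  unfold field
  exact (A.continuous_group_comp continuous_neg
    (P.continuous_nonlin.comp (A.continuous_group_comp continuous_id hv))).const_smul _

theorem norm_field_sub_le {R : ℝ} {u v : S} (hu : ‖u‖ ≤ R) (hv : ‖v‖ ≤ R) (t : ℝ) :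
    ‖P.field t u - P.field t v‖ ≤ 3 * P.const * R ^ 2 * ‖u - v‖ := by
  rw [field, field, ← smul_sub, ← map_sub, norm_smul, norm_neg, Complex.norm_I, one_mul,
    LinearIsometry.norm_map]
  refine (P.norm_nonlin_sub_le (R := R) ?_ ?_).trans_eq ?_
  · rwa [LinearIsometry.norm_map]
  · rwa [LinearIsometry.norm_map]
  · rw [← map_sub, LinearIsometry.norm_map]

theorem norm_field_le {R : ℝ} {u : S} (hu : ‖u‖ ≤ R) (t : ℝ) :
    ‖P.field t u‖ ≤ P.const * R ^ 3 := by
  rw [field, norm_smul, norm_neg, Complex.norm_I, one_mul, LinearIsometry.norm_map]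
  exact P.norm_nonlin_le (by rwa [LinearIsometry.norm_map])

theorem lipschitzOnWith_field (R : ℝ) (t : ℝ) :
    LipschitzOnWith (Real.toNNReal (3 * P.const * R ^ 2)) (P.field t) (Metric.closedBall 0 R) := by
  have hc := P.const_nonneg
  refine LipschitzOnWith.of_dist_le_mul fun u hu v hv => ?_
  rw [dist_eq_norm, dist_eq_norm, Real.coe_toNNReal _ (by positivity)]
  exact P.norm_field_sub_le (mem_closedBall_zero_iff.1 hu) (mem_closedBall_zero_iff.1 hv) t

/-! ### The radial projection on a ball -/

/-- The factor `R / max R ‖u‖` of the radial projection on the ball of radius `R`. -/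
def cutoff (R : ℝ) (u : S) : ℝ := R / max R ‖u‖

theorem cutoff_nonneg {R : ℝ} (hR : 0 < R) (u : S) : 0 ≤ cutoff R u := by
  unfold cutoff; positivity

theorem cutoff_le_one {R : ℝ} (hR : 0 < R) (u : S) : cutoff R u ≤ 1 :=
  (div_le_one (lt_max_of_lt_left hR)).2 (le_max_left _ _)

theorem cutoff_of_norm_le {R : ℝ} (hR : 0 < R) {u : S} (hu : ‖u‖ ≤ R) : cutoff R u = 1 := by
  rw [cutoff, max_eq_left hu, div_self hR.ne']

theorem norm_cutoff_smul_le {R : ℝ} (hR : 0 < R) (u : S) : ‖cutoff R u • u‖ ≤ R := by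
  have hm : 0 < max R ‖u‖ := lt_max_of_lt_left hR
  rw [norm_smul, Real.norm_of_nonneg (cutoff_nonneg hR u), cutoff, div_mul_eq_mul_div,
    div_le_iff₀ hm]
  exact mul_le_mul_of_nonneg_left (le_max_right _ _) hR.le

/-- The radial projection of a normed space is `2`-Lipschitz. -/
theorem norm_cutoff_smul_sub_le {R : ℝ} (hR : 0 < R) (u v : S) :
    ‖cutoff R u • u - cutoff R v • v‖ ≤ 2 * ‖u - v‖ := by
  have ha : 0 < max R ‖u‖ := lt_max_of_lt_left hR
  have hb : 0 < max R ‖v‖ := lt_max_of_lt_left hR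
  have e : cutoff R u • u - cutoff R v • v =
      cutoff R u • (u - v) + (cutoff R u - cutoff R v) • v := by
    rw [smul_sub, sub_smul]; abel
  rw [e]
  refine (norm_add_le _ _).trans ?_
  have h1 : ‖cutoff R u • (u - v)‖ ≤ ‖u - v‖ := by
    rw [norm_smul, Real.norm_of_nonneg (cutoff_nonneg hR u)]
    exact mul_le_of_le_one_left (norm_nonneg _) (cutoff_le_one hR u)
  have h2 : ‖(cutoff R u - cutoff R v) • v‖ ≤ ‖u - v‖ := by
    have e2 : cutoff R u - cutoff R v =
        (R / max R ‖u‖) * ((max R ‖v‖ - max R ‖u‖) / max R ‖v‖) := by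
      unfold cutoff; field_simp
    have hn : ‖R / max R ‖u‖‖ = cutoff R u := Real.norm_of_nonneg (cutoff_nonneg hR u)
    rw [norm_smul, e2, norm_mul, hn, norm_div, Real.norm_of_nonneg hb.le, mul_assoc,
      div_mul_eq_mul_div]
    refine (mul_le_of_le_one_left (by positivity) (cutoff_le_one hR u)).trans ?_
    rw [div_le_iff₀ hb]
    refine mul_le_mul ?_ (le_max_right _ _) (norm_nonneg _) (norm_nonneg _)
    calc ‖max R ‖v‖ - max R ‖u‖‖ ≤ max |R - R| |‖v‖ - ‖u‖| := abs_max_sub_max_le_max _ _ _ _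
      _ ≤ ‖u - v‖ := by
        rw [sub_self, abs_zero]
        refine max_le (norm_nonneg _) ?_
        rw [norm_sub_rev]
        exact abs_norm_sub_norm_le v u
  linarith

theorem continuous_cutoff_smul {R : ℝ} (hR : 0 < R) : Continuous fun v : S => cutoff R v • v := by
  unfold cutoff
  have : ∀ v : S, max R ‖v‖ ≠ 0 := fun v => (lt_max_of_lt_left hR).ne'
  fun_prop (disch := assumption)

/-- The vector field composed with the radial projection on the ball of radius `R`; it is
bounded and globally Lipschitz. -/
def truncField (R : ℝ) (t : ℝ) (v : S) : S := P.field t (cutoff R v • v)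

/-! ### Solutions as mild solutions in `S` -/

/-- Duhamel's formula in `S`. -/
def IsMild (I : Set ℝ) (u₀ : S) (w : ℝ → S) : Prop :=
  ∀ t ∈ I, w t = A.group t u₀ -
    Complex.I • ∫ τ in (0 : ℝ)..t, A.group (t - τ) (P.nonlin (w τ))

theorem IsMild.mono {I J : Set ℝ} (hJ : J ⊆ I) {u₀ : S} {w : ℝ → S} (h : P.IsMild I u₀ w) :
    P.IsMild J u₀ w := fun t ht => h t (hJ ht)

variable [CompleteSpace S]

theorem uIoc_subset_of_ordConnected {I : Set ℝ} (hI : I.OrdConnected) (h0 : (0 : ℝ) ∈ I) {t : ℝ}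
    (ht : t ∈ I) : uIoc 0 t ⊆ I :=
  uIoc_subset_uIcc.trans (hI.uIcc_subset h0 ht)

/-- For curves in `S`, Duhamel's formula in `W` is the same as in `S`: the potential and the
nonlinearity are determined by the solution, and the inclusion in `W` is injective and commutes
with the integral. -/
theorem isSolution_iff {I : Set ℝ} (hI : I.OrdConnected) (h0 : (0 : ℝ) ∈ I) (u₀ : S) {w : ℝ → S}
    (hw : Continuous w) :
    IsSolution κ I (A.toW u₀) (fun t => A.toW (w t)) ↔ P.IsMild I u₀ w := by
  have hF : Continuous fun τ => P.nonlin (w τ) := P.continuous_nonlin.comp hw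
  have hcont : ∀ t : ℝ, Continuous fun τ => A.group (t - τ) (P.nonlin (w τ)) := fun t =>
    A.continuous_group_comp (by fun_prop) hF
  have hint : ∀ t : ℝ, ∫ τ in (0 : ℝ)..t, A.toW (A.group (t - τ) (P.nonlin (w τ)))
      = A.toW (∫ τ in (0 : ℝ)..t, A.group (t - τ) (P.nonlin (w τ))) := fun t =>
    A.toW.intervalIntegral_comp_comm ((hcont t).intervalIntegrable 0 t)
  constructor
  · rintro ⟨V, N, hVN, h⟩ t ht
    have h2 := (h ⟨t, ht⟩).2.2
    refine A.injective ?_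
    rw [map_sub, map_smul, ← hint, A.toW_group]
    refine h2.trans ?_
    congr 2
    refine intervalIntegral.integral_congr_ae ?_
    filter_upwards [hVN] with τ hτ hτt
    obtain ⟨h3, h4⟩ := hτ (uIoc_subset_of_ordConnected hI h0 ht hτt)
    have h5 : V τ = P.pot (w τ) (w τ) := P.eq_pot_of_isConvolution h3
    have h6 : N τ = A.toW (P.nonlin (w τ)) := Wiener.ext fun x => by
      rw [h4, nonlin, A.toW_mul, Wiener.mul_apply, h5]
    rw [A.toW_group, h6]
    rfl
  · intro h
    refine ⟨fun τ => P.pot (w τ) (w τ), fun τ => A.toW (P.nonlin (w τ)),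
      Filter.Eventually.of_forall fun τ hτ => ⟨P.isConvolution (w τ), fun x => ?_⟩,
      fun t => ⟨Continuous.intervalIntegrable (by fun_prop) _ _, ?_, ?_⟩⟩
    · change A.toW (A.mul (P.pot (w τ) (w τ)) (w τ)) x = _
      rw [A.toW_mul, Wiener.mul_apply]
    · have := (A.toW.continuous.comp (hcont t)).intervalIntegrable (μ := volume) 0 t
      refine this.congr ?_
      exact fun τ _ => A.toW_group _ _
    · have h1 := congrArg A.toW (h t t.2)
      rw [map_sub, map_smul, ← hint, A.toW_group] at h1
      refine h1.trans (congrArg₂ _ rfl (congrArg _ ?_))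
      exact intervalIntegral.integral_congr fun τ _ => A.toW_group _ _

/-- The interaction picture `v(t) = e^{-itΔ} w(t)` solves `v' = field t v`, in integral form. -/
theorem isMild_iff {I : Set ℝ} (u₀ : S) {w : ℝ → S} (hw : Continuous w) :
    P.IsMild I u₀ w ↔ ∀ t ∈ I, A.group (-t) (w t) =
      u₀ + ∫ τ in (0 : ℝ)..t, P.field τ (A.group (-τ) (w τ)) := by
  refine forall₂_congr fun t _ => ?_
  have hF : Continuous fun τ => P.nonlin (w τ) := P.continuous_nonlin.comp hw
  have hcont : Continuous fun τ => A.group (t - τ) (P.nonlin (w τ)) :=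
    A.continuous_group_comp (by fun_prop) hF
  have h1 : ∫ τ in (0 : ℝ)..t, P.field τ (A.group (-τ) (w τ)) =
      A.group (-t) (-Complex.I • ∫ τ in (0 : ℝ)..t, A.group (t - τ) (P.nonlin (w τ))) := by
    rw [← intervalIntegral.integral_smul]
    have := (A.group (-t)).toContinuousLinearMap.intervalIntegral_comp_comm
      ((hcont.const_smul (-Complex.I)).intervalIntegrable (μ := volume) 0 t)
    refine Eq.trans ?_ this
    refine intervalIntegral.integral_congr fun τ _ => ?_
    simp only [LinearIsometry.coe_toContinuousLinearMap, field, A.group_group_neg, Pi.smul_apply,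
      map_smul]
    rw [← A.group_add]
    congr 3
    ring
  rw [h1]
  constructor
  · intro h
    rw [h, map_sub, A.group_neg_group, neg_smul, map_neg, sub_eq_add_neg]
  · intro h
    have := congrArg (A.group t) h
    rw [map_add, A.group_group_neg, A.group_group_neg] at this
    rw [this, neg_smul, sub_eq_add_neg]

/-- The mild solution with interaction picture `v`, at points of the time interval. -/
theorem isMild_group {I : Set ℝ} {u₀ : S} {v : ℝ → S} (hv : Continuous v)
    (h : ∀ t ∈ I, v t = u₀ + ∫ τ in (0 : ℝ)..t, P.field τ (v τ)) :
    P.IsMild I u₀ (fun t => A.group t (v t)) := by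
  refine (P.isMild_iff u₀ (A.continuous_group_comp continuous_id hv)).2 fun t ht => ?_
  simp only [id, A.group_neg_group]
  exact h t ht

/-- The primitive of the vector field along a mild solution is an integral curve, equal to the
interaction picture of the solution. -/
theorem IsMild.exists_curve {I : Set ℝ} {u₀ : S} {w : ℝ → S} (hw : Continuous w)
    (h : P.IsMild I u₀ w) :
    ∃ v : ℝ → S, v 0 = u₀ ∧ Continuous v ∧ (∀ t ∈ I, v t = A.group (-t) (w t)) ∧
      ∀ t ∈ I, HasDerivAt v (P.field t (v t)) t := by
  have hv : Continuous fun t => A.group (-t) (w t) :=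
    A.continuous_group_comp continuous_neg hw
  have hG := P.continuous_field_comp hv
  have hd : ∀ t, HasDerivAt (fun t => u₀ + ∫ τ in (0 : ℝ)..t, P.field τ (A.group (-τ) (w τ)))
      (P.field t (A.group (-t) (w t))) t := fun t =>
    (intervalIntegral.integral_hasDerivAt_right (hG.intervalIntegrable _ _)
      (hG.stronglyMeasurableAtFilter _ _) hG.continuousAt).const_add u₀
  have he : ∀ t ∈ I, u₀ + ∫ τ in (0 : ℝ)..t, P.field τ (A.group (-τ) (w τ)) =
      A.group (-t) (w t) := fun t ht => ((P.isMild_iff u₀ hw).1 h t ht).symm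
  refine ⟨fun t => u₀ + ∫ τ in (0 : ℝ)..t, P.field τ (A.group (-τ) (w τ)), by simp,
    continuous_iff_continuousAt.2 fun t => (hd t).continuousAt, he, fun t ht => ?_⟩
  have := hd t
  simp only [he t ht]
  exact this

/-- Two mild solutions are within `e^{Lt}` times the distance of their data. -/
theorem IsMild.dist_le {T R : ℝ} {u₁ u₂ : S} {w₁ w₂ : ℝ → S} (hw₁ : Continuous w₁)
    (hw₂ : Continuous w₂) (h₁ : P.IsMild (Icc 0 T) u₁ w₁) (h₂ : P.IsMild (Icc 0 T) u₂ w₂)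
    (hR₁ : ∀ t ∈ Icc 0 T, ‖w₁ t‖ ≤ R) (hR₂ : ∀ t ∈ Icc 0 T, ‖w₂ t‖ ≤ R) :
    ∀ t ∈ Icc 0 T, ‖w₁ t - w₂ t‖ ≤
      ‖u₁ - u₂‖ * Real.exp (Real.toNNReal (3 * P.const * R ^ 2) * t) := by
  obtain ⟨v₁, h10, hc1, he1, hd1⟩ := IsMild.exists_curve P hw₁ h₁
  obtain ⟨v₂, h20, hc2, he2, hd2⟩ := IsMild.exists_curve P hw₂ h₂
  intro t ht
  have := dist_le_of_trajectories_ODE_of_mem (v := P.field) (a := 0) (b := T)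
    (s := fun _ => Metric.closedBall 0 R) (δ := ‖u₁ - u₂‖)
    (fun t _ => P.lipschitzOnWith_field R t) hc1.continuousOn
    (fun t ht => (hd1 t (Ico_subset_Icc_self ht)).hasDerivWithinAt)
    (fun t ht => by
      rw [mem_closedBall_zero_iff, he1 t (Ico_subset_Icc_self ht), LinearIsometry.norm_map]
      exact hR₁ t (Ico_subset_Icc_self ht)) hc2.continuousOn
    (fun t ht => (hd2 t (Ico_subset_Icc_self ht)).hasDerivWithinAt)
    (fun t ht => by
      rw [mem_closedBall_zero_iff, he2 t (Ico_subset_Icc_self ht), LinearIsometry.norm_map]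
      exact hR₂ t (Ico_subset_Icc_self ht)) (by rw [h10, h20, dist_eq_norm]) t ht
  rwa [dist_eq_norm, he1 t ht, he2 t ht, ← map_sub, LinearIsometry.norm_map, sub_zero] at this

/-- Unconditional uniqueness in `C(I; S)`. -/
theorem IsMild.unique {I : Set ℝ} (hI : I.OrdConnected) (h0 : (0 : ℝ) ∈ I) {u₀ : S}
    {w₁ w₂ : ℝ → S} (hw₁ : Continuous w₁) (hw₂ : Continuous w₂) (h₁ : P.IsMild I u₀ w₁)
    (h₂ : P.IsMild I u₀ w₂) : EqOn w₁ w₂ I := by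
  obtain ⟨v₁, h10, hc1, he1, hd1⟩ := IsMild.exists_curve P hw₁ h₁
  obtain ⟨v₂, h20, hc2, he2, hd2⟩ := IsMild.exists_curve P hw₂ h₂
  intro t ht
  have hsub : uIcc 0 t ⊆ I := hI.uIcc_subset h0 ht
  obtain ⟨R₁, hR₁⟩ := isCompact_uIcc.exists_bound_of_continuousOn (hc1.continuousOn (s := uIcc 0 t))
  obtain ⟨R₂, hR₂⟩ := isCompact_uIcc.exists_bound_of_continuousOn (hc2.continuousOn (s := uIcc 0 t))
  have hm1 : ∀ s ∈ uIcc 0 t, v₁ s ∈ Metric.closedBall (0 : S) (max R₁ R₂) := fun s hs =>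
    mem_closedBall_zero_iff.2 ((hR₁ s hs).trans (le_max_left _ _))
  have hm2 : ∀ s ∈ uIcc 0 t, v₂ s ∈ Metric.closedBall (0 : S) (max R₁ R₂) := fun s hs =>
    mem_closedBall_zero_iff.2 ((hR₂ s hs).trans (le_max_right _ _))
  have key : v₁ t = v₂ t := by
    rcases le_total 0 t with h | h
    · rw [uIcc_of_le h] at hm1 hm2 hsub
      exact ODE_solution_unique_of_mem_Icc_right (v := P.field)
        (fun t _ => P.lipschitzOnWith_field _ t) hc1.continuousOn
        (fun s hs => (hd1 s (hsub (Ico_subset_Icc_self hs))).hasDerivWithinAt)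
        (fun s hs => hm1 s (Ico_subset_Icc_self hs)) hc2.continuousOn
        (fun s hs => (hd2 s (hsub (Ico_subset_Icc_self hs))).hasDerivWithinAt)
        (fun s hs => hm2 s (Ico_subset_Icc_self hs)) (h10.trans h20.symm) ⟨h, le_rfl⟩
    · rw [uIcc_of_ge h] at hm1 hm2 hsub
      exact ODE_solution_unique_of_mem_Icc_left (v := P.field)
        (fun t _ => P.lipschitzOnWith_field _ t) hc1.continuousOn
        (fun s hs => (hd1 s (hsub (Ioc_subset_Icc_self hs))).hasDerivWithinAt)
        (fun s hs => hm1 s (Ioc_subset_Icc_self hs)) hc2.continuousOn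
        (fun s hs => (hd2 s (hsub (Ioc_subset_Icc_self hs))).hasDerivWithinAt)
        (fun s hs => hm2 s (Ioc_subset_Icc_self hs)) (h10.trans h20.symm) ⟨le_rfl, h⟩
  rw [he1 t ht, he2 t ht] at key
  exact (A.group (-t)).injective key

/-! ### Existence for the truncated equation -/

/-- As the truncated field is bounded and globally Lipschitz, there is no restriction on the length
of the time interval. -/
theorem isPicardLindelof_truncField {R T : ℝ} (hR : 0 < R) (hT : 0 ≤ T) (u₀ : S) :
    IsPicardLindelof (P.truncField R) (tmin := -T) (tmax := T) ⟨0, by simp [hT]⟩ u₀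
      (Real.toNNReal (P.const * R ^ 3) * Real.toNNReal T) 0 (Real.toNNReal (P.const * R ^ 3))
      (Real.toNNReal (6 * P.const * R ^ 2)) where
  lipschitzOnWith t _ := by
    have hc := P.const_nonneg
    refine LipschitzOnWith.of_dist_le_mul fun u _ v _ => ?_
    rw [dist_eq_norm, dist_eq_norm, Real.coe_toNNReal _ (by positivity)]
    refine (P.norm_field_sub_le (norm_cutoff_smul_le hR u) (norm_cutoff_smul_le hR v) t).trans ?_
    have := norm_cutoff_smul_sub_le hR u v
    calc 3 * P.const * R ^ 2 * ‖cutoff R u • u - cutoff R v • v‖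
        ≤ 3 * P.const * R ^ 2 * (2 * ‖u - v‖) := by gcongr
      _ = _ := by ring
  continuousOn x _ := (P.continuous_field_comp continuous_const).continuousOn
  norm_le t _ x _ := by
    have hc := P.const_nonneg
    rw [Real.coe_toNNReal _ (by positivity)]
    exact P.norm_field_le (norm_cutoff_smul_le hR x) t
  mul_max_le := by simp [hT]

theorem exists_truncated {R T : ℝ} (hR : 0 < R) (hT : 0 ≤ T) (u₀ : S) :
    ∃ v : ℝ → S, Continuous v ∧
      ∀ t ∈ Icc (-T) T, v t = u₀ + ∫ τ in (0 : ℝ)..t, P.truncField R τ (v τ) := by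
  obtain ⟨α, h0, hα⟩ :=
    (P.isPicardLindelof_truncField hR hT u₀).exists_eq_forall_mem_Icc_hasDerivWithinAt₀
  have h0T : (0 : ℝ) ∈ Icc (-T) T := by simp [hT]
  have hle : -T ≤ T := h0T.1.trans h0T.2
  have hcα : ContinuousOn α (Icc (-T) T) := fun t ht => (hα t ht).continuousWithinAt
  have hc : Continuous (IccExtend hle ((Icc (-T) T).domRestrict α)) :=
    (continuousOn_iff_continuous_domRestrict.1 hcα).Icc_extend'
  have he : ∀ t ∈ Icc (-T) T, IccExtend hle ((Icc (-T) T).domRestrict α) t = α t := fun t ht => by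
    rw [IccExtend_of_mem _ _ ht]; rfl
  refine ⟨_, hc, fun t ht => ?_⟩
  have hsub : uIcc 0 t ⊆ Icc (-T) T := ordConnected_Icc.uIcc_subset h0T ht
  have hint : Continuous fun τ => P.truncField R τ (IccExtend hle ((Icc (-T) T).domRestrict α) τ) :=
    P.continuous_field_comp ((continuous_cutoff_smul hR).comp hc)
  have hft := intervalIntegral.integral_eq_sub_of_hasDeriv_right (a := 0) (b := t) (f := α)
    (f' := fun τ => P.truncField R τ (IccExtend hle ((Icc (-T) T).domRestrict α) τ))
    (hcα.mono hsub) (fun s hs => ?_) (hint.intervalIntegrable _ _)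
  · rw [hft, he t ht, h0]
    abel
  · have hs' : s ∈ uIcc 0 t := Ioo_subset_Icc_self hs
    rw [he s (hsub hs')]
    have hsT : s ∈ Ioo (-T) T := by
      have h1 := h0T
      have : min 0 t ≥ -T := le_min h0T.1 ht.1
      have : max 0 t ≤ T := max_le h0T.2 ht.2
      exact ⟨by linarith [hs.1], by linarith [hs.2]⟩
    exact ((hα s (hsub hs')).hasDerivAt (Icc_mem_nhds hsT.1 hsT.2)).hasDerivWithinAt

/-- A solution of the truncated equation that stays in the ball is a mild solution. -/
theorem isMild_of_truncated {R : ℝ} (hR : 0 < R) {I : Set ℝ} (hI : I.OrdConnected)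
    (h0 : (0 : ℝ) ∈ I) {u₀ : S} {v : ℝ → S} (hv : Continuous v)
    (h : ∀ t ∈ I, v t = u₀ + ∫ τ in (0 : ℝ)..t, P.truncField R τ (v τ))
    (hb : ∀ t ∈ I, ‖v t‖ ≤ R) : P.IsMild I u₀ (fun t => A.group t (v t)) := by
  refine P.isMild_group hv fun t ht => ?_
  rw [h t ht]
  congr 1
  refine intervalIntegral.integral_congr fun τ hτ => ?_
  simp only [truncField]
  rw [cutoff_of_norm_le hR (hb τ (hI.uIcc_subset h0 ht hτ)), one_smul]

/-- Local existence, on a time interval that depends only on a bound on the initial datum. -/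
theorem exists_isMild_local {ρ : ℝ} (hρ : 0 ≤ ρ) :
    ∃ T : ℝ, 0 < T ∧ ∀ u₀ : S, ‖u₀‖ ≤ ρ → ∃ w : ℝ → S, Continuous w ∧
      P.IsMild (Icc (-T) T) u₀ w ∧ ∀ t ∈ Icc (-T) T, ‖w t‖ ≤ ρ + 1 := by
  have hc := P.const_nonneg
  have hR : 0 < ρ + 1 := by linarith
  set M : ℝ := P.const * (ρ + 1) ^ 3 + 1 with hM
  have hM0 : 0 < M := by positivity
  refine ⟨1 / M, by positivity, fun u₀ hu => ?_⟩
  obtain ⟨v, hv, h⟩ := P.exists_truncated hR (T := 1 / M) (by positivity) u₀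
  have hb : ∀ t ∈ Icc (-(1 / M)) (1 / M), ‖v t‖ ≤ ρ + 1 := by
    intro t ht
    rw [h t ht]
    refine (norm_add_le _ _).trans (add_le_add hu ?_)
    refine (intervalIntegral.norm_integral_le_of_norm_le_const (C := M) fun τ _ => ?_).trans ?_
    · exact (P.norm_field_le (norm_cutoff_smul_le hR _) τ).trans (by linarith)
    · rw [sub_zero]
      calc M * |t| ≤ M * (1 / M) := by gcongr; exact abs_le.2 ht
        _ = 1 := by field_simp
  refine ⟨_, A.continuous_group_comp continuous_id hv, P.isMild_of_truncated hR ordConnected_Icc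
    (by constructor <;> simp [hM0.le]) hv h hb, fun t ht => ?_⟩
  rw [LinearIsometry.norm_map]
  exact hb t ht

/-- Solutions on a compact interval containing `0`, from a mild solution. -/
theorem isSolution_iff_eq {a b : ℝ} (ha : a ≤ 0) (hb : 0 ≤ b) {u₀ : S} {w : ℝ → S}
    (hw : Continuous w) (h : P.IsMild (Icc a b) u₀ w) (v : C(Icc a b, S)) :
    IsSolution κ (Icc a b) (A.toW u₀) (fun t => A.toW (v t)) ↔
      v = ⟨fun t => w t, by fun_prop⟩ := by
  have hle : a ≤ b := ha.trans hb
  have h0 : (0 : ℝ) ∈ Icc a b := ⟨ha, hb⟩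
  have hc : Continuous (IccExtend hle v) := v.continuous.Icc_extend'
  have he : (fun t : Icc a b => A.toW (v t)) =
      fun t : Icc a b => A.toW (IccExtend hle v t) := by
    funext t
    rw [IccExtend_val]
  rw [he, P.isSolution_iff ordConnected_Icc h0 u₀ hc]
  constructor
  · intro hv
    ext t
    have := IsMild.unique P ordConnected_Icc h0 hc hw hv h t.2
    rwa [IccExtend_val] at this
  · rintro rfl t ht
    have := h t ht
    rw [IccExtend_of_mem _ _ ht]
    refine this.trans ?_
    congr 2
    refine intervalIntegral.integral_congr fun τ hτ => ?_
    rw [IccExtend_of_mem _ _ (ordConnected_Icc.uIcc_subset h0 ht hτ)]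
    rfl

/-- Solutions on the whole line, from a mild solution. -/
theorem isSolution_univ_iff_eq {u₀ : S} {w : ℝ → S} (hw : Continuous w)
    (h : P.IsMild univ u₀ w) (v : C(ℝ, S)) :
    IsSolution κ univ (A.toW u₀) (fun t => A.toW (v t)) ↔ v = ⟨w, hw⟩ := by
  rw [P.isSolution_iff (w := v) ordConnected_univ (mem_univ _) u₀ v.continuous]
  constructor
  · intro hv
    ext t
    exact IsMild.unique P ordConnected_univ (mem_univ _) v.continuous hw hv h (mem_univ t)
  · rintro rfl
    exact h

/-- Mild solutions on all compact intervals give a global one. -/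
theorem exists_isMild_univ {u₀ : S}
    (h : ∀ T : ℝ, 0 < T → ∃ w : ℝ → S, Continuous w ∧ P.IsMild (Icc (-T) T) u₀ w) :
    ∃ w : ℝ → S, Continuous w ∧ P.IsMild univ u₀ w := by
  choose! w hwc hw using h
  have key : ∀ T T' : ℝ, 0 < T → T ≤ T' → EqOn (w T) (w T') (Icc (-T) T) := fun T T' hT hTT =>
    IsMild.unique P ordConnected_Icc ⟨by linarith, hT.le⟩ (hwc T hT) (hwc T' (hT.trans_le hTT))
      (hw T hT) (IsMild.mono P (Icc_subset_Icc (by linarith) hTT) (hw T' (hT.trans_le hTT)))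
  have key2 : ∀ T : ℝ, 0 < T → ∀ t ∈ Icc (-T) T, w (|t| + 1) t = w T t := by
    intro T hT t ht
    have h1 : t ∈ Icc (-(|t| + 1)) (|t| + 1) :=
      abs_le.1 (by linarith)
    rcases le_total (|t| + 1) T with h | h
    · exact key _ _ (by positivity) h h1
    · exact (key _ _ hT h ht).symm
  have hc : Continuous fun t => w (|t| + 1) t := by
    refine continuous_iff_continuousAt.2 fun t => ?_
    have hT : 0 < |t| + 1 := by positivity
    refine ((hwc _ hT).continuousAt (x := t)).congr ?_
    have hmem : Icc (-(|t| + 1)) (|t| + 1) ∈ nhds t :=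
      Icc_mem_nhds (by linarith [neg_abs_le t]) (by linarith [le_abs_self t])
    filter_upwards [hmem] with s hs
    exact (key2 _ hT s hs).symm
  refine ⟨_, hc, fun t _ => ?_⟩
  have hT : 0 < |t| + 1 := by positivity
  have ht : t ∈ Icc (-(|t| + 1)) (|t| + 1) := abs_le.1 (by linarith)
  rw [hw _ hT t ht]
  congr 2
  refine intervalIntegral.integral_congr fun τ hτ => ?_
  rw [key2 _ hT τ (ordConnected_Icc.uIcc_subset ⟨by linarith, hT.le⟩ ht hτ)]

/-- Local well-posedness in `S`. -/
theorem locallyWellPosed (P : Interaction κ A) (j : S →ₗ[ℂ] Wiener d) (hj : ∀ f, j f = A.toW f) :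
    LocallyWellPosed κ S j := by
  classical
  intro B hB
  obtain ⟨ρ, hρ0, hρ⟩ := hB.exists_pos_norm_le
  obtain ⟨T, hT, hex⟩ := P.exists_isMild_local hρ0.le
  choose! w hwc hw hwb using hex
  have hsub : Icc 0 T ⊆ Icc (-T) T := Icc_subset_Icc (by linarith) le_rfl
  refine ⟨T, hT, C(Icc (0 : ℝ) T, S), inferInstance, inferInstance, inferInstance,
    ContinuousLinearMap.id ℂ _, Function.injective_id,
    fun φ => if h : ‖φ‖ ≤ ρ then
      ⟨fun t => w φ t, (hwc φ h).comp continuous_subtype_val⟩ else 0, fun φ hφ ψ => ?_, ?_⟩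
  · have h : ‖φ‖ ≤ ρ := hρ φ hφ
    simp only [hj, ContinuousLinearMap.id_apply, dif_pos h]
    exact P.isSolution_iff_eq le_rfl hT.le (hwc φ h) (IsMild.mono P hsub (hw φ h)) ψ
  · set K : ℝ := Real.exp (Real.toNNReal (3 * P.const * (ρ + 1) ^ 2) * T)
    refine LipschitzOnWith.uniformContinuousOn (K := Real.toNNReal K) ?_
    refine LipschitzOnWith.of_dist_le_mul fun φ hφ ψ hψ => ?_
    have h1 : ‖φ‖ ≤ ρ := hρ φ hφ
    have h2 : ‖ψ‖ ≤ ρ := hρ ψ hψ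
    simp only [ContinuousLinearMap.id_apply, dif_pos h1, dif_pos h2]
    rw [ContinuousMap.dist_le (by positivity)]
    intro t
    rw [Real.coe_toNNReal _ (Real.exp_pos _).le, dist_eq_norm, dist_eq_norm, mul_comm]
    refine (IsMild.dist_le P (hwc φ h1) (hwc ψ h2) (IsMild.mono P hsub (hw φ h1))
      (IsMild.mono P hsub (hw ψ h2)) (fun t ht => hwb φ h1 t (hsub ht))
      (fun t ht => hwb ψ h2 t (hsub ht)) t t.2).trans ?_
    gcongr
    exact t.2.2

end Interaction

end

/-! ### Interactions with `K̂` in a Lebesgue space -/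

theorem integrable_and_integral_mul_le_of_memLp_top {κ : E d → ℂ} (hκ : MemLp κ ∞ volume) :
    ∃ C : ℝ, 0 ≤ C ∧ ∀ g : E d → ℂ, Integrable g →
      Integrable (fun ξ => κ ξ * g ξ) ∧ ∫ ξ, ‖κ ξ * g ξ‖ ≤ C * ∫ ξ, ‖g ξ‖ := by
  have h2 : eLpNormEssSup κ volume ≠ ∞ := by
    have := hκ.2.ne
    rwa [eLpNorm_exponent_top] at this
  refine ⟨(eLpNormEssSup κ volume).toReal, ENNReal.toReal_nonneg, fun g hg => ?_⟩
  have hle : ∀ᵐ ξ, ‖κ ξ * g ξ‖ ≤ (eLpNormEssSup κ volume).toReal * ‖g ξ‖ := by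
    filter_upwards [ae_le_eLpNormEssSup (f := κ) (μ := (volume : Measure (E d)))] with ξ hξ
    have := ENNReal.toReal_mono h2 hξ
    rw [norm_mul]
    exact mul_le_mul_of_nonneg_right (by simpa using this) (norm_nonneg _)
  have hi := (hg.norm.const_mul _).mono' (hκ.1.mul hg.1) hle
  refine ⟨hi, (integral_mono_ae hi.norm (hg.norm.const_mul _) hle).trans_eq ?_⟩
  rw [integral_const_mul]

/-- For `κ ∈ L^p`, the product `κ g` is integrable when `g` is integrable and bounded. For `p < ∞`
this follows from `|κ| ≤ 1 + |κ|^p`, which avoids the interpolation of `L^{p'}` between `L¹` and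
`L^∞`. -/
theorem exists_integral_mul_le {κ : E d → ℂ} {p : ℝ≥0∞} (hp : 1 ≤ p) (hκ : MemLp κ p volume) :
    ∃ C : ℝ, 0 ≤ C ∧ ∀ (g : E d → ℂ) (b : ℝ), Integrable g → 0 ≤ b → (∀ᵐ ξ, ‖g ξ‖ ≤ b) →
      Integrable (fun ξ => κ ξ * g ξ) ∧ ∫ ξ, ‖κ ξ * g ξ‖ ≤ C * ((∫ ξ, ‖g ξ‖) + b) := by
  have hm : ∀ g : E d → ℂ, Integrable g → AEStronglyMeasurable (fun ξ => κ ξ * g ξ) volume :=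
    fun g hg => hκ.1.mul hg.1
  rcases eq_or_ne p ∞ with rfl | hp'
  · obtain ⟨C, hC0, hC⟩ := integrable_and_integral_mul_le_of_memLp_top hκ
    exact ⟨C, hC0, fun g b hg hb _ => ⟨(hC g hg).1,
      (hC g hg).2.trans (mul_le_mul_of_nonneg_left (by linarith) hC0)⟩⟩
  · have hp0 : p ≠ 0 := (zero_lt_one.trans_le hp).ne'
    have hq : 1 ≤ p.toReal := by
      have := ENNReal.toReal_mono hp' hp
      simpa using this
    have hI : Integrable fun ξ => ‖κ ξ‖ ^ p.toReal := hκ.integrable_norm_rpow hp0 hp'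
    have hpt : ∀ x : ℝ, 0 ≤ x → x ≤ 1 + x ^ p.toReal := fun x hx => by
      have h0 := Real.rpow_nonneg hx p.toReal
      rcases le_total x 1 with h | h
      · linarith
      · have := Real.rpow_le_rpow_of_exponent_le h hq
        rw [Real.rpow_one] at this
        linarith
    have hI0 : 0 ≤ ∫ ξ, ‖κ ξ‖ ^ p.toReal := integral_nonneg fun ξ => by positivity
    refine ⟨1 + ∫ ξ, ‖κ ξ‖ ^ p.toReal, by linarith, fun g b hg hb hgb => ?_⟩
    have hle : ∀ᵐ ξ, ‖κ ξ * g ξ‖ ≤ ‖g ξ‖ + b * ‖κ ξ‖ ^ p.toReal := by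
      filter_upwards [hgb] with ξ hξ
      rw [norm_mul]
      calc ‖κ ξ‖ * ‖g ξ‖ ≤ (1 + ‖κ ξ‖ ^ p.toReal) * ‖g ξ‖ := by
            gcongr; exact hpt _ (norm_nonneg _)
        _ = ‖g ξ‖ + ‖g ξ‖ * ‖κ ξ‖ ^ p.toReal := by ring
        _ ≤ _ := by gcongr
    have hJ := hg.norm.add (hI.const_mul b)
    have hi := hJ.mono' (hm g hg) hle
    refine ⟨hi, (integral_mono_ae hi.norm hJ hle).trans ?_⟩
    have e : ∫ ξ, (((fun ξ => ‖g ξ‖) + fun ξ => b * ‖κ ξ‖ ^ p.toReal : E d → ℝ)) ξ =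
        (∫ ξ, ‖g ξ‖) + b * ∫ ξ, ‖κ ξ‖ ^ p.toReal := by
      rw [← integral_const_mul]
      exact integral_add hg.norm (hI.const_mul b)
    rw [e]
    have hG : 0 ≤ ∫ ξ, ‖g ξ‖ := integral_nonneg fun ξ => norm_nonneg _
    nlinarith

namespace L2Wiener

/-- Complex conjugation on `L² ∩ W`. -/
def conj (f : L2Wiener d) : L2Wiener d :=
  ⟨(Wiener.conj (toW f)).1, (Wiener.conj (toW f)).2,
    f.memLp.of_le (Wiener.continuous_apply (Wiener.conj (toW f))).aestronglyMeasurable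
      (Filter.Eventually.of_forall fun x => by
        rw [Wiener.conj_apply, RCLike.norm_conj]; rfl)⟩

theorem toW_conj (f : L2Wiener d) : toW (conj f) = Wiener.conj (toW f) := rfl

theorem norm_toL2_conj (f : L2Wiener d) : ‖toL2 (conj f)‖ = ‖toL2 f‖ := by
  rw [norm_toL2, norm_toL2]
  congr 1
  refine eLpNorm_congr_norm_ae (Filter.Eventually.of_forall fun x => ?_)
  change ‖Wiener.conj (toW f) x‖ = _
  rw [Wiener.conj_apply, RCLike.norm_conj]
  rfl

theorem norm_hat_mul_le (f g : L2Wiener d) :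
    ∀ᵐ ξ, ‖Wiener.hat (Wiener.mul (toW f) (toW g)) ξ‖ ≤ fc d * ‖toL2 f‖ * ‖toL2 g‖ := by
  filter_upwards [Wiener.hat_prod (toW f) (toW g)] with ξ h
  rw [Wiener.mul_def, h, norm_mul, Complex.norm_real, Real.norm_of_nonneg (fc_pos d).le, mul_assoc]
  exact mul_le_mul_of_nonneg_left (norm_hatConv_le f g ξ) (fc_pos d).le

theorem norm_hat_mul_conj_le (f g : L2Wiener d) :
    ∀ᵐ ξ, ‖Wiener.hat (Wiener.mul (toW f) (Wiener.conj (toW g))) ξ‖ ≤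
      fc d * ‖toL2 f‖ * ‖toL2 g‖ := by
  have := norm_hat_mul_le f (conj g)
  rwa [norm_toL2_conj, toW_conj] at this

end L2Wiener

/-- If `K̂ ∈ L^p`, then `‖K * (u v̄)‖_W ≲ ‖u‖ ‖v‖` on `L² ∩ W`, the Fourier transform of `u v̄` being
integrable and bounded. -/
theorem nonempty_interaction_l2 {κ : E d → ℂ} {p : ℝ≥0∞} (hp : 1 ≤ p) (hκ : MemLp κ p volume) :
    Nonempty (Interaction κ (l2WienerSpace d)) := by
  obtain ⟨C, hC0, hC⟩ := exists_integral_mul_le hp hκ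
  have hc := fc_pos d
  have h : ∀ u v : L2Wiener d, _ := fun u v =>
    hC (Wiener.hat (Wiener.mul (L2Wiener.toW u) (Wiener.conj (L2Wiener.toW v))))
      (fc d * ‖L2Wiener.toL2 u‖ * ‖L2Wiener.toL2 v‖)
      (Wiener.integrable_hat _) (by positivity) (L2Wiener.norm_hat_mul_conj_le u v)
  refine ⟨Interaction.ofBound ((fc d)⁻¹ * (C * (2 * fc d)))
    (fun u v => by
      simp only [mul_assoc]
      exact (h u v).1.const_mul ((fc d)⁻¹ : ℂ))
    (fun u v => ?_)⟩
  have h1 := (h u v).2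
  rw [← Wiener.norm_eq_integral] at h1
  have h2 : ‖Wiener.mul (L2Wiener.toW u) (Wiener.conj (L2Wiener.toW v))‖ ≤
      fc d * ‖L2Wiener.toW u‖ * ‖L2Wiener.toW v‖ := by
    have := Wiener.norm_prod_le (L2Wiener.toW u) (Wiener.conj (L2Wiener.toW v))
    rwa [Wiener.norm_conj] at this
  simp only [mul_assoc, norm_mul (_⁻¹), norm_inv, Complex.norm_real, Real.norm_of_nonneg hc.le]
  rw [integral_const_mul]
  refine mul_le_mul_of_nonneg_left ?_ (by positivity)
  refine h1.trans (mul_le_mul_of_nonneg_left ?_ hC0)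
  have e1 := L2Wiener.norm_toW_le u
  have e2 := L2Wiener.norm_toW_le v
  have e3 := L2Wiener.norm_toL2_le u
  have e4 := L2Wiener.norm_toL2_le v
  calc ‖Wiener.mul (L2Wiener.toW u) (Wiener.conj (L2Wiener.toW v))‖ +
        fc d * ‖L2Wiener.toL2 u‖ * ‖L2Wiener.toL2 v‖
      ≤ fc d * ‖u‖ * ‖v‖ + fc d * ‖u‖ * ‖v‖ := by
        refine add_le_add (h2.trans ?_) ?_ <;> gcongr
    _ = _ := by ring

/-- If `K̂ ∈ L^∞`, then `‖K * (u v̄)‖_W ≲ ‖u‖_W ‖v‖_W`, as `W` is an algebra. -/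
theorem nonempty_interaction_wiener {κ : E d → ℂ} (hκ : MemLp κ ∞ volume) :
    Nonempty (Interaction κ (wienerSpace d)) := by
  obtain ⟨C, hC0, hC⟩ := integrable_and_integral_mul_le_of_memLp_top hκ
  have hc := fc_pos d
  have h : ∀ u v : Wiener d, _ := fun u v =>
    hC (Wiener.hat (Wiener.mul u (Wiener.conj v))) (Wiener.integrable_hat _)
  refine ⟨Interaction.ofBound ((fc d)⁻¹ * (C * fc d))
    (fun u v => by
      simp only [mul_assoc]
      exact (h u v).1.const_mul ((fc d)⁻¹ : ℂ))
    (fun u v => ?_)⟩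
  have h1 := (h u v).2
  rw [← Wiener.norm_eq_integral] at h1
  have h2 : ‖Wiener.mul u (Wiener.conj v)‖ ≤ fc d * ‖u‖ * ‖v‖ := by
    have := Wiener.norm_prod_le u (Wiener.conj v)
    rwa [Wiener.norm_conj] at this
  simp only [mul_assoc, norm_mul (_⁻¹), norm_inv, Complex.norm_real, Real.norm_of_nonneg hc.le]
  rw [integral_const_mul]
  refine mul_le_mul_of_nonneg_left ?_ (by positivity)
  refine h1.trans (mul_le_mul_of_nonneg_left ?_ hC0)
  simpa only [mul_assoc] using h2

/-! ### Real-valued kernels -/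

theorem fourier_eq_invFourier_neg (f : E d → ℂ) (ξ : E d) : fourier f ξ = invFourier f (-ξ) := by
  simp only [fourier, invFourier, inner_neg_left]
  congr 2
  ext x
  rw [real_inner_comm]
  push_cast
  rw [mul_neg]

/-- The Fourier transform, with the normalization `(2π)^{-d/2} ∫ e^{-i x·ξ} f(x) dx`, of a
Schwartz function. -/
def schwartzFourier (φ : 𝓢(E d, ℂ)) : 𝓢(E d, ℂ) :=
  (fc d : ℂ) • SchwartzMap.compCLMOfContinuousLinearEquiv ℂ
    (ContinuousLinearEquiv.smulLeft (R₁ := ℝ) (M₁ := E d)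
      (Units.mk0 ((2 * Real.pi)⁻¹ : ℝ) (by positivity))) (𝓕 φ)

theorem schwartzFourier_apply (φ : 𝓢(E d, ℂ)) (ξ : E d) : schwartzFourier φ ξ = fourier φ ξ := by
  rw [fourier_eq_invFourier_neg, invFourier_eq]
  simp only [schwartzFourier, _root_.smul_apply, smul_eq_mul,
    SchwartzMap.compCLMOfContinuousLinearEquiv_apply, Function.comp]
  rw [SchwartzMap.fourier_coe]
  congr 2
  rw [neg_smul_neg]
  rfl

/-- The reflection of a Schwartz function. -/
def schwartzNeg (φ : 𝓢(E d, ℂ)) : 𝓢(E d, ℂ) :=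
  SchwartzMap.compCLMOfContinuousLinearEquiv ℂ (ContinuousLinearEquiv.neg ℝ (M := E d)) φ

theorem schwartzNeg_apply (φ : 𝓢(E d, ℂ)) (ξ : E d) : schwartzNeg φ ξ = φ (-ξ) := rfl

/-- The Fourier transform of a real-valued distribution is conjugate symmetric. -/
theorem conj_symm_of_isRealValued {K : 𝓢'(E d, ℂ)} {κ : E d → ℂ} (hK : HasFourierTransform K κ)
    (hr : IsRealValued K) (hκ : LocallyIntegrable κ) :
    ∀ᵐ ξ, κ (-ξ) = starRingEnd ℂ (κ ξ) := by
  have hκ' : LocallyIntegrable fun ξ => starRingEnd ℂ (κ (-ξ)) := by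
    rw [locallyIntegrable_iff] at hκ ⊢
    intro k hk
    have h1 : IntegrableOn κ (Neg.neg ⁻¹' k) := hκ _ (by
      rw [Set.neg_preimage]; exact hk.neg)
    have h2 : IntegrableOn (fun ξ => κ (-ξ)) k := by
      have := (Measure.measurePreserving_neg (volume : Measure (E d))).integrableOn_comp_preimage
        (Homeomorph.neg (E d)).measurableEmbedding (f := κ) (s := Neg.neg ⁻¹' k)
      have e : (Neg.neg ⁻¹' (Neg.neg ⁻¹' k) : Set (E d)) = k := by ext; simp
      rw [e] at this
      exact this.2 h1
    exact Complex.conjLIE.toContinuousLinearEquiv.toContinuousLinearMap.integrable_comp h2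
  have key : κ =ᵐ[volume] fun ξ => starRingEnd ℂ (κ (-ξ)) := by
    refine ae_eq_of_integral_contDiff_smul_eq hκ hκ' fun χ hχ hχc => ?_
    have hc : HasCompactSupport (fun x => (χ x : ℂ)) := hχc.comp_left (g := Complex.ofReal) rfl
    have hs : ContDiff ℝ ((⊤ : ℕ∞) : WithTop ℕ∞) (fun x => (χ x : ℂ)) :=
      Complex.ofRealCLM.contDiff.comp hχ
    set φ : 𝓢(E d, ℂ) := hc.toSchwartzMap hs with hφ
    have hφa : ∀ x, φ x = (χ x : ℂ) := fun x => rfl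
    have ha := hK φ _ (schwartzFourier_apply φ)
    have hb := hK (schwartzNeg φ) _ (schwartzFourier_apply (schwartzNeg φ))
    have hconj : ∀ x, schwartzFourier (schwartzNeg φ) x
        = starRingEnd ℂ (schwartzFourier φ x) := by
      intro x
      rw [schwartzFourier_apply, schwartzFourier_apply, fourier_eq_invFourier_neg,
        fourier_eq_invFourier_neg, ← Wiener.invFourier_conj_neg]
      congr 1
      funext ξ
      rw [schwartzNeg_apply, hφa, Complex.conj_ofReal]
    have h1 := hr (schwartzFourier φ + schwartzFourier (schwartzNeg φ)) (fun x => by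
      rw [_root_.add_apply, hconj, Complex.add_im, Complex.conj_im, add_neg_cancel])
    have h2 := hr (Complex.I • (schwartzFourier φ - schwartzFourier (schwartzNeg φ))) (fun x => by
      rw [_root_.smul_apply, _root_.sub_apply, hconj]
      simp)
    rw [map_add, ha, hb, Complex.add_im] at h1
    rw [map_smul, map_sub, ha, hb, smul_eq_mul, Complex.mul_im, Complex.I_re, Complex.I_im,
      zero_mul, one_mul, zero_add, Complex.sub_re] at h2
    have e1 : ∫ ξ, χ ξ • κ ξ = ∫ ξ, κ ξ * φ ξ := by
      congr 1; ext ξ; rw [hφa, mul_comm, Complex.real_smul]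
    have e2 : ∫ ξ, χ ξ • starRingEnd ℂ (κ (-ξ)) =
        starRingEnd ℂ (∫ ξ, κ ξ * schwartzNeg φ ξ) := by
      rw [← integral_conj, ← integral_neg_eq_self]
      congr 1; ext ξ
      rw [schwartzNeg_apply, hφa, map_mul, Complex.conj_ofReal, mul_comm, Complex.real_smul,
        neg_neg]
    rw [e1, e2]
    apply Complex.ext
    · rw [Complex.conj_re]; linarith
    · rw [Complex.conj_im]; linarith
  filter_upwards [key] with ξ h
  rw [h]
  simp

namespace Interaction

/-- For a real-valued kernel the potential `K * |u|²` is real. -/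
theorem im_pot_eq_zero {S : Type} [NormedAddCommGroup S] [NormedSpace ℂ S] {κ : E d → ℂ}
    {A : StateSpace d S} (P : Interaction κ A) (hκ : ∀ᵐ ξ, κ (-ξ) = starRingEnd ℂ (κ ξ)) (u : S)
    (x : E d) : (P.pot u u x).im = 0 := by
  set h : Wiener d := Wiener.mul (A.toW u) (Wiener.conj (A.toW u)) with hh
  have hc : Wiener.conj h = h := Wiener.ext fun x => by
    rw [Wiener.conj_apply, hh, mul_conj_apply, Complex.conj_ofReal]
  have hV : Wiener.conj (P.pot u u) = P.pot u u := by
    refine Wiener.eq_of_hat_ae_eq ?_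
    have hneg := (Measure.measurePreserving_neg (volume : Measure (E d))).quasiMeasurePreserving
    have h4 := Wiener.hat_conj h
    rw [hc] at h4
    filter_upwards [Wiener.hat_conj (P.pot u u), P.hat_pot u u, hneg.ae (P.hat_pot u u), hκ,
      h4] with ξ h1 h2 h3 h4 h5
    rw [h1, h2, h3, h4, ← hh, map_mul, map_mul, ← h5, Complex.conj_conj]
    simp
  have := congrArg (fun f : Wiener d => f x) hV
  simp only [Wiener.conj_apply] at this
  exact Complex.conj_eq_iff_im.1 this

/-! ### Conservation of the `L²` norm -/

variable {κ : E d → ℂ} (P : Interaction κ (l2WienerSpace d))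

/-- As the potential is real, `-i (K * |u|²) u` is orthogonal to `u` in `L²` for the real inner
product. -/
theorem inner_toL2_nonlin (hκ : ∀ᵐ ξ, κ (-ξ) = starRingEnd ℂ (κ ξ)) (u : L2Wiener d) :
    inner ℝ (L2Wiener.toL2 u) (L2Wiener.toL2 (-Complex.I • P.nonlin u)) = 0 := by
  rw [L2.inner_def]
  refine integral_eq_zero_of_ae ?_
  filter_upwards [L2Wiener.coeFn_toL2 u, L2Wiener.coeFn_toL2 (-Complex.I • P.nonlin u)]
    with x h1 h2
  have him := P.im_pot_eq_zero hκ u x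
  have hre : P.pot u u x = ((P.pot u u x).re : ℂ) := Complex.ext rfl (by simpa using him)
  have h3 : (-Complex.I • P.nonlin u) x = -Complex.I * (P.pot u u x * u x) := by
    rw [L2Wiener.smul_apply]
    exact congrArg _ (L2Wiener.mul_apply (P.pot u u) u x)
  rw [h1, h2, h3, hre, Complex.inner, Pi.zero_apply]
  simp
  ring

/-- The factor `a` allows for the truncated equation, whose field is a real multiple of the field
at each point. -/
theorem hasDerivAt_norm_toL2_sq (hκ : ∀ᵐ ξ, κ (-ξ) = starRingEnd ℂ (κ ξ)) {v : ℝ → L2Wiener d}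
    {a t : ℝ} (hv : HasDerivAt v (a • P.field t (v t)) t) :
    HasDerivAt (fun s => ‖L2Wiener.toL2 (v s)‖ ^ 2) 0 t := by
  let L : L2Wiener d →L[ℝ] Lp ℂ 2 (volume : Measure (E d)) :=
    (L2Wiener.toL2L.comp (L2Wiener.group t).toContinuousLinearMap).restrictScalars ℝ
  have hL : ∀ f, L f = L2Wiener.toL2 (L2Wiener.group t f) := fun f => rfl
  have h1 : HasDerivAt (fun s => L (v s)) (L (a • P.field t (v t))) t :=
    L.hasFDerivAt.comp_hasDerivAt t hv
  have h2 := h1.norm_sq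
  have e : inner ℝ (L (v t)) (L (a • P.field t (v t))) = 0 := by
    rw [map_smul, inner_smul_right, hL, hL]
    have e2 : L2Wiener.group t (P.field t (v t)) =
        -Complex.I • P.nonlin (L2Wiener.group t (v t)) := by
      rw [field, map_smul]
      exact congrArg _ ((l2WienerSpace d).group_group_neg t _)
    rw [e2, P.inner_toL2_nonlin hκ, mul_zero]
  rw [e, mul_zero] at h2
  refine h2.congr_of_eventuallyEq (Filter.Eventually.of_forall fun s => ?_)
  simp only [hL, L2Wiener.norm_toL2_group]

/-- Conservation of the `L²` norm along the curves `v' = a(t) field t v`, with `a` real. -/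
theorem norm_toL2_eq_of_hasDerivAt (hκ : ∀ᵐ ξ, κ (-ξ) = starRingEnd ℂ (κ ξ))
    {v : ℝ → L2Wiener d} {a : ℝ → ℝ} {T₀ T : ℝ} (hT₀ : T₀ ≤ 0) (hT : 0 ≤ T)
    (hv : ∀ t ∈ Icc T₀ T, HasDerivAt v (a t • P.field t (v t)) t) :
    ∀ t ∈ Icc T₀ T, ‖L2Wiener.toL2 (v t)‖ = ‖L2Wiener.toL2 (v 0)‖ := by
  have hd : ∀ t ∈ Icc T₀ T, HasDerivAt (fun s => ‖L2Wiener.toL2 (v s)‖ ^ 2) 0 t := fun t ht =>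
    P.hasDerivAt_norm_toL2_sq hκ (hv t ht)
  have hc := constant_of_has_deriv_right_zero
    (fun t ht => (hd t ht).continuousAt.continuousWithinAt)
    (fun t ht => (hd t (Ico_subset_Icc_self ht)).hasDerivWithinAt)
  intro t ht
  have := (hc t ht).trans (hc 0 ⟨hT₀, hT⟩).symm
  exact (pow_left_inj₀ (norm_nonneg _) (norm_nonneg _) two_ne_zero).1 this

/-- Conservation of the `L²` norm. -/
theorem IsMild.norm_toL2_eq (hκ : ∀ᵐ ξ, κ (-ξ) = starRingEnd ℂ (κ ξ)) {T₀ T : ℝ} (hT₀ : T₀ ≤ 0)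
    (hT : 0 ≤ T) {u₀ : L2Wiener d} {w : ℝ → L2Wiener d} (hw : Continuous w)
    (h : P.IsMild (Icc T₀ T) u₀ w) :
    ∀ t ∈ Icc T₀ T, ‖L2Wiener.toL2 (w t)‖ = ‖L2Wiener.toL2 u₀‖ := by
  obtain ⟨v, h0, -, he, hd⟩ := IsMild.exists_curve P hw h
  intro t ht
  have := P.norm_toL2_eq_of_hasDerivAt hκ (a := fun _ => 1) hT₀ hT
    (fun t ht => by simpa using hd t ht) t ht
  rw [h0, he t ht] at this
  rw [← this]
  exact (L2Wiener.norm_toL2_group _ _).symm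

/-! ### Global existence -/

theorem nonlin_smul (a : ℝ) (u : L2Wiener d) : P.nonlin (a • u) = a ^ 3 • P.nonlin u := by
  have h : ∀ (V : Wiener d) (f : L2Wiener d) (a : ℝ), (l2WienerSpace d).mul V (a • f) =
      a • (l2WienerSpace d).mul V f := fun V f a => by
    rw [← Complex.coe_smul, map_smul, Complex.coe_smul]
  have h' : ∀ (V : Wiener d) (f : L2Wiener d) (a : ℝ), (l2WienerSpace d).mul (a • V) f =
      a • (l2WienerSpace d).mul V f := fun V f a => by
    rw [← Complex.coe_smul, map_smul, _root_.smul_apply, Complex.coe_smul]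
  simp only [nonlin, map_smul, _root_.smul_apply]
  rw [h, h', h', smul_smul, smul_smul]
  congr 1
  ring

/-- By homogeneity the truncation only multiplies the vector field by a real factor, so that the
truncated equation conserves the `L²` norm too. -/
theorem truncField_eq (R t : ℝ) (v : L2Wiener d) :
    P.truncField R t v = cutoff R v ^ 3 • P.field t v := by
  have h : ∀ (s : ℝ) (f : L2Wiener d) (a : ℝ), (l2WienerSpace d).group s (a • f) =
      a • (l2WienerSpace d).group s f := fun s f a => by
    rw [← Complex.coe_smul, map_smul, Complex.coe_smul]
  rw [truncField, field, field, h, nonlin_smul, h, smul_comm]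

theorem norm_pot_le_of_integrable (hκ : Integrable κ) (u v : L2Wiener d) :
    ‖P.pot u v‖ ≤ (∫ ξ, ‖κ ξ‖) * ‖L2Wiener.toL2 u‖ * ‖L2Wiener.toL2 v‖ := by
  have hc := fc_pos d
  rw [Wiener.norm_eq_integral, mul_assoc, ← integral_mul_const]
  refine integral_mono_ae (Wiener.integrable_hat _).norm (hκ.norm.mul_const _) ?_
  filter_upwards [P.hat_pot u v, L2Wiener.norm_hat_mul_conj_le u v] with ξ h1 h2
  rw [h1, norm_mul, norm_mul, norm_inv, Complex.norm_real, Real.norm_of_nonneg hc.le]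
  calc (fc d)⁻¹ * ‖κ ξ‖ * _ ≤ (fc d)⁻¹ * ‖κ ξ‖ *
        (fc d * ‖L2Wiener.toL2 u‖ * ‖L2Wiener.toL2 v‖) := by gcongr; exact h2
    _ = _ := by field_simp

/-- Existence on arbitrary time intervals for a real-valued `K` with `K̂ ∈ L¹`. The truncated
equation conserves the `L²` norm, so the potential is bounded in `W` by a constant that does not
depend on the radius `R` of the truncation; Gronwall's inequality bounds the solution by
`‖u₀‖ e^{kT} < R`, and the truncation is inactive. -/
theorem exists_isMild_of_integrable (hκ : Integrable κ)
    (hs : ∀ᵐ ξ, κ (-ξ) = starRingEnd ℂ (κ ξ)) (u₀ : L2Wiener d) {T : ℝ} (hT : 0 < T) :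
    ∃ w : ℝ → L2Wiener d, Continuous w ∧ P.IsMild (Icc (-T) T) u₀ w := by
  have hκ0 : 0 ≤ ∫ ξ, ‖κ ξ‖ := integral_nonneg fun _ => norm_nonneg _
  set k : ℝ := ‖(l2WienerSpace d).mul‖ * ((∫ ξ, ‖κ ξ‖) * ‖L2Wiener.toL2 u₀‖ ^ 2) with hk
  have hk0 : 0 ≤ k := by positivity
  set R : ℝ := ‖u₀‖ * Real.exp (k * T) + 1 with hR
  have hR0 : 0 < R := by positivity
  obtain ⟨v, hv, h⟩ := P.exists_truncated hR0 hT.le u₀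
  have hG : Continuous fun τ => P.truncField R τ (v τ) :=
    P.continuous_field_comp ((continuous_cutoff_smul hR0).comp hv)
  set y : ℝ → L2Wiener d := fun t => u₀ + ∫ τ in (0 : ℝ)..t, P.truncField R τ (v τ) with hy
  have hyv : ∀ t ∈ Icc (-T) T, y t = v t := fun t ht => (h t ht).symm
  have hd : ∀ t ∈ Icc (-T) T, HasDerivAt y (cutoff R (y t) ^ 3 • P.field t (y t)) t := by
    intro t ht
    rw [← truncField_eq, hyv t ht]
    exact (intervalIntegral.integral_hasDerivAt_right (hG.intervalIntegrable _ _)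
      (hG.stronglyMeasurableAtFilter _ _) hG.continuousAt).const_add u₀
  have hy0 : y 0 = u₀ := by simp [hy]
  have hL2 : ∀ t ∈ Icc (-T) T, ‖L2Wiener.toL2 (y t)‖ = ‖L2Wiener.toL2 u₀‖ := by
    have := P.norm_toL2_eq_of_hasDerivAt hs (by linarith) hT.le hd
    rwa [hy0] at this
  have hfield : ∀ t ∈ Icc (-T) T, ‖cutoff R (y t) ^ 3 • P.field t (y t)‖ ≤ k * ‖y t‖ + 0 := by
    intro t ht
    rw [norm_smul, norm_pow, Real.norm_of_nonneg (cutoff_nonneg hR0 _), add_zero]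
    refine (mul_le_of_le_one_left (norm_nonneg _)
      (pow_le_one₀ (cutoff_nonneg hR0 _) (cutoff_le_one hR0 _))).trans ?_
    rw [field, norm_smul, norm_neg, Complex.norm_I, one_mul, LinearIsometry.norm_map, nonlin]
    refine ((l2WienerSpace d).mul.le_opNorm₂ _ _).trans ?_
    rw [LinearIsometry.norm_map, hk]
    have hp := P.norm_pot_le_of_integrable hκ ((l2WienerSpace d).group t (y t))
      ((l2WienerSpace d).group t (y t))
    have e : ‖L2Wiener.toL2 ((l2WienerSpace d).group t (y t))‖ = ‖L2Wiener.toL2 u₀‖ :=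
      (L2Wiener.norm_toL2_group t (y t)).trans (hL2 t ht)
    rw [e, mul_assoc, ← sq] at hp
    gcongr
  have hexp : ∀ s ∈ Icc 0 T, ‖u₀‖ * Real.exp (k * (s - 0)) ≤ R := by
    intro s hs
    rw [sub_zero, hR]
    have : Real.exp (k * s) ≤ Real.exp (k * T) :=
      Real.exp_le_exp.2 (mul_le_mul_of_nonneg_left hs.2 hk0)
    nlinarith [norm_nonneg u₀]
  have hb : ∀ t ∈ Icc (-T) T, ‖y t‖ ≤ R := by
    intro t ht
    rcases le_total 0 t with h0 | h0
    · have hsub : ∀ s ∈ Icc 0 T, s ∈ Icc (-T) T := fun s hs => ⟨by linarith [hs.1], hs.2⟩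
      have := norm_le_gronwallBound_of_norm_deriv_right_le (f := y)
        (fun s hs => (hd s (hsub s hs)).continuousAt.continuousWithinAt)
        (fun s hs => (hd s (hsub s (Ico_subset_Icc_self hs))).hasDerivWithinAt)
        (δ := ‖u₀‖) (by rw [hy0]) (fun s hs => hfield s (hsub s (Ico_subset_Icc_self hs)))
        t ⟨h0, ht.2⟩
      rw [gronwallBound_ε0] at this
      exact this.trans (hexp t ⟨h0, ht.2⟩)
    · have hsub : ∀ s ∈ Icc 0 T, -s ∈ Icc (-T) T := fun s hs =>
        ⟨by linarith [hs.2], by linarith [hs.1]⟩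
      have hd' : ∀ s ∈ Icc 0 T, HasDerivAt (fun s => y (-s))
          (-(cutoff R (y (-s)) ^ 3 • P.field (-s) (y (-s)))) s := fun s hs => by
        have := (hd (-s) (hsub s hs)).scomp s (hasDerivAt_neg s)
        rw [neg_one_smul] at this
        exact this
      have := norm_le_gronwallBound_of_norm_deriv_right_le (f := fun s => y (-s))
        (fun s hs => (hd' s hs).continuousAt.continuousWithinAt)
        (fun s hs => (hd' s (Ico_subset_Icc_self hs)).hasDerivWithinAt)
        (δ := ‖u₀‖) (by rw [neg_zero, hy0]) (fun s hs => by
          rw [norm_neg]; exact hfield (-s) (hsub s (Ico_subset_Icc_self hs)))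
        (-t) ⟨by linarith, by linarith [ht.1]⟩
      rw [gronwallBound_ε0, neg_neg] at this
      exact this.trans (hexp (-t) ⟨by linarith, by linarith [ht.1]⟩)
  exact ⟨_, (l2WienerSpace d).continuous_group_comp continuous_id hv,
    P.isMild_of_truncated hR0 ordConnected_Icc ⟨by linarith, hT.le⟩ hv h
      fun t ht => by rw [← hyv t ht]; exact hb t ht⟩

end Interaction

/-! ### Well-posedness in `L² ∩ W` and in `W` -/

/-- Well-posedness in `L² ∩ W` for `K̂ ∈ L^p`. -/
theorem wellPosed_l2Wiener {p : ℝ≥0∞} {K : 𝓢'(E d, ℂ)} {κ : E d → ℂ} (hp : 1 ≤ p)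
    (hK : HasFourierTransform K κ) (hκ : MemLp κ p volume) :
    (∀ u₀ : L2Wiener d, ∃ T : ℝ, 0 < T ∧ ∃ u : C(Icc (-T) T, L2Wiener d),
      (∀ v : C(Icc (-T) T, L2Wiener d),
        IsSolution κ (Icc (-T) T) u₀.toW (fun t => (v t).toW) ↔ v = u) ∧
      (IsRealValued K → ∀ t, ‖(u t).toL2‖ = ‖u₀.toL2‖)) ∧
    LocallyWellPosed κ (L2Wiener d) L2Wiener.toW ∧
    (p = 1 → IsRealValued K → ∀ u₀ : L2Wiener d, ∃ u : C(ℝ, L2Wiener d),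
      (∀ v : C(ℝ, L2Wiener d),
        IsSolution κ univ u₀.toW (fun t => (v t).toW) ↔ v = u) ∧
      ∀ t, ‖(u t).toL2‖ = ‖u₀.toL2‖) := by
  obtain ⟨P⟩ := nonempty_interaction_l2 hp hκ
  have hsymm : IsRealValued K → ∀ᵐ ξ, κ (-ξ) = starRingEnd ℂ (κ ξ) := fun hr =>
    conj_symm_of_isRealValued hK hr (hκ.locallyIntegrable hp)
  refine ⟨fun u₀ => ?_, P.locallyWellPosed _ fun _ => rfl, ?_⟩
  · obtain ⟨T, hT, hex⟩ := P.exists_isMild_local (norm_nonneg u₀)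
    obtain ⟨w, hw, hm, -⟩ := hex u₀ le_rfl
    exact ⟨T, hT, _, P.isSolution_iff_eq (by linarith) hT.le hw hm, fun hr t =>
      Interaction.IsMild.norm_toL2_eq P (hsymm hr) (by linarith) hT.le hw hm t t.2⟩
  · rintro rfl hr u₀
    obtain ⟨w, hw, hm⟩ := P.exists_isMild_univ fun T hT =>
      P.exists_isMild_of_integrable (memLp_one_iff_integrable.1 hκ) (hsymm hr) u₀ hT
    refine ⟨⟨w, hw⟩, P.isSolution_univ_iff_eq hw hm, fun t => ?_⟩
    exact Interaction.IsMild.norm_toL2_eq P (hsymm hr) (T₀ := -|t|) (T := |t|) (by simp) (by simp) hw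
      (Interaction.IsMild.mono P (subset_univ _) hm) t (abs_le.1 le_rfl)

/-- Well-posedness in `W` for `K̂ ∈ L^∞`. -/
theorem wellPosed_wiener {κ : E d → ℂ} (hκ : MemLp κ ∞ volume) :
    (∀ u₀ : Wiener d, ∃ T : ℝ, 0 < T ∧ ∃ u : C(Icc (-T) T, Wiener d),
      ∀ v : C(Icc (-T) T, Wiener d), IsSolution κ (Icc (-T) T) u₀ v ↔ v = u) ∧
    LocallyWellPosed κ (Wiener d) LinearMap.id := by
  obtain ⟨P⟩ := nonempty_interaction_wiener hκ
  refine ⟨fun u₀ => ?_, P.locallyWellPosed _ fun _ => rfl⟩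
  obtain ⟨T, hT, hex⟩ := P.exists_isMild_local (norm_nonneg u₀)
  obtain ⟨w, hw, hm, -⟩ := hex u₀ le_rfl
  exact ⟨T, hT, _, P.isSolution_iff_eq (by linarith) hT.le hw hm⟩

/-! ### The truncated Riesz kernel -/

theorem integrableOn_norm_rpow (hd : 1 ≤ d) {β : ℝ} (hβ : β < d) (r : ℝ) :
    IntegrableOn (fun ξ : E d => ‖ξ‖ ^ (-β)) (Metric.closedBall 0 r) := by
  have : Nonempty (Fin d) := ⟨⟨0, hd⟩⟩
  refine IntegrableOn.mono_set (t := Metric.ball 0 (|r| + 1)) ?_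
    (Metric.closedBall_subset_ball (by linarith [le_abs_self r]))
  rw [integrableOn_fun_norm_addHaar volume (f := fun y => y ^ (-β)), finrank_euclideanSpace_fin]
  refine ((intervalIntegral.integrableOn_Ioo_rpow_iff (s := (d : ℝ) - 1 - β)
    (by positivity)).2 (by linarith)).congr_fun (fun y hy => ?_) measurableSet_Ioo
  have e : y ^ (d - 1) = y ^ ((d : ℝ) - 1) := by
    rw [← Real.rpow_natCast, Nat.cast_sub hd, Nat.cast_one]
  simp only [smul_eq_mul]
  rw [e, ← Real.rpow_add hy.1]
  rfl

theorem integrable_indicator_norm_rpow (hd : 1 ≤ d) {β : ℝ} (hβ : β < d) :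
    Integrable ((Metric.closedBall (0 : E d) 1).indicator fun ξ => ‖ξ‖ ^ (-β)) :=
  (integrable_indicator_iff measurableSet_closedBall).2 (integrableOn_norm_rpow hd hβ 1)

theorem truncatedRiesz_eq_ofReal (γ : ℝ) (ξ : E d) : truncatedRiesz d γ ξ =
    (((Metric.closedBall (0 : E d) 1).indicator (fun ξ => ‖ξ‖ ^ (-((d : ℝ) - γ))) ξ : ℝ) : ℂ) := by
  rw [truncatedRiesz]
  by_cases h : ξ ∈ Metric.closedBall (0 : E d) 1 <;> simp [h]

theorem norm_truncatedRiesz (γ : ℝ) (ξ : E d) : ‖truncatedRiesz d γ ξ‖ =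
    (Metric.closedBall (0 : E d) 1).indicator (fun ξ => ‖ξ‖ ^ (-((d : ℝ) - γ))) ξ := by
  rw [truncatedRiesz_eq_ofReal, Complex.norm_real, Real.norm_of_nonneg]
  exact indicator_nonneg (fun _ _ => by positivity) _

theorem truncatedRiesz_of_lt {γ : ℝ} {ξ : E d} (h : 1 < ‖ξ‖) : truncatedRiesz d γ ξ = 0 := by
  rw [truncatedRiesz, indicator_of_notMem]
  simpa using h

theorem truncatedRiesz_neg (γ : ℝ) (ξ : E d) : truncatedRiesz d γ (-ξ) = truncatedRiesz d γ ξ := by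
  simp [truncatedRiesz, indicator]

theorem conj_truncatedRiesz (γ : ℝ) (ξ : E d) :
    starRingEnd ℂ (truncatedRiesz d γ ξ) = truncatedRiesz d γ ξ := by
  rw [truncatedRiesz_eq_ofReal, Complex.conj_ofReal]

theorem aestronglyMeasurable_truncatedRiesz (γ : ℝ) :
    AEStronglyMeasurable (truncatedRiesz d γ) volume :=
  ((by fun_prop : Measurable fun ξ : E d => ((‖ξ‖ ^ (-((d : ℝ) - γ)) : ℝ) : ℂ)).indicator
    measurableSet_closedBall).aestronglyMeasurable

theorem memLp_truncatedRiesz (hd : 1 ≤ d) {γ : ℝ} {p : ℝ≥0∞} (hp : 1 ≤ p) (hp' : p ≠ ∞)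
    (hγ : ((d : ℝ) - γ) * p.toReal < d) : MemLp (truncatedRiesz d γ) p volume := by
  have hp0 : p ≠ 0 := (zero_lt_one.trans_le hp).ne'
  have hq : 0 < p.toReal := ENNReal.toReal_pos hp0 hp'
  refine (integrable_norm_rpow_iff (aestronglyMeasurable_truncatedRiesz γ) hp0 hp').1 ?_
  refine (integrable_indicator_norm_rpow hd hγ).congr (Filter.Eventually.of_forall fun ξ => ?_)
  simp only [norm_truncatedRiesz]
  by_cases h : ξ ∈ Metric.closedBall (0 : E d) 1
  · rw [indicator_of_mem h, indicator_of_mem h, ← Real.rpow_mul (norm_nonneg _), neg_mul]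
  · rw [indicator_of_notMem h, indicator_of_notMem h, Real.zero_rpow hq.ne']

theorem not_memLp_top_truncatedRiesz (hd : 1 ≤ d) {γ : ℝ} (hγ : γ < d) :
    ¬ MemLp (truncatedRiesz d γ) ∞ volume := by
  have : Nonempty (Fin d) := ⟨⟨0, hd⟩⟩
  intro h
  have h2 : eLpNormEssSup (truncatedRiesz d γ) volume ≠ ∞ := by
    have := h.2.ne
    rwa [eLpNorm_exponent_top] at this
  set M : ℝ := (eLpNormEssSup (truncatedRiesz d γ) volume).toReal with hM
  have hle : ∀ᵐ ξ, ‖truncatedRiesz d γ ξ‖ ≤ M := by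
    filter_upwards [ae_le_eLpNormEssSup (f := truncatedRiesz d γ)
      (μ := (volume : Measure (E d)))] with ξ hξ
    simpa using ENNReal.toReal_mono h2 hξ
  have hα : 0 < (d : ℝ) - γ := by linarith
  have hlim := tendsto_rpow_neg_nhdsGT_zero (neg_lt_zero.2 hα)
  obtain ⟨δ, hδ, hδM⟩ : ∃ δ : ℝ, 0 < δ ∧ ∀ r ∈ Ioo 0 δ, M < r ^ (-((d : ℝ) - γ)) := by
    have := hlim.eventually_gt_atTop M
    rw [eventually_nhdsWithin_iff, Metric.eventually_nhds_iff] at this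
    obtain ⟨δ, hδ, h⟩ := this
    exact ⟨δ, hδ, fun r hr => h (by rw [Real.dist_eq, sub_zero, abs_of_pos hr.1]; exact hr.2) hr.1⟩
  have hzero : volume (Metric.ball (0 : E d) (min δ 1) \ {0}) = 0 := by
    refine measure_mono_null (fun ξ hξ => ?_) (ae_iff.1 hle)
    have h0 : 0 < ‖ξ‖ := norm_pos_iff.2 hξ.2
    have h1 : ‖ξ‖ < min δ 1 := mem_ball_zero_iff.1 hξ.1
    rw [mem_ofPred_eq, not_le, norm_truncatedRiesz, indicator_of_mem]
    · exact hδM _ ⟨h0, h1.trans_le (min_le_left _ _)⟩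
    · exact mem_closedBall_zero_iff.2 (h1.le.trans (min_le_right _ _))
  rw [measure_sdiff_null (measure_singleton _)] at hzero
  exact (Metric.measure_ball_pos volume (0 : E d) (lt_min hδ one_pos)).ne' hzero

/-- The mass of the singularity `|ξ|^{-(d-γ)}` near the origin. -/
theorem integral_ball_norm_rpow {γ : ℝ} {r : ℝ} (hr : 0 < r) :
    ∫ ξ in Metric.ball (0 : E d) r, ‖ξ‖ ^ (-((d : ℝ) - γ)) =
      r ^ γ * ∫ ξ in Metric.ball (0 : E d) 1, ‖ξ‖ ^ (-((d : ℝ) - γ)) := by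
  have h := Measure.setIntegral_comp_smul_of_pos (volume : Measure (E d))
    (fun ξ => ‖ξ‖ ^ (-((d : ℝ) - γ))) (Metric.ball (0 : E d) 1) hr
  rw [finrank_euclideanSpace_fin, smul_ball hr.ne', smul_zero, Real.norm_of_nonneg hr.le,
    mul_one] at h
  have e : ∀ ξ : E d, ‖r • ξ‖ ^ (-((d : ℝ) - γ)) =
      r ^ (-((d : ℝ) - γ)) * ‖ξ‖ ^ (-((d : ℝ) - γ)) := fun ξ => by
    rw [norm_smul, Real.norm_of_nonneg hr.le, Real.mul_rpow hr.le (norm_nonneg _)]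
  simp only [e] at h
  rw [integral_const_mul, smul_eq_mul, eq_inv_mul_iff_mul_eq₀ (pow_pos hr d).ne', ← mul_assoc,
    ← Real.rpow_natCast, ← Real.rpow_add hr] at h
  rw [← h]
  congr 2
  ring

theorem integral_ball_one_norm_rpow_pos (hd : 1 ≤ d) {γ : ℝ} (hγ : 0 < γ) :
    0 < ∫ ξ in Metric.ball (0 : E d) 1, ‖ξ‖ ^ (-((d : ℝ) - γ)) := by
  have : Nonempty (Fin d) := ⟨⟨0, hd⟩⟩
  have hi : IntegrableOn (fun ξ : E d => ‖ξ‖ ^ (-((d : ℝ) - γ))) (Metric.ball 0 1) :=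
    (integrableOn_norm_rpow hd (by linarith) 1).mono_set Metric.ball_subset_closedBall
  rw [integral_pos_iff_support_of_nonneg (fun _ => by positivity) hi]
  have h1 : 0 < (volume.restrict (Metric.ball (0 : E d) 1)) (Metric.ball (0 : E d) 1 \ {0}) := by
    rw [Measure.restrict_apply (measurableSet_ball.diff (measurableSet_singleton _)),
      inter_eq_left.2 sdiff_subset, measure_sdiff_null (measure_singleton _)]
    exact Metric.measure_ball_pos volume _ one_pos
  refine h1.trans_le (measure_mono fun ξ hξ => ?_)
  exact (Real.rpow_pos_of_pos (norm_pos_iff.2 hξ.2) _).ne'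

/-! ### The kernel with a given Fourier transform -/

/-- The inverse of `schwartzFourier`, as a continuous linear map. -/
def schwartzInvFourier (d : ℕ) : 𝓢(E d, ℂ) →L[ℂ] 𝓢(E d, ℂ) :=
  ((fc d : ℂ)⁻¹) • ((FourierTransform.fourierInvCLM ℂ 𝓢(E d, ℂ)).comp
    (SchwartzMap.compCLMOfContinuousLinearEquiv ℂ
      (ContinuousLinearEquiv.smulLeft (R₁ := ℝ) (M₁ := E d)
        (Units.mk0 ((2 * Real.pi)⁻¹ : ℝ) (by positivity))).symm))

theorem schwartzInvFourier_of_eq_fourier {φ ψ : 𝓢(E d, ℂ)} (h : ∀ ξ, ψ ξ = fourier φ ξ) :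
    schwartzInvFourier d ψ = φ := by
  have hψ : ψ = schwartzFourier φ := by
    ext ξ
    rw [h, schwartzFourier_apply]
  subst hψ
  have hc : (fc d : ℂ) ≠ 0 := Complex.ofReal_ne_zero.2 (fc_pos d).ne'
  set e := ContinuousLinearEquiv.smulLeft (R₁ := ℝ) (M₁ := E d)
        (Units.mk0 ((2 * Real.pi)⁻¹ : ℝ) (by positivity)) with he
  have h1 : SchwartzMap.compCLMOfContinuousLinearEquiv ℂ e.symm (schwartzFourier φ) =
      (fc d : ℂ) • 𝓕 φ := by
    ext ξ
    simp only [schwartzFourier, map_smul, _root_.smul_apply,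
      SchwartzMap.compCLMOfContinuousLinearEquiv_apply, Function.comp]
    rw [← he, e.apply_symm_apply]
  rw [schwartzInvFourier, _root_.smul_apply, ContinuousLinearMap.comp_apply, h1, map_smul, smul_smul,
    inv_mul_cancel₀ hc, one_smul, FourierTransform.fourierInvCLM_apply,
    FourierTransform.fourierInv_fourier_eq]

/-- The inverse Fourier transform of a real function is conjugate symmetric. -/
theorem schwartzInvFourier_neg {φ : 𝓢(E d, ℂ)} (h : ∀ x, (φ x).im = 0) (ξ : E d) :
    schwartzInvFourier d φ (-ξ) = starRingEnd ℂ (schwartzInvFourier d φ ξ) := by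
  have hφ : ∀ x, starRingEnd ℂ (φ x) = φ x := fun x => Complex.conj_eq_iff_im.2 (h x)
  have e : ∀ ξ, schwartzInvFourier d φ ξ = (fc d : ℂ)⁻¹ * 𝓕⁻ (fun x => φ
      ((ContinuousLinearEquiv.smulLeft (R₁ := ℝ) (M₁ := E d)
        (Units.mk0 ((2 * Real.pi)⁻¹ : ℝ) (by positivity))).symm x)) ξ := fun ξ => by
    rw [schwartzInvFourier, _root_.smul_apply, ContinuousLinearMap.comp_apply,
      FourierTransform.fourierInvCLM_apply, _root_.smul_apply, SchwartzMap.fourierInv_coe]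
    rfl
  simp only [e, map_mul, map_inv₀, Complex.conj_ofReal]
  rw [Real.fourierInv_eq', Real.fourierInv_eq', ← integral_conj]
  congr 2
  ext x
  simp only [smul_eq_mul, map_mul, ← Complex.exp_conj, inner_neg_right, Complex.conj_I,
    Complex.conj_ofReal, hφ]
  push_cast
  simp

/-- Every function of some `L^p` is the Fourier transform of a tempered distribution, real-valued
if the function is conjugate symmetric. -/
theorem exists_hasFourierTransform {κ : E d → ℂ} {p : ℝ≥0∞} (hp : 1 ≤ p) (hκ : MemLp κ p volume)
    (hs : ∀ᵐ ξ, κ (-ξ) = starRingEnd ℂ (κ ξ)) :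
    ∃ K : 𝓢'(E d, ℂ), IsRealValued K ∧ HasFourierTransform K κ := by
  have : Fact (1 ≤ p) := ⟨hp⟩
  have hK : ∀ ψ : 𝓢(E d, ℂ), (PointwiseConvergenceCLM.precomp ℂ (schwartzInvFourier d)
      (Lp.toTemperedDistribution (hκ.toLp κ)) : 𝓢'(E d, ℂ)) ψ =
        ∫ ξ, κ ξ * schwartzInvFourier d ψ ξ := by
    intro ψ
    refine (Lp.toTemperedDistribution_apply (hκ.toLp κ) (schwartzInvFourier d ψ)).trans ?_
    refine integral_congr_ae ?_
    filter_upwards [hκ.coeFn_toLp] with ξ h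
    rw [h, smul_eq_mul, mul_comm]
  refine ⟨PointwiseConvergenceCLM.precomp ℂ (schwartzInvFourier d)
    (Lp.toTemperedDistribution (hκ.toLp κ)), fun φ hφ => ?_, fun φ ψ h => ?_⟩
  · rw [hK, ← Complex.conj_eq_iff_im, ← integral_conj, ← integral_neg_eq_self]
    refine integral_congr_ae ?_
    filter_upwards [hs] with ξ h
    rw [map_mul, h, schwartzInvFourier_neg hφ, Complex.conj_conj, Complex.conj_conj]
  · rw [hK, schwartzInvFourier_of_eq_fourier h]

/-! ### The linear Schrödinger equation with an integrable potential -/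

/-- An exponential weight makes the Volterra operator with kernel `g` small. -/
theorem exists_exp_weight {g : ℝ → ℝ} (hg : Integrable g) {T : ℝ} {ε : ℝ} (hε : 0 < ε) :
    ∃ Λ : ℝ, 0 < Λ ∧ ∀ t ∈ Icc 0 T,
      Real.exp (-(Λ * t)) * ∫ τ in (0 : ℝ)..t, ‖g τ‖ * Real.exp (Λ * τ) ≤ ε := by
  obtain ⟨h, hgh, hh⟩ := hg.exists_boundedContinuous_integral_sub_le (half_pos hε)
  refine ⟨2 * ‖h‖ / ε + 1, by positivity, fun t ht => ?_⟩
  set Λ : ℝ := 2 * ‖h‖ / ε + 1 with hΛ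
  have hΛ0 : 0 < Λ := by positivity
  have hd : ∀ τ : ℝ, HasDerivAt (fun τ => ‖h‖ * (Real.exp (Λ * τ) / Λ))
      (‖h‖ * Real.exp (Λ * τ)) τ := fun τ => by
    have := ((((hasDerivAt_id τ).const_mul Λ).exp).div_const Λ).const_mul ‖h‖
    simpa [hΛ0.ne'] using this
  have hi2 : Continuous fun τ : ℝ => ‖h‖ * Real.exp (Λ * τ) := by fun_prop
  have h2 : ∫ τ in (0 : ℝ)..t, ‖h‖ * Real.exp (Λ * τ) ≤ ε / 2 * Real.exp (Λ * t) := by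
    rw [intervalIntegral.integral_eq_sub_of_hasDerivAt (fun τ _ => hd τ)
      (hi2.intervalIntegrable _ _), mul_zero, Real.exp_zero]
    have h3 : ‖h‖ / Λ ≤ ε / 2 := by
      rw [div_le_iff₀ hΛ0, hΛ]
      have : ε / 2 * (2 * ‖h‖ / ε + 1) = ‖h‖ + ε / 2 := by field_simp
      rw [this]; linarith
    have h4 : 0 ≤ ‖h‖ * (1 / Λ) := by positivity
    calc ‖h‖ * (Real.exp (Λ * t) / Λ) - ‖h‖ * (1 / Λ) ≤ ‖h‖ / Λ * Real.exp (Λ * t) := by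
          have : ‖h‖ * (Real.exp (Λ * t) / Λ) = ‖h‖ / Λ * Real.exp (Λ * t) := by ring
          linarith
      _ ≤ _ := by gcongr
  have hi1 : IntervalIntegrable (fun τ => ‖g τ - h τ‖) volume 0 t :=
    (hg.sub hh).norm.intervalIntegrable
  have hgi : IntervalIntegrable (fun τ => ‖g τ‖ * Real.exp (Λ * τ)) volume 0 t :=
    hg.norm.intervalIntegrable.mul_continuousOn (by fun_prop)
  have h1 : ∫ τ in (0 : ℝ)..t, ‖g τ‖ * Real.exp (Λ * τ) ≤
      ∫ τ in (0 : ℝ)..t, (‖g τ - h τ‖ * Real.exp (Λ * t) + ‖h‖ * Real.exp (Λ * τ)) := by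
    refine intervalIntegral.integral_mono_on ht.1 hgi
      ((hi1.mul_const _).add (hi2.intervalIntegrable _ _)) fun τ hτ => ?_
    have e1 : ‖g τ‖ ≤ ‖g τ - h τ‖ + ‖h‖ := by
      have := norm_add_le (g τ - h τ) (h τ)
      rw [sub_add_cancel] at this
      exact this.trans (by gcongr; exact h.norm_coe_le_norm τ)
    have e2 : Real.exp (Λ * τ) ≤ Real.exp (Λ * t) :=
      Real.exp_le_exp.2 (mul_le_mul_of_nonneg_left hτ.2 hΛ0.le)
    calc ‖g τ‖ * Real.exp (Λ * τ) ≤ (‖g τ - h τ‖ + ‖h‖) * Real.exp (Λ * τ) := by gcongr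
      _ = ‖g τ - h τ‖ * Real.exp (Λ * τ) + ‖h‖ * Real.exp (Λ * τ) := add_mul _ _ _
      _ ≤ _ := by gcongr
  rw [intervalIntegral.integral_add (hi1.mul_const _) (hi2.intervalIntegrable _ _),
    intervalIntegral.integral_mul_const] at h1
  have h5 : ∫ τ in (0 : ℝ)..t, ‖g τ - h τ‖ ≤ ε / 2 := by
    rw [intervalIntegral.integral_of_le ht.1]
    exact (setIntegral_le_integral (hg.sub hh).norm
      (Filter.Eventually.of_forall fun _ => norm_nonneg _)).trans hgh
  calc _ ≤ Real.exp (-(Λ * t)) * (ε * Real.exp (Λ * t)) := by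
        gcongr
        refine h1.trans ?_
        have := mul_le_mul_of_nonneg_right h5 (Real.exp_pos (Λ * t)).le
        linarith
    _ = ε * (Real.exp (-(Λ * t)) * Real.exp (Λ * t)) := by ring
    _ = ε := by rw [← Real.exp_add, neg_add_cancel, Real.exp_zero, mul_one]

namespace StateSpace

variable {S : Type} [NormedAddCommGroup S] [NormedSpace ℂ S] (A : StateSpace d S)

/-- The generator of the linear equation `i ∂ₜu + Δu = V u` in the interaction picture. -/
def linField (V : ℝ → Wiener d) (τ : ℝ) (x : S) : S :=
  -Complex.I • A.group (-τ) (A.mul (V τ) (A.group τ x))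

theorem norm_linField_le (V : ℝ → Wiener d) (τ : ℝ) (x : S) :
    ‖A.linField V τ x‖ ≤ ‖A.mul‖ * ‖V τ‖ * ‖x‖ := by
  rw [linField, norm_smul, norm_neg, Complex.norm_I, one_mul, LinearIsometry.norm_map]
  refine (A.mul.le_opNorm₂ _ _).trans_eq ?_
  rw [LinearIsometry.norm_map]

theorem linField_sub (V : ℝ → Wiener d) (τ : ℝ) (x y : S) :
    A.linField V τ (x - y) = A.linField V τ x - A.linField V τ y := by
  simp only [linField, map_sub, smul_sub]

theorem linField_smul (V : ℝ → Wiener d) (τ : ℝ) (a : ℝ) (x : S) :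
    A.linField V τ (a • x) = a • A.linField V τ x := by
  simp only [linField, ← Complex.coe_smul, map_smul]
  rw [smul_comm]

theorem toW_linField (V : ℝ → Wiener d) (τ : ℝ) (x : S) :
    A.toW (A.linField V τ x) = (wienerSpace d).linField V τ (A.toW x) := by
  simp only [linField, map_smul, A.toW_group, A.toW_mul]
  rfl

theorem intervalIntegrable_linField {V : ℝ → Wiener d} (hV : Integrable V) {v : ℝ → S}
    (hv : Continuous v) (a b : ℝ) :
    IntervalIntegrable (fun τ => A.linField V τ (v τ)) volume a b := by
  obtain ⟨D, hD⟩ := isCompact_uIcc.exists_bound_of_continuousOn (hv.continuousOn (s := uIcc a b))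
  have hm : AEStronglyMeasurable (fun τ => A.linField V τ (v τ)) volume := by
    have h1 : AEStronglyMeasurable (fun τ => A.mul (V τ) (A.group τ (v τ))) volume :=
      A.mul.aestronglyMeasurable_comp₂ hV.1
        (A.continuous_group_comp continuous_id hv).aestronglyMeasurable
    have h2 : Continuous fun p : ℝ × S => A.group (-p.1) p.2 :=
      A.continuous_group_comp (by fun_prop) continuous_snd
    exact (h2.comp_aestronglyMeasurable
      (aestronglyMeasurable_id.prodMk h1)).const_smul (-Complex.I)
  rw [intervalIntegrable_iff]
  refine ((hV.norm.const_mul (‖A.mul‖ * D)).integrableOn).mono' hm.restrict ?_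
  refine (ae_restrict_iff' measurableSet_uIoc).2 (Filter.Eventually.of_forall fun τ hτ => ?_)
  refine (A.norm_linField_le V τ (v τ)).trans ?_
  have := hD τ (uIoc_subset_uIcc hτ)
  calc ‖A.mul‖ * ‖V τ‖ * ‖v τ‖ ≤ ‖A.mul‖ * ‖V τ‖ * D := by gcongr
    _ = _ := by ring

variable [CompleteSpace S]

/-- Existence and uniqueness in `C([0,T]; S)` for the linear equation with a potential in
`L¹([0,T]; W)`. -/
theorem exists_unique_linear {V : ℝ → Wiener d} (hV : Integrable V) {T : ℝ} (hT : 0 ≤ T)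
    (u₀ : S) :
    (∃ v : ℝ → S, Continuous v ∧
      ∀ t ∈ Icc 0 T, v t = u₀ + ∫ τ in (0 : ℝ)..t, A.linField V τ (v τ)) ∧
    ∀ v w : ℝ → S, Continuous v → Continuous w →
      (∀ t ∈ Icc 0 T, v t = u₀ + ∫ τ in (0 : ℝ)..t, A.linField V τ (v τ)) →
      (∀ t ∈ Icc 0 T, w t = u₀ + ∫ τ in (0 : ℝ)..t, A.linField V τ (w τ)) →
      EqOn v w (Icc 0 T) := by
  obtain ⟨Λ, hΛ, hw⟩ := exists_exp_weight (hV.norm.const_mul ‖A.mul‖) (T := T)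
    (half_pos one_pos)
  -- the unknown is multiplied by the weight `e^{-Λt}`
  let ext : C(Icc 0 T, S) → ℝ → S := fun f => IccExtend hT f
  have hext : ∀ f, Continuous fun τ => Real.exp (Λ * τ) • ext f τ := fun f =>
    (by fun_prop : Continuous fun τ => Real.exp (Λ * τ)).smul f.continuous.Icc_extend'
  have hprim : ∀ f, Continuous fun t =>
      ∫ τ in (0 : ℝ)..t, A.linField V τ (Real.exp (Λ * τ) • ext f τ) := fun f =>
    intervalIntegral.continuous_primitive
      (fun a b => A.intervalIntegrable_linField hV (hext f) a b) 0
  let Φ : C(Icc 0 T, S) → C(Icc 0 T, S) := fun f =>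
    ⟨fun t => Real.exp (-(Λ * t)) •
      (u₀ + ∫ τ in (0 : ℝ)..t, A.linField V τ (Real.exp (Λ * τ) • ext f τ)), by
      have := hprim f
      fun_prop⟩
  have hcon : ContractingWith (1 / 2 : NNReal) Φ := by
    refine ⟨by norm_num, LipschitzWith.of_dist_le_mul fun f g => ?_⟩
    rw [ContinuousMap.dist_le (by positivity)]
    intro t
    have e : Φ f t - Φ g t = Real.exp (-(Λ * t)) • ∫ τ in (0 : ℝ)..t,
        A.linField V τ (Real.exp (Λ * τ) • (ext f τ - ext g τ)) := by
      simp only [Φ, ContinuousMap.coe_mk]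
      rw [← smul_sub, add_sub_add_left_eq_sub, ← intervalIntegral.integral_sub
        (A.intervalIntegrable_linField hV (hext f) 0 t)
        (A.intervalIntegrable_linField hV (hext g) 0 t)]
      simp only [smul_sub, linField_sub]
    rw [dist_eq_norm, e, norm_smul, Real.norm_of_nonneg (Real.exp_pos _).le]
    have hb : ‖∫ τ in (0 : ℝ)..t, A.linField V τ (Real.exp (Λ * τ) • (ext f τ - ext g τ))‖ ≤
        ∫ τ in (0 : ℝ)..t, ‖‖A.mul‖ * ‖V τ‖‖ * Real.exp (Λ * τ) * dist f g := by
      refine intervalIntegral.norm_integral_le_of_norm_le t.2.1 ?_ ?_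
      · refine Filter.Eventually.of_forall fun τ hτ => ?_
        have hτT : τ ∈ Icc 0 T := ⟨hτ.1.le, hτ.2.trans t.2.2⟩
        have h1 : ‖ext f τ - ext g τ‖ ≤ dist f g := by
          simp only [ext]
          rw [IccExtend_of_mem _ _ hτT, IccExtend_of_mem _ _ hτT, ← dist_eq_norm]
          exact ContinuousMap.dist_apply_le_dist _
        rw [linField_smul, norm_smul, Real.norm_of_nonneg (Real.exp_pos _).le,
          Real.norm_of_nonneg (by positivity)]
        calc _ ≤ Real.exp (Λ * τ) * (‖A.mul‖ * ‖V τ‖ * dist f g) := by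
              gcongr
              exact (A.norm_linField_le V τ _).trans (by gcongr)
          _ = _ := by ring
      · exact ((hV.norm.const_mul _).norm.intervalIntegrable.mul_continuousOn
          (by fun_prop)).mul_const _
    rw [intervalIntegral.integral_mul_const] at hb
    calc _ ≤ Real.exp (-(Λ * t)) * ((∫ τ in (0 : ℝ)..t,
          ‖‖A.mul‖ * ‖V τ‖‖ * Real.exp (Λ * τ)) * dist f g) := by gcongr
      _ = (Real.exp (-(Λ * t)) * ∫ τ in (0 : ℝ)..t,
          ‖‖A.mul‖ * ‖V τ‖‖ * Real.exp (Λ * τ)) * dist f g := by ring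
      _ ≤ _ := by
        have := hw t t.2
        push_cast
        gcongr
  -- solutions correspond to fixed points
  have hfix : ∀ v : ℝ → S, ∀ hv : Continuous v,
      (∀ t ∈ Icc 0 T, v t = u₀ + ∫ τ in (0 : ℝ)..t, A.linField V τ (v τ)) →
      Function.IsFixedPt Φ ⟨fun t => Real.exp (-(Λ * t)) • v t, by fun_prop⟩ := by
    intro v hv h
    refine ContinuousMap.ext fun t => ?_
    simp only [Φ, ContinuousMap.coe_mk]
    rw [h t t.2]
    congr 2
    refine intervalIntegral.integral_congr fun τ hτ => ?_
    rw [uIcc_of_le t.2.1] at hτ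
    simp only [ext]
    rw [IccExtend_of_mem _ _ ⟨hτ.1, hτ.2.trans t.2.2⟩, ContinuousMap.coe_mk, smul_smul,
      ← Real.exp_add, add_neg_cancel, Real.exp_zero, one_smul]
  refine ⟨?_, fun v w hv hw h1 h2 t ht => ?_⟩
  · have : Nonempty C(Icc 0 T, S) := ⟨0⟩
    have hf := hcon.fixedPoint_isFixedPt
    set f := hcon.fixedPoint Φ
    refine ⟨_, hext f, fun t ht => ?_⟩
    have h1 := DFunLike.congr_fun hf ⟨t, ht⟩
    simp only [Φ, ContinuousMap.coe_mk] at h1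
    simp only [ext] at h1 ⊢
    rw [IccExtend_of_mem _ _ ht, ← h1, smul_smul, ← Real.exp_add, add_neg_cancel, Real.exp_zero,
      one_smul]
  · have := DFunLike.congr_fun (hcon.fixedPoint_unique' (hfix v hv h1) (hfix w hw h2)) ⟨t, ht⟩
    simp only [ContinuousMap.coe_mk] at this
    exact smul_right_injective S (Real.exp_pos _).ne' this

end StateSpace

/-! ### Persistence of the square integrability -/

/-- A solution in `C([0,T]; W)` with datum in `L² ∩ W` solves a linear equation with potential
in `L¹([0,T]; W)`, hence stays in `L² ∩ W`, where the solution is unique. -/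
theorem Interaction.isSolution_wiener_iff_eq {κ : E d → ℂ} (P : Interaction κ (l2WienerSpace d))
    {T : ℝ} (hT : 0 ≤ T) {φ : L2Wiener d} {w : ℝ → L2Wiener d} (hw : Continuous w)
    (h : P.IsMild (Icc 0 T) φ w) (ψ : C(Icc 0 T, Wiener d)) :
    IsSolution κ (Icc 0 T) φ.toW ψ ↔
      ψ = ⟨fun t => (w t).toW, (L2Wiener.toWL.continuous.comp hw).comp
        continuous_subtype_val⟩ := by
  have hb : ∀ v : C(Icc 0 T, L2Wiener d), IsSolution κ (Icc 0 T) φ.toW (fun t => (v t).toW) ↔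
      v = ⟨fun t => w t, hw.comp continuous_subtype_val⟩ := fun v =>
    P.isSolution_iff_eq le_rfl hT hw h v
  constructor
  swap
  · rintro rfl
    exact (hb ⟨fun t => w t, hw.comp continuous_subtype_val⟩).2 rfl
  intro hψ
  obtain ⟨V, N, hVN, hD⟩ := id hψ
  have hVi : IntegrableOn V (Ioc 0 T) := by
    have := (hD ⟨T, hT, le_rfl⟩).1
    rwa [intervalIntegrable_iff, uIoc_of_le hT] at this
  set V' : ℝ → Wiener d := (Ioc 0 T).indicator V with hV'
  have hV'i : Integrable V' := (integrable_indicator_iff measurableSet_Ioc).2 hVi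
  set ψ' : ℝ → Wiener d := IccExtend hT ψ with hψ'
  have hψc : Continuous ψ' := ψ.continuous.Icc_extend'
  have hvc : Continuous fun t => Wiener.group (-t) (ψ' t) :=
    (wienerSpace d).continuous_group_comp continuous_neg hψc
  have hv : ∀ t ∈ Icc 0 T, Wiener.group (-t) (ψ' t) = φ.toW + ∫ τ in (0 : ℝ)..t,
      (wienerSpace d).linField V' τ (Wiener.group (-τ) (ψ' τ)) := by
    intro t ht
    obtain ⟨-, h2, h3⟩ := hD ⟨t, ht⟩
    have h4 : ψ' t = Wiener.group t φ.toW -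
        Complex.I • ∫ τ in (0 : ℝ)..t, Wiener.schrodinger (t - τ) (N τ) := by
      rw [hψ', IccExtend_of_mem _ _ ht]
      exact h3
    have h5 := (Wiener.group (d := d) (-t)).toContinuousLinearMap.intervalIntegral_comp_comm h2
    simp only [LinearIsometry.coe_toContinuousLinearMap] at h5
    have h6 := (wienerSpace d).group_neg_group t φ.toW
    rw [h4, map_sub, map_smul, ← h5, sub_eq_add_neg, ← neg_smul, ← intervalIntegral.integral_smul]
    refine congrArg₂ _ h6 (intervalIntegral.integral_congr_ae ?_)
    filter_upwards [hVN] with τ hτ hτt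
    rw [uIoc_of_le ht.1] at hτt
    have hτT : τ ∈ Icc 0 T := ⟨hτt.1.le, hτt.2.trans ht.2⟩
    have h7 : N τ = Wiener.mul (V τ) (ψ' τ) := Wiener.ext fun x => by
      rw [(hτ hτT).2, Wiener.mul_apply, hψ', IccExtend_of_mem _ _ hτT]
    have h8 : V' τ = V τ := indicator_of_mem (s := Ioc 0 T) ⟨hτt.1, hτT.2⟩ V
    rw [StateSpace.linField, h8]
    have h9 : (wienerSpace d).group τ (Wiener.group (-τ) (ψ' τ)) = ψ' τ :=
      (wienerSpace d).group_group_neg τ (ψ' τ)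
    rw [h9, ← Wiener.group_apply, ← Wiener.group_add, h7,
      show -t + (t - τ) = -τ by ring]
    rfl
  obtain ⟨y, hyc, hy⟩ := ((l2WienerSpace d).exists_unique_linear hV'i hT φ).1
  have hy' : ∀ t ∈ Icc 0 T, (y t).toW = φ.toW + ∫ τ in (0 : ℝ)..t,
      (wienerSpace d).linField V' τ (y τ).toW := by
    intro t ht
    have h1 := L2Wiener.toWL.intervalIntegral_comp_comm
      ((l2WienerSpace d).intervalIntegrable_linField hV'i hyc 0 t)
    have h2 := congrArg L2Wiener.toWL (hy t ht)
    rw [map_add, ← h1] at h2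
    refine h2.trans (congrArg₂ _ rfl ?_)
    exact intervalIntegral.integral_congr fun τ _ => (l2WienerSpace d).toW_linField V' τ (y τ)
  have heq := ((wienerSpace d).exists_unique_linear hV'i hT φ.toW).2 _ _ hvc
    (L2Wiener.toWL.continuous.comp hyc) hv hy'
  set z : C(Icc 0 T, L2Wiener d) := ⟨fun t => L2Wiener.group t (y t),
    ((l2WienerSpace d).continuous_group_comp continuous_id hyc).comp continuous_subtype_val⟩
  have hz : ∀ t, ψ t = (z t).toW := by
    intro t
    have h1 := congrArg (Wiener.group (t : ℝ)) (heq t.2)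
    have h2 : Wiener.group t (Wiener.group (-t) (ψ' t)) = ψ' t :=
      (wienerSpace d).group_group_neg t (ψ' t)
    rw [h2, hψ', IccExtend_val] at h1
    exact h1
  have hz2 : (ψ : Icc 0 T → Wiener d) = fun t => (z t).toW := funext hz
  rw [hz2] at hψ
  have hz3 := (hb z).1 hψ
  ext1 t
  rw [hz, hz3]
  rfl

/-! ### Rescaled norms and band-limited functions -/

namespace L2Wiener

/-- The embedding `g ↦ (g, s g)` in `W × L²`. The norm of the image is `max (‖g‖_W) (s ‖g‖_{L²})`,
an equivalent norm of `L² ∩ W` in which the `L²` norm has the weight `s`. -/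
def scaled (s : ℝ) : L2Wiener d →L[ℂ] Wiener d × Lp ℂ 2 (volume : Measure (E d)) :=
  toWL.prod ((s : ℂ) • toL2L)

variable {s : ℝ}

theorem norm_scaled (hs : 0 ≤ s) (g : L2Wiener d) :
    ‖scaled s g‖ = max ‖toW g‖ (s * ‖toL2 g‖) := by
  rw [scaled, ContinuousLinearMap.prod_apply, Prod.norm_mk, _root_.smul_apply, norm_smul,
    Complex.norm_real, Real.norm_of_nonneg hs]
  rfl

theorem norm_toW_le_scaled (hs : 0 ≤ s) (g : L2Wiener d) : ‖toW g‖ ≤ ‖scaled s g‖ := by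
  rw [norm_scaled hs]; exact le_max_left _ _

theorem norm_toL2_le_scaled (hs : 0 ≤ s) (g : L2Wiener d) : s * ‖toL2 g‖ ≤ ‖scaled s g‖ := by
  rw [norm_scaled hs]; exact le_max_right _ _

theorem norm_scaled_group (hs : 0 ≤ s) (t : ℝ) (g : L2Wiener d) :
    ‖scaled s (group t g)‖ = ‖scaled s g‖ := by
  rw [norm_scaled hs, norm_scaled hs, norm_toL2_group, toW_group, LinearIsometry.norm_map]

theorem norm_scaled_mul_le (hs : 0 ≤ s) (V : Wiener d) (g : L2Wiener d) :
    ‖scaled s (mul V g)‖ ≤ fc d * ‖V‖ * ‖scaled s g‖ := by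
  have h0 : 0 ≤ fc d * ‖V‖ := mul_nonneg (fc_pos d).le (norm_nonneg _)
  rw [norm_scaled hs (mul V g), mul_def]
  refine max_le ?_ ?_
  · rw [toW_smulW]
    exact (Wiener.norm_prod_le V (toW g)).trans
      (mul_le_mul_of_nonneg_left (norm_toW_le_scaled hs g) h0)
  · calc s * ‖toL2 (smulW V g)‖ ≤ s * (fc d * ‖V‖ * ‖toL2 g‖) :=
          mul_le_mul_of_nonneg_left (norm_toL2_smulW_le V g) hs
      _ = fc d * ‖V‖ * (s * ‖toL2 g‖) := by ring
      _ ≤ _ := mul_le_mul_of_nonneg_left (norm_toL2_le_scaled hs g) h0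

theorem norm_scaled_le_of_hat (hs : 0 ≤ s) {C : ℝ} (hC : 0 ≤ C) {f g : L2Wiener d}
    (h : ∀ᵐ ξ, ‖Wiener.hat (toW f) ξ‖ ≤ C * ‖Wiener.hat (toW g) ξ‖) :
    ‖scaled s f‖ ≤ C * ‖scaled s g‖ := by
  rw [norm_scaled hs f]
  refine max_le ?_ ?_
  · refine le_trans ?_ (mul_le_mul_of_nonneg_left (norm_toW_le_scaled hs g) hC)
    rw [Wiener.norm_eq_integral, Wiener.norm_eq_integral, ← integral_const_mul]
    exact integral_mono_ae (Wiener.integrable_hat _).norm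
      ((Wiener.integrable_hat _).norm.const_mul C) h
  · have h2 : ‖toL2 f‖ ≤ C * ‖toL2 g‖ := by
      refine (pow_le_pow_iff_left₀ (norm_nonneg _) (by positivity) two_ne_zero).1 ?_
      rw [mul_pow, norm_toL2_sq, norm_toL2_sq, ← integral_const_mul]
      refine integral_mono_ae (integrable_norm_hat_sq f) ((integrable_norm_hat_sq g).const_mul _) ?_
      filter_upwards [h] with ξ hξ
      rw [← mul_pow]
      exact pow_le_pow_left₀ (norm_nonneg _) hξ 2
    calc s * ‖toL2 f‖ ≤ s * (C * ‖toL2 g‖) := mul_le_mul_of_nonneg_left h2 hs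
      _ = C * (s * ‖toL2 g‖) := by ring
      _ ≤ _ := mul_le_mul_of_nonneg_left (norm_toL2_le_scaled hs g) hC

end L2Wiener

namespace Wiener

/-- The Fourier transform vanishes outside the ball of radius `r`. -/
def BandLimited (r : ℝ) (g : Wiener d) : Prop := ∀ᵐ ξ, r < ‖ξ‖ → hat g ξ = 0

/-- The frequencies of a product are sums of frequencies of the factors. -/
theorem BandLimited.mul {r s : ℝ} {V g : Wiener d} (hV : BandLimited r V) (hg : BandLimited s g) :
    BandLimited (r + s) (mul V g) := by
  filter_upwards [hat_prod V g] with ξ h hξ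
  rw [mul_def, h, hatConv, convolution_def]
  refine mul_eq_zero_of_right _ (integral_eq_zero_of_ae ?_)
  have hg' : ∀ᵐ η, s < ‖ξ - η‖ → hat g (ξ - η) = 0 :=
    (quasiMeasurePreserving_sub_left_of_right_invariant volume ξ).ae hg
  filter_upwards [hV, hg'] with η h1 h2
  rw [ContinuousLinearMap.mul_apply', Pi.zero_apply]
  by_cases hη : r < ‖η‖
  · rw [h1 hη, zero_mul]
  · rw [h2, mul_zero]
    have := norm_sub_norm_le ξ η
    linarith

theorem BandLimited.smul {r : ℝ} {g : Wiener d} (hg : BandLimited r g) (a : ℂ) :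
    BandLimited r (a • g) := by
  filter_upwards [hg, hat_smul a g] with ξ h1 h2 hξ
  rw [h2, h1 hξ, mul_zero]

theorem norm_symbol_sub_one_le (t : ℝ) (ξ : E d) : ‖symbol t ξ - 1‖ ≤ |t| * ‖ξ‖ ^ 2 := by
  have h := Real.norm_exp_I_mul_ofReal_sub_one_le (x := -(t * ‖ξ‖ ^ 2))
  rw [Real.norm_eq_abs, abs_neg, abs_mul, abs_of_nonneg (sq_nonneg ‖ξ‖)] at h
  rw [symbol]
  convert h using 4
  push_cast
  ring

end Wiener

namespace L2Wiener

/-- On functions with frequencies at most `r`, the Laplacian has norm at most `r²`. -/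
theorem norm_scaled_group_sub_le {s r : ℝ} (hs : 0 ≤ s) (t : ℝ) {g : L2Wiener d}
    (hg : Wiener.BandLimited r (toW g)) :
    ‖scaled s (group t g - g)‖ ≤ |t| * r ^ 2 * ‖scaled s g‖ := by
  refine norm_scaled_le_of_hat hs (by positivity) ?_
  rw [map_sub, toW_group]
  filter_upwards [hg, Wiener.hat_sub (Wiener.group t (toW g)) (toW g),
    Wiener.hat_group t (toW g)] with ξ h1 h2 h3
  have e : Wiener.symbol t ξ * Wiener.hat (toW g) ξ - Wiener.hat (toW g) ξ =
      (Wiener.symbol t ξ - 1) * Wiener.hat (toW g) ξ := by ring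
  rw [h2, h3, e, norm_mul]
  by_cases hξ : r < ‖ξ‖
  · rw [h1 hξ, norm_zero, mul_zero, mul_zero]
  · refine mul_le_mul_of_nonneg_right ((Wiener.norm_symbol_sub_one_le t ξ).trans ?_)
      (norm_nonneg _)
    have := pow_le_pow_left₀ (norm_nonneg ξ) (not_lt.1 hξ) 2
    gcongr

/-! ### Multiplication by a phase -/

/-- The multiplication by `-i V`. -/
def phaseGen (V : Wiener d) : L2Wiener d →L[ℂ] L2Wiener d := -Complex.I • mul V

/-- The multiplication by the phase `e^{-itV}`. -/
def phase (V : Wiener d) (t : ℝ) : L2Wiener d →L[ℂ] L2Wiener d :=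
  NormedSpace.exp (t • phaseGen V)

theorem hasSum_phase (V : Wiener d) (t : ℝ) (g : L2Wiener d) :
    HasSum (fun n : ℕ => (t ^ n / (n.factorial : ℝ)) • (phaseGen V ^ n) g) (phase V t g) := by
  have h := NormedSpace.exp_series_hasSum_exp' (𝕂 := ℝ) (t • phaseGen V)
  have h2 := (ContinuousLinearMap.apply ℂ (L2Wiener d) g).hasSum h
  refine h2.congr_fun fun n => ?_
  rw [ContinuousLinearMap.apply_apply, _root_.smul_apply, smul_pow,
    _root_.smul_apply, smul_smul, div_eq_inv_mul]

theorem hasDerivAt_phase (V : Wiener d) (t : ℝ) (g : L2Wiener d) :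
    HasDerivAt (fun u => phase V u g) (phase V t (phaseGen V g)) t := by
  have h := hasDerivAt_exp_smul_const (phaseGen V) t
  exact ((ContinuousLinearMap.apply ℂ (L2Wiener d) g).restrictScalars ℝ).hasFDerivAt.comp_hasDerivAt
    t h

theorem phaseGen_apply (V : Wiener d) (g : L2Wiener d) :
    phaseGen V g = -Complex.I • mul V g := rfl

theorem phase_comm (V : Wiener d) (t : ℝ) (g : L2Wiener d) :
    phase V t (phaseGen V g) = phaseGen V (phase V t g) := by
  have h : Commute (phase V t) (phaseGen V) :=
    ((Commute.refl (phaseGen V)).smul_left t).exp_left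
  exact DFunLike.congr_fun h g

theorem phase_apply (V : Wiener d) (t : ℝ) (g : L2Wiener d) (x : E d) :
    phase V t g x = Complex.exp (-(Complex.I * (t * V x))) * g x := by
  have hpow : ∀ n : ℕ, ((phaseGen V ^ n) g) x = (-(Complex.I * V x)) ^ n * g x := by
    intro n
    induction n with
    | zero => simp
    | succ n ih =>
      rw [pow_succ', mul_apply_eq_comp, phaseGen_apply, smul_apply, mul_apply, ih]
      ring
  have h1 := ((Wiener.evalCLM x).comp toWL).hasSum (hasSum_phase V t g)
  have h2 := (NormedSpace.expSeries_div_hasSum_exp (-(Complex.I * (t * V x)))).mul_right (g x)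
  rw [← Complex.exp_eq_exp_ℂ] at h2
  refine HasSum.unique (f := fun n : ℕ => (-(Complex.I * (t * V x))) ^ n / n.factorial * g x) ?_ h2
  refine h1.congr_fun fun n => ?_
  have e : ((Wiener.evalCLM x).comp toWL) ((t ^ n / (n.factorial : ℝ)) • (phaseGen V ^ n) g) =
      ((t ^ n / (n.factorial : ℝ) : ℝ) : ℂ) * ((phaseGen V ^ n) g) x := by
    rw [← Complex.coe_smul, map_smul]
    rfl
  rw [e, hpow]
  push_cast
  rw [show -(Complex.I * (t * V x)) = t * -(Complex.I * V x) by ring, mul_pow]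
  ring

variable {s : ℝ}

theorem norm_scaled_phaseGen_le (hs : 0 ≤ s) (V : Wiener d) (g : L2Wiener d) :
    ‖scaled s (phaseGen V g)‖ ≤ fc d * ‖V‖ * ‖scaled s g‖ := by
  rw [phaseGen_apply, map_smul, norm_smul, norm_neg, Complex.norm_I, one_mul]
  exact norm_scaled_mul_le hs V g

theorem norm_scaled_phaseGen_pow_le (hs : 0 ≤ s) (V : Wiener d) (g : L2Wiener d) (n : ℕ) :
    ‖scaled s ((phaseGen V ^ n) g)‖ ≤ (fc d * ‖V‖) ^ n * ‖scaled s g‖ := by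
  have h0 : 0 ≤ fc d * ‖V‖ := mul_nonneg (fc_pos d).le (norm_nonneg _)
  induction n with
  | zero => simp
  | succ n ih =>
    rw [pow_succ', mul_apply_eq_comp]
    refine (norm_scaled_phaseGen_le hs V _).trans ?_
    calc _ ≤ fc d * ‖V‖ * ((fc d * ‖V‖) ^ n * ‖scaled s g‖) := by gcongr
      _ = _ := by ring

theorem norm_scaled_phase_le (hs : 0 ≤ s) (V : Wiener d) (g : L2Wiener d) {t : ℝ} (ht : 0 ≤ t) :
    ‖scaled s (phase V t g)‖ ≤ Real.exp (t * (fc d * ‖V‖)) * ‖scaled s g‖ := by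
  have h1 := (scaled s).hasSum (hasSum_phase V t g)
  have h2 := (NormedSpace.expSeries_div_hasSum_exp (t * (fc d * ‖V‖))).mul_right ‖scaled s g‖
  rw [← Real.exp_eq_exp_ℝ] at h2
  refine h1.norm_le_of_bounded h2 fun n => ?_
  rw [← Complex.coe_smul, map_smul, norm_smul, Complex.norm_real,
    Real.norm_of_nonneg (by positivity)]
  calc _ ≤ t ^ n / (n.factorial : ℝ) * ((fc d * ‖V‖) ^ n * ‖scaled s g‖) := by
        gcongr; exact norm_scaled_phaseGen_pow_le hs V g n
    _ = _ := by rw [mul_pow]; ring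

theorem bandLimited_phaseGen_pow {V : Wiener d} (hV : Wiener.BandLimited 1 V) {g : L2Wiener d}
    {ρ : ℝ} (hg : Wiener.BandLimited ρ (toW g)) (n : ℕ) :
    Wiener.BandLimited (n + ρ) (toW ((phaseGen V ^ n) g)) := by
  induction n with
  | zero => simpa using hg
  | succ n ih =>
    have h := (hV.mul ih).smul (-Complex.I)
    have e : (1 : ℝ) + (n + ρ) = ((n + 1 : ℕ) : ℝ) + ρ := by push_cast; ring
    rw [e] at h
    rw [pow_succ', mul_apply_eq_comp, phaseGen_apply, map_smul]
    exact h

theorem natCast_add_sq_le {ρ : ℝ} (hρ : 1 ≤ ρ) (n : ℕ) : (n + ρ) ^ 2 ≤ ρ ^ 2 * 4 ^ n := by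
  have h1 : ((n : ℝ) + 1) ≤ 2 ^ n := by exact_mod_cast Nat.lt_two_pow_self
  have h2 : (n : ℝ) + ρ ≤ ρ * 2 ^ n := by nlinarith [Nat.cast_nonneg (α := ℝ) n]
  calc ((n : ℝ) + ρ) ^ 2 ≤ (ρ * 2 ^ n) ^ 2 := by gcongr
    _ = ρ ^ 2 * 4 ^ n := by rw [mul_pow, ← pow_mul, mul_comm n 2, pow_mul]; norm_num

/-- The free group moves `e^{-itV} g` little if `V` and `g` are band limited: the `n`-th term of
the exponential series has frequencies of size at most `n + ρ`. -/
theorem norm_scaled_group_phase_sub_le (hs : 0 ≤ s) {V : Wiener d} (hV : Wiener.BandLimited 1 V)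
    {g : L2Wiener d} {ρ : ℝ} (hρ : 1 ≤ ρ) (hg : Wiener.BandLimited ρ (toW g)) {t : ℝ} (ht : 0 ≤ t)
    (τ : ℝ) :
    ‖scaled s (group τ (phase V t g) - phase V t g)‖ ≤
      |τ| * ρ ^ 2 * Real.exp (t * (4 * (fc d * ‖V‖))) * ‖scaled s g‖ := by
  let L : L2Wiener d →L[ℂ] Wiener d × Lp ℂ 2 (volume : Measure (E d)) :=
    (scaled s).comp ((group τ).toContinuousLinearMap - ContinuousLinearMap.id ℂ _)
  have hL : ∀ f, L f = scaled s (group τ f - f) := fun f => rfl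
  have h1 := L.hasSum (hasSum_phase V t g)
  have h2 := ((NormedSpace.expSeries_div_hasSum_exp (t * (4 * (fc d * ‖V‖)))).mul_left
    (|τ| * ρ ^ 2)).mul_right ‖scaled s g‖
  rw [← Real.exp_eq_exp_ℝ] at h2
  rw [← hL]
  refine h1.norm_le_of_bounded h2 fun n => ?_
  rw [← Complex.coe_smul, map_smul, norm_smul, Complex.norm_real,
    Real.norm_of_nonneg (by positivity), hL]
  have h3 := norm_scaled_group_sub_le hs (r := n + ρ) τ
    (bandLimited_phaseGen_pow hV hg n)
  have h4 := norm_scaled_phaseGen_pow_le hs V g n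
  have h0 : 0 ≤ fc d * ‖V‖ := mul_nonneg (fc_pos d).le (norm_nonneg _)
  calc _ ≤ t ^ n / (n.factorial : ℝ) *
        (|τ| * (ρ ^ 2 * 4 ^ n) * ((fc d * ‖V‖) ^ n * ‖scaled s g‖)) := by
        gcongr
        refine h3.trans ?_
        gcongr
        exact natCast_add_sq_le hρ n
    _ = _ := by rw [mul_pow, mul_pow]; ring

end L2Wiener

/-! ### The phase approximation over short times -/

/-- A bound that does not divide by `K`, uniform as `K → 0`. -/
theorem gronwallBound_zero_le {K ε x : ℝ} (hK : 0 ≤ K) (hε : 0 ≤ ε) :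
    gronwallBound 0 K ε x ≤ ε * x * Real.exp (K * x) := by
  rcases hK.eq_or_lt with rfl | hK
  · simp [gronwallBound_K0]
  · rw [gronwallBound_of_K_ne_0 hK.ne']
    simp only [zero_mul, zero_add]
    have h1 : Real.exp (K * x) - 1 ≤ K * x * Real.exp (K * x) := by
      have h2 := Real.add_one_le_exp (-(K * x))
      have h3 := mul_le_mul_of_nonneg_right h2 (Real.exp_pos (K * x)).le
      rw [← Real.exp_add, neg_add_cancel, Real.exp_zero] at h3
      linarith
    calc ε / K * (Real.exp (K * x) - 1) ≤ ε / K * (K * x * Real.exp (K * x)) := by gcongr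
      _ = _ := by field_simp

namespace Interaction

open L2Wiener

variable {κ : E d → ℂ} (P : Interaction κ (l2WienerSpace d))

theorem bandLimited_pot (hκ : ∀ ξ, 1 < ‖ξ‖ → κ ξ = 0) (u v : L2Wiener d) :
    Wiener.BandLimited 1 (P.pot u v) := by
  filter_upwards [P.hat_pot u v] with ξ h hξ
  rw [h, hκ ξ hξ, mul_zero, zero_mul]

/-- Multiplication by a phase does not change the potential. -/
theorem pot_phase {V : Wiener d} (hV : ∀ x, (V x).im = 0) (t : ℝ) (φ : L2Wiener d) :
    P.pot (phase V t φ) (phase V t φ) = P.pot φ φ := by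
  have h : Wiener.mul (toW (phase V t φ)) (Wiener.conj (toW (phase V t φ))) =
      Wiener.mul (toW φ) (Wiener.conj (toW φ)) := by
    refine Wiener.ext fun x => ?_
    have e : toW (phase V t φ) x = Complex.exp (-(Complex.I * (t * V x))) * toW φ x :=
      phase_apply V t φ x
    have e2 : (Complex.I * (t * V x)).re = 0 := by simp [hV x]
    rw [mul_conj_apply, mul_conj_apply, e, norm_mul, Complex.norm_exp, Complex.neg_re, e2, neg_zero,
      Real.exp_zero, one_mul]
  refine Wiener.eq_of_hat_ae_eq ?_
  filter_upwards [P.hat_pot (phase V t φ) (phase V t φ), P.hat_pot φ φ] with ξ h1 h2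
  rw [h1, h2]
  exact congrArg (fun f : Wiener d => ((fc d)⁻¹ : ℂ) * κ ξ * Wiener.hat f ξ) h

variable {s Λ : ℝ}

theorem norm_scaled_nonlin_sub_le (hs : 0 ≤ s) (hΛ : 0 ≤ Λ)
    (hP : ∀ u v, ‖P.pot u v‖ ≤ Λ * ‖scaled s u‖ * ‖scaled s v‖) {R : ℝ} {u v : L2Wiener d}
    (hu : ‖scaled s u‖ ≤ R) (hv : ‖scaled s v‖ ≤ R) :
    ‖scaled s (P.nonlin u - P.nonlin v)‖ ≤ 3 * fc d * Λ * R ^ 2 * ‖scaled s (u - v)‖ := by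
  have hR : 0 ≤ R := (norm_nonneg _).trans hu
  have hc := (fc_pos d).le
  have key : ∀ a b c : L2Wiener d, ‖scaled s ((l2WienerSpace d).mul (P.pot a b) c)‖ ≤
      fc d * (Λ * ‖scaled s a‖ * ‖scaled s b‖) * ‖scaled s c‖ := fun a b c =>
    (norm_scaled_mul_le hs (P.pot a b) c).trans (by gcongr; exact hP a b)
  rw [nonlin_sub, map_add, map_add]
  refine norm_add₃_le.trans ?_
  have h1 := key (u - v) u u
  have h2 := key v (u - v) u
  have h3 := key v v (u - v)
  set D := ‖scaled s (u - v)‖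
  have hD : 0 ≤ D := norm_nonneg _
  have h1' : fc d * (Λ * D * ‖scaled s u‖) * ‖scaled s u‖ ≤ fc d * (Λ * D * R) * R := by gcongr
  have h2' : fc d * (Λ * ‖scaled s v‖ * D) * ‖scaled s u‖ ≤ fc d * (Λ * R * D) * R := by gcongr
  have h3' : fc d * (Λ * ‖scaled s v‖ * ‖scaled s v‖) * D ≤ fc d * (Λ * R * R) * D := by gcongr
  linarith

/-- Over times of order `1 / Λ`, where `Λ` bounds the interaction in a rescaled norm, a solution
with band-limited datum `φ` is close to the solution `e^{-itV} φ`, with `V = K * |φ|²`, of the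
equation without the Laplacian. -/
theorem exists_phase_approx (d : ℕ) {ρ M R S : ℝ} (hρ : 1 ≤ ρ) (hM : 0 ≤ M) (hS : 0 ≤ S) :
    ∃ C : ℝ, 0 ≤ C ∧ ∀ {κ : E d → ℂ} (P : Interaction κ (l2WienerSpace d)) {s Λ T : ℝ}
      {φ : L2Wiener d} {w : ℝ → L2Wiener d}, 0 ≤ s → 0 ≤ Λ → T * Λ ≤ S →
      (∀ᵐ ξ, κ (-ξ) = starRingEnd ℂ (κ ξ)) → (∀ ξ, 1 < ‖ξ‖ → κ ξ = 0) →
      (∀ u v, ‖P.pot u v‖ ≤ Λ * ‖scaled s u‖ * ‖scaled s v‖) →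
      Wiener.BandLimited ρ (toW φ) → ‖scaled s φ‖ ≤ M → Continuous w →
      P.IsMild (Icc 0 T) φ w → (∀ t ∈ Icc 0 T, ‖scaled s (w t)‖ ≤ R) →
      ∀ t ∈ Icc 0 T, ∀ x : E d,
        ‖w t x - Complex.exp (-(Complex.I * (t * P.pot φ φ x))) * φ x‖ ≤ C * t := by
  have hc := (fc_pos d).le
  set B : ℝ := Real.exp (4 * (fc d * (S * M ^ 2))) with hB
  set R' : ℝ := max R (B * M) with hR'
  set ε : ℝ := 3 * fc d * S * R' ^ 2 * (ρ ^ 2 * B * M) +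
    (ρ + 1) ^ 2 * B * (fc d * (S * M ^ 3)) with hε
  have hB0 : 0 < B := Real.exp_pos _
  have hR'0 : 0 ≤ R' := le_max_of_le_right (by positivity)
  have hε0 : 0 ≤ ε := by positivity
  refine ⟨fc d * (ε * Real.exp (3 * fc d * S * R' ^ 2) + ρ ^ 2 * B * M), by positivity, ?_⟩
  intro κ P s Λ T φ w hs hΛ hTΛ hκ hκ1 hP hφ hφM hw hmild hwR t ht x
  set V : Wiener d := P.pot φ φ with hV
  have hVΛ : ‖V‖ ≤ Λ * M ^ 2 := (hP φ φ).trans (by rw [sq, ← mul_assoc]; gcongr)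
  have hVim : ∀ x, (V x).im = 0 := P.im_pot_eq_zero hκ φ
  have hVband : Wiener.BandLimited 1 V := P.bandLimited_pot hκ1 φ φ
  have htΛ : ∀ r ∈ Icc 0 T, r * Λ ≤ S := fun r hr =>
    (mul_le_mul_of_nonneg_right hr.2 hΛ).trans hTΛ
  have htV : ∀ r ∈ Icc 0 T, r * ‖V‖ ≤ S * M ^ 2 := fun r hr => by
    have h0 := hr.1
    calc r * ‖V‖ ≤ r * (Λ * M ^ 2) := by gcongr
      _ = r * Λ * M ^ 2 := by ring
      _ ≤ _ := by gcongr; exact htΛ r hr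
  have hexp4 : ∀ r ∈ Icc 0 T, Real.exp (r * (4 * (fc d * ‖V‖))) ≤ B := fun r hr => by
    rw [hB, Real.exp_le_exp]
    have := mul_le_mul_of_nonneg_left (htV r hr) hc
    linarith
  have hexp1 : ∀ r ∈ Icc 0 T, Real.exp (r * (fc d * ‖V‖)) ≤ B := fun r hr => by
    refine le_trans (Real.exp_le_exp.2 ?_) (hexp4 r hr)
    have : 0 ≤ r * (fc d * ‖V‖) := mul_nonneg hr.1 (by positivity)
    linarith
  have hz : ∀ r ∈ Icc 0 T, ‖scaled s (phase V r φ)‖ ≤ R' := fun r hr => by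
    refine (norm_scaled_phase_le hs V φ hr.1).trans (le_trans ?_ (le_max_right _ _))
    gcongr
    exact hexp1 r hr
  have hUz : ∀ r ∈ Icc 0 T, ‖scaled s (group r (phase V r φ) - phase V r φ)‖ ≤
      r * (ρ ^ 2 * B * M) := fun r hr => by
    have h0 := hr.1
    refine (norm_scaled_group_phase_sub_le hs hVband hρ hφ h0 r).trans ?_
    rw [abs_of_nonneg h0]
    calc _ ≤ r * ρ ^ 2 * B * M := by gcongr; exact hexp4 r hr
      _ = _ := by ring
  obtain ⟨v, hv0, hvc, hve, hvd⟩ := IsMild.exists_curve P hw hmild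
  have hgv : ∀ r ∈ Icc 0 T, group r (v r) = w r := fun r hr => by
    rw [hve r hr]
    exact (l2WienerSpace d).group_group_neg r (w r)
  -- the derivative of the error `v - e^{-itV} φ`
  have hd : ∀ r ∈ Icc 0 T, HasDerivAt (fun r => scaled s (v r - phase V r φ))
      (scaled s (P.field r (v r) - phase V r (phaseGen V φ))) r := fun r hr =>
    ((scaled s).restrictScalars ℝ).hasFDerivAt.comp_hasDerivAt r
      ((hvd r hr).sub (hasDerivAt_phase V r φ))
  have hnonlin : ∀ r, P.nonlin (phase V r φ) = mul V (phase V r φ) := fun r => by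
    rw [nonlin, P.pot_phase hVim]
    rfl
  have hbound : ∀ r ∈ Icc 0 T, ‖scaled s (P.field r (v r) - phase V r (phaseGen V φ))‖ ≤
      3 * fc d * Λ * R' ^ 2 * ‖scaled s (v r - phase V r φ)‖ + ε := by
    intro r hr
    have h0 := hr.1
    set z := phase V r φ with hzdef
    set q := phase V r (phaseGen V φ) with hq
    have hqz : q = -Complex.I • P.nonlin z := by
      rw [hq, phase_comm, phaseGen_apply, hnonlin]
    have hsplit : P.field r (v r) - q =
        -Complex.I • group (-r) (P.nonlin (w r) - P.nonlin z) + (group (-r) q - q) := by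
      have e1 : P.field r (v r) = -Complex.I • group (-r) (P.nonlin (w r)) := by
        rw [← hgv r hr]; rfl
      rw [e1, hqz, map_smul, map_sub, smul_sub]
      abel
    have hwz : ‖scaled s (w r - z)‖ ≤ ‖scaled s (v r - z)‖ + r * (ρ ^ 2 * B * M) := by
      have e : w r - z = group r (v r - z) + (group r z - z) := by
        rw [map_sub, hgv r hr]; abel
      rw [e, map_add]
      refine (norm_add_le _ _).trans (add_le_add ?_ (hUz r hr))
      rw [norm_scaled_group hs]
    have hA : ‖scaled s (-Complex.I • group (-r) (P.nonlin (w r) - P.nonlin z))‖ ≤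
        3 * fc d * Λ * R' ^ 2 * (‖scaled s (v r - z)‖ + r * (ρ ^ 2 * B * M)) := by
      rw [map_smul, norm_smul, norm_neg, Complex.norm_I, one_mul, norm_scaled_group hs]
      refine (P.norm_scaled_nonlin_sub_le hs hΛ hP ((hwR r hr).trans (le_max_left _ _))
        (hz r hr)).trans ?_
      gcongr
    have hQ : ‖scaled s (group (-r) q - q)‖ ≤ (ρ + 1) ^ 2 * B * (fc d * (S * M ^ 3)) := by
      have hband : Wiener.BandLimited (ρ + 1) (toW (phaseGen V φ)) := by
        have := bandLimited_phaseGen_pow hVband hφ 1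
        rwa [pow_one, Nat.cast_one, add_comm] at this
      refine (norm_scaled_group_phase_sub_le hs hVband (by linarith) hband h0 (-r)).trans ?_
      rw [abs_neg, abs_of_nonneg h0]
      have h1 := norm_scaled_phaseGen_le hs V φ
      calc r * (ρ + 1) ^ 2 * Real.exp (r * (4 * (fc d * ‖V‖))) * ‖scaled s (phaseGen V φ)‖
          ≤ r * (ρ + 1) ^ 2 * B * (fc d * ‖V‖ * M) := by
            gcongr
            · exact hexp4 r hr
            · exact h1.trans (by gcongr)
        _ = (ρ + 1) ^ 2 * B * (fc d * (r * ‖V‖ * M)) := by ring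
        _ ≤ (ρ + 1) ^ 2 * B * (fc d * (S * M ^ 2 * M)) := by
          have := mul_le_mul_of_nonneg_right (htV r hr) hM
          gcongr
        _ = _ := by ring
    rw [hsplit, map_add]
    refine (norm_add_le _ _).trans ((add_le_add hA hQ).trans ?_)
    have h2 : 3 * fc d * (r * Λ) * R' ^ 2 * (ρ ^ 2 * B * M) ≤
        3 * fc d * S * R' ^ 2 * (ρ ^ 2 * B * M) := by gcongr; exact htΛ r hr
    rw [hε]
    linarith
  have hgr := norm_le_gronwallBound_of_norm_deriv_right_le
    (f := fun r => scaled s (v r - phase V r φ)) (δ := 0)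
    (fun r hr => (hd r hr).continuousAt.continuousWithinAt)
    (fun r hr => (hd r (Ico_subset_Icc_self hr)).hasDerivWithinAt)
    (by simp [hv0, phase, NormedSpace.exp_zero])
    (fun r hr => hbound r (Ico_subset_Icc_self hr)) t ht
  have h0 := ht.1
  rw [sub_zero] at hgr
  have herr : ‖scaled s (v t - phase V t φ)‖ ≤ ε * t * Real.exp (3 * fc d * S * R' ^ 2) := by
    refine hgr.trans ((gronwallBound_zero_le (by positivity) hε0).trans ?_)
    refine mul_le_mul_of_nonneg_left (Real.exp_le_exp.2 ?_) (by positivity)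
    have : 3 * fc d * (t * Λ) * R' ^ 2 ≤ 3 * fc d * S * R' ^ 2 := by gcongr; exact htΛ t ht
    linarith
  have hfin : ‖scaled s (w t - phase V t φ)‖ ≤
      (ε * Real.exp (3 * fc d * S * R' ^ 2) + ρ ^ 2 * B * M) * t := by
    have e : w t - phase V t φ = group t (v t - phase V t φ) +
        (group t (phase V t φ) - phase V t φ) := by
      rw [map_sub, hgv t ht]; abel
    rw [e, map_add]
    refine (norm_add_le _ _).trans ?_
    rw [norm_scaled_group hs]
    have := add_le_add herr (hUz t ht)
    linarith
  have e : w t x - Complex.exp (-(Complex.I * (t * V x))) * φ x = toW (w t - phase V t φ) x := by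
    rw [map_sub, Wiener.sub_apply, toW_apply, toW_apply, phase_apply]
  rw [e]
  refine (Wiener.norm_apply_le _ x).trans ?_
  rw [mul_assoc]
  gcongr
  exact (norm_toW_le_scaled hs _).trans hfin

end Interaction

/-! ### The interaction of concentrated frequencies -/

namespace Wiener

theorem BandLimited.add {r s : ℝ} {f g : Wiener d} (hf : BandLimited r f) (hg : BandLimited s g)
    (hsr : s ≤ r) : BandLimited r (f + g) := by
  filter_upwards [hf, hg, hat_add f g] with ξ h1 h2 h3 hξ
  rw [h3, h1 hξ, h2 (hsr.trans_lt hξ), add_zero]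

end Wiener

open L2Wiener in
/-- The interaction with the truncated Riesz kernel, in the norm with the weight `μ^{d/2}`: the
frequencies `|ξ| ≥ μ` are controlled by the `W` norms, the frequencies `|ξ| < μ` by the `L²`
norms. -/
theorem Interaction.norm_pot_le_scaled (hd : 1 ≤ d) {γ : ℝ} (hγ : 0 < γ) (hγd : γ < d)
    (P : Interaction (truncatedRiesz d γ) (l2WienerSpace d)) {μ : ℝ} (hμ : 0 < μ)
    (u v : L2Wiener d) :
    ‖P.pot u v‖ ≤ (1 + ∫ ξ in Metric.ball (0 : E d) 1, ‖ξ‖ ^ (-((d : ℝ) - γ))) *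
      μ ^ (-((d : ℝ) - γ)) * ‖scaled (μ ^ ((d : ℝ) / 2)) u‖ * ‖scaled (μ ^ ((d : ℝ) / 2)) v‖ := by
  have hc := fc_pos d
  set α : ℝ := (d : ℝ) - γ with hα
  have hα0 : 0 < α := by linarith
  set I : ℝ := ∫ ξ in Metric.ball (0 : E d) 1, ‖ξ‖ ^ (-α) with hI
  have hI0 : 0 ≤ I := integral_nonneg fun _ => by positivity
  set s : ℝ := μ ^ ((d : ℝ) / 2) with hs
  have hs0 : 0 < s := Real.rpow_pos_of_pos hμ _
  set q : Wiener d := Wiener.mul (toW u) (Wiener.conj (toW v)) with hq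
  have hqn : ‖q‖ ≤ fc d * ‖toW u‖ * ‖toW v‖ := by
    have := Wiener.norm_prod_le (toW u) (Wiener.conj (toW v))
    rwa [Wiener.norm_conj] at this
  have hib : IntegrableOn (fun ξ : E d => ‖ξ‖ ^ (-α)) (Metric.ball 0 μ) :=
    (integrableOn_norm_rpow hd (by linarith) μ).mono_set Metric.ball_subset_closedBall
  have hi1 : Integrable fun ξ => (fc d)⁻¹ * μ ^ (-α) * ‖Wiener.hat q ξ‖ :=
    (Wiener.integrable_hat q).norm.const_mul _
  have hi2 : Integrable fun ξ => (Metric.ball (0 : E d) μ).indicator (fun ξ => ‖ξ‖ ^ (-α)) ξ *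
      (‖toL2 u‖ * ‖toL2 v‖) :=
    ((integrable_indicator_iff measurableSet_ball).2 hib).mul_const _
  have h1 : ‖P.pot u v‖ ≤ ∫ ξ, ((fc d)⁻¹ * μ ^ (-α) * ‖Wiener.hat q ξ‖ +
      (Metric.ball (0 : E d) μ).indicator (fun ξ => ‖ξ‖ ^ (-α)) ξ *
        (‖toL2 u‖ * ‖toL2 v‖)) := by
    rw [Wiener.norm_eq_integral]
    refine integral_mono_ae (Wiener.integrable_hat _).norm (hi1.add hi2) ?_
    filter_upwards [P.hat_pot u v, norm_hat_mul_conj_le u v] with ξ h2 h3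
    have hpos : 0 ≤ (Metric.closedBall (0 : E d) 1).indicator (fun ξ => ‖ξ‖ ^ (-α)) ξ :=
      indicator_nonneg (fun _ _ => by positivity) _
    have hle : (Metric.closedBall (0 : E d) 1).indicator (fun ξ => ‖ξ‖ ^ (-α)) ξ ≤ ‖ξ‖ ^ (-α) :=
      indicator_le_self' (fun _ _ => by positivity) _
    rw [h2, norm_mul, norm_mul, norm_inv, Complex.norm_real, Real.norm_of_nonneg hc.le,
      norm_truncatedRiesz]
    by_cases hξ : ξ ∈ Metric.ball (0 : E d) μ
    · rw [indicator_of_mem hξ]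
      have h4 : 0 ≤ (fc d)⁻¹ * μ ^ (-α) * ‖Wiener.hat q ξ‖ := by positivity
      calc _ ≤ (fc d)⁻¹ * ‖ξ‖ ^ (-α) * (fc d * ‖toL2 u‖ * ‖toL2 v‖) := by
            gcongr
            exact h3
        _ = ‖ξ‖ ^ (-α) * (‖toL2 u‖ * ‖toL2 v‖) := by field_simp
        _ ≤ _ := le_add_of_nonneg_left h4
    · rw [indicator_of_notMem hξ, zero_mul, add_zero]
      have h4 : μ ≤ ‖ξ‖ := not_lt.1 fun h => hξ (mem_ball_zero_iff.2 h)
      have h5 : ‖ξ‖ ^ (-α) ≤ μ ^ (-α) :=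
        Real.rpow_le_rpow_of_nonpos hμ h4 (by linarith)
      have h6 := hle.trans h5
      change (fc d)⁻¹ * _ * ‖Wiener.hat q ξ‖ ≤ _
      gcongr
  rw [integral_add hi1 hi2, integral_const_mul, integral_mul_const, ← Wiener.norm_eq_integral,
    integral_indicator measurableSet_ball, integral_ball_norm_rpow hμ, ← hα, ← hI] at h1
  have hμγ : μ ^ γ = μ ^ (-α) * (s * s) := by
    rw [hs, ← Real.rpow_add hμ, ← Real.rpow_add hμ, hα]
    congr 1
    ring
  have e1 := norm_toW_le_scaled hs0.le u
  have e2 := norm_toW_le_scaled hs0.le v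
  have e3 := norm_toL2_le_scaled hs0.le u
  have e4 := norm_toL2_le_scaled hs0.le v
  calc ‖P.pot u v‖ ≤ _ := h1
    _ ≤ (fc d)⁻¹ * μ ^ (-α) * (fc d * ‖toW u‖ * ‖toW v‖) +
        μ ^ γ * I * (‖toL2 u‖ * ‖toL2 v‖) := by gcongr
    _ = μ ^ (-α) * (‖toW u‖ * ‖toW v‖) +
        μ ^ (-α) * I * ((s * ‖toL2 u‖) * (s * ‖toL2 v‖)) := by
      rw [hμγ]; field_simp
    _ ≤ μ ^ (-α) * (‖scaled s u‖ * ‖scaled s v‖) +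
        μ ^ (-α) * I * (‖scaled s u‖ * ‖scaled s v‖) := by gcongr
    _ = _ := by ring

theorem volume_real_ball (x : E d) {r : ℝ} (hr : 0 < r) :
    volume.real (Metric.ball x r) = r ^ d * volume.real (Metric.ball (0 : E d) 1) := by
  rw [measureReal_def, Measure.addHaar_ball_of_pos volume x hr, ENNReal.toReal_mul,
    ENNReal.toReal_ofReal (by positivity), finrank_euclideanSpace_fin, measureReal_def]

theorem volume_real_ball_pos (d : ℕ) : 0 < volume.real (Metric.ball (0 : E d) 1) :=
  ENNReal.toReal_pos (Metric.measure_ball_pos volume _ one_pos).ne' measure_ball_lt_top.ne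

theorem memLp_indicator_ball (μ A : ℝ) (p : ℝ≥0∞) :
    MemLp ((Metric.ball (0 : E d) μ).indicator fun _ => (A : ℂ)) p volume :=
  memLp_indicator_const p measurableSet_ball _ (Or.inr measure_ball_lt_top.ne)

theorem integrable_indicator_ball (μ A : ℝ) :
    Integrable ((Metric.ball (0 : E d) μ).indicator fun _ => (A : ℂ)) :=
  memLp_one_iff_integrable.1 (memLp_indicator_ball μ A 1)

namespace L2Wiener

/-- The function whose Fourier transform is `A` times the indicator function of the ball of
radius `μ`. -/
def bump (d : ℕ) (μ A : ℝ) : L2Wiener d :=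
  ofW (Wiener.ofIntegrable _ (integrable_indicator_ball μ A))
    ((memLp_congr_ae (Wiener.hat_ofIntegrable _)).2 (memLp_indicator_ball μ A 2))

theorem hat_bump (μ A : ℝ) : (Wiener.hat (toW (bump d μ A)) : E d → ℂ) =ᵐ[volume]
    (Metric.ball (0 : E d) μ).indicator fun _ => (A : ℂ) :=
  Wiener.hat_ofIntegrable (integrable_indicator_ball μ A)

theorem bandLimited_bump (μ A : ℝ) : Wiener.BandLimited μ (toW (bump d μ A)) := by
  filter_upwards [hat_bump μ A] with ξ h hξ
  rw [h, indicator_of_notMem]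
  rw [mem_ball_zero_iff, not_lt]
  exact hξ.le

theorem norm_toW_bump {μ A : ℝ} (hμ : 0 < μ) (hA : 0 ≤ A) :
    ‖toW (bump d μ A)‖ = A * (μ ^ d * volume.real (Metric.ball (0 : E d) 1)) := by
  rw [Wiener.norm_eq_integral, ← volume_real_ball (0 : E d) hμ]
  have h : (fun ξ => ‖Wiener.hat (toW (bump d μ A)) ξ‖) =ᵐ[volume]
      (Metric.ball (0 : E d) μ).indicator fun _ => A := by
    filter_upwards [hat_bump μ A] with ξ h
    rw [h, norm_indicator_eq_indicator_norm]
    simp only [Complex.norm_real, Real.norm_of_nonneg hA]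
  rw [integral_congr_ae h, integral_indicator measurableSet_ball, setIntegral_const, smul_eq_mul,
    mul_comm]

theorem norm_toL2_bump_sq {μ A : ℝ} (hμ : 0 < μ) :
    ‖toL2 (bump d μ A)‖ ^ 2 = A ^ 2 * (μ ^ d * volume.real (Metric.ball (0 : E d) 1)) := by
  rw [norm_toL2_sq, ← volume_real_ball (0 : E d) hμ]
  have h : (fun ξ => ‖Wiener.hat (toW (bump d μ A)) ξ‖ ^ 2) =ᵐ[volume]
      (Metric.ball (0 : E d) μ).indicator fun _ => A ^ 2 := by
    filter_upwards [hat_bump μ A] with ξ h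
    rw [h]
    by_cases hξ : ξ ∈ Metric.ball (0 : E d) μ
    · rw [indicator_of_mem hξ, indicator_of_mem hξ, Complex.norm_real, Real.norm_eq_abs, sq_abs]
    · rw [indicator_of_notMem hξ, indicator_of_notMem hξ, norm_zero]
      norm_num
  rw [integral_congr_ae h, integral_indicator measurableSet_ball, setIntegral_const, smul_eq_mul,
    mul_comm]

theorem bump_apply_zero {μ A : ℝ} (hμ : 0 < μ) : bump d μ A 0 =
    ((fc d * (A * (μ ^ d * volume.real (Metric.ball (0 : E d) 1))) : ℝ) : ℂ) := by
  have h : bump d μ A 0 = invFourier ((Metric.ball (0 : E d) μ).indicator fun _ => (A : ℂ)) 0 :=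
    Wiener.ofIntegrable_apply (integrable_indicator_ball μ A) 0
  rw [h, ← volume_real_ball (0 : E d) hμ, invFourier, ← fc]
  simp only [inner_zero_left, Complex.ofReal_zero, mul_zero, Complex.exp_zero, one_mul]
  rw [integral_indicator measurableSet_ball, setIntegral_const, Complex.real_smul]
  push_cast
  ring

/-- The autocorrelation of the indicator function of a ball: the Fourier transform of `|a|²`, up to
the normalization. -/
theorem hatConv_bump (μ A : ℝ) (ξ : E d) :
    Wiener.hatConv (toW (bump d μ A)) (Wiener.conj (toW (bump d μ A))) ξ =
      ((A ^ 2 * volume.real (Metric.ball (0 : E d) μ ∩ Metric.ball ξ μ) : ℝ) : ℂ) := by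
  have h1 : ∀ᵐ η, Wiener.hat (Wiener.conj (toW (bump d μ A))) (ξ - η) =
      (Metric.ball (0 : E d) μ).indicator (fun _ => (A : ℂ)) (η - ξ) := by
    have h2 : ∀ᵐ ζ, Wiener.hat (Wiener.conj (toW (bump d μ A))) ζ =
        (Metric.ball (0 : E d) μ).indicator (fun _ => (A : ℂ)) (-ζ) := by
      have hneg := (Measure.measurePreserving_neg
        (volume : Measure (E d))).quasiMeasurePreserving
      filter_upwards [Wiener.hat_conj (toW (bump d μ A)), hneg.ae (hat_bump μ A)] with ζ h3 h4
      rw [h3, h4]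
      by_cases hζ : -ζ ∈ Metric.ball (0 : E d) μ
      · rw [indicator_of_mem hζ, Complex.conj_ofReal]
      · rw [indicator_of_notMem hζ, map_zero]
    filter_upwards [(quasiMeasurePreserving_sub_left_of_right_invariant volume ξ).ae h2] with η h
    rw [h, neg_sub]
  rw [Wiener.hatConv, convolution_def]
  have h2 : (fun η => ContinuousLinearMap.mul ℂ ℂ (Wiener.hat (toW (bump d μ A)) η)
      (Wiener.hat (Wiener.conj (toW (bump d μ A))) (ξ - η))) =ᵐ[volume]
      (Metric.ball (0 : E d) μ ∩ Metric.ball ξ μ).indicator fun _ => (A : ℂ) ^ 2 := by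
    filter_upwards [hat_bump μ A, h1] with η h3 h4
    rw [ContinuousLinearMap.mul_apply', h3, h4]
    have hiff : η - ξ ∈ Metric.ball (0 : E d) μ ↔ η ∈ Metric.ball ξ μ := by
      rw [mem_ball_zero_iff, mem_ball_iff_norm]
    have h7 : (Metric.ball (0 : E d) μ).indicator (fun _ => (A : ℂ)) (η - ξ) =
        (Metric.ball ξ μ).indicator (fun _ => (A : ℂ)) η := by
      by_cases h : η ∈ Metric.ball ξ μ
      · rw [indicator_of_mem h, indicator_of_mem (hiff.2 h)]
      · rw [indicator_of_notMem h, indicator_of_notMem (mt hiff.1 h)]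
    rw [h7, ← inter_indicator_mul, sq]
  rw [integral_congr_ae h2, integral_indicator (measurableSet_ball.inter measurableSet_ball),
    setIntegral_const, Complex.real_smul]
  push_cast
  ring

end L2Wiener

open L2Wiener in
/-- The potential created by a bump of frequencies of size `μ` is large at the origin. -/
theorem Interaction.le_re_pot_bump (hd : 1 ≤ d) {γ : ℝ} (hγ : 0 < γ)
    (P : Interaction (truncatedRiesz d γ) (l2WienerSpace d)) {μ A : ℝ} (hμ : 0 < μ)
    (hμ1 : μ ≤ 1) :
    fc d * (A ^ 2 * ((μ / 2) ^ d * volume.real (Metric.ball (0 : E d) 1)) *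
      (μ ^ γ * ∫ ξ in Metric.ball (0 : E d) 1, ‖ξ‖ ^ (-((d : ℝ) - γ)))) ≤
      (P.pot (bump d μ A) (bump d μ A) 0).re := by
  have hc := fc_pos d
  set a := bump d μ A with ha
  set k : E d → ℝ := fun ξ =>
    (Metric.closedBall (0 : E d) 1).indicator (fun ξ => ‖ξ‖ ^ (-((d : ℝ) - γ))) ξ *
      (A ^ 2 * volume.real (Metric.ball (0 : E d) μ ∩ Metric.ball ξ μ)) with hk
  have hhat : (Wiener.hat (P.pot a a) : E d → ℂ) =ᵐ[volume] fun ξ => ((k ξ : ℝ) : ℂ) := by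
    filter_upwards [P.hat_pot a a, Wiener.hat_prod (toW a) (Wiener.conj (toW a))] with ξ h1 h2
    have h3 : Wiener.hat (Wiener.mul ((l2WienerSpace d).toW a)
        (Wiener.conj ((l2WienerSpace d).toW a))) ξ =
        (fc d : ℂ) * Wiener.hatConv (toW a) (Wiener.conj (toW a)) ξ := h2
    have hc' : (fc d : ℂ) ≠ 0 := Complex.ofReal_ne_zero.2 hc.ne'
    rw [h1, h3, hatConv_bump, truncatedRiesz_eq_ofReal, hk]
    push_cast
    field_simp
  have hki : Integrable k := by
    have := ((Wiener.integrable_hat (P.pot a a)).congr hhat).re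
    exact this
  have hval : P.pot a a 0 = ((fc d * ∫ ξ, k ξ : ℝ) : ℂ) := by
    rw [Wiener.eq_invFourier_hat, invFourier, ← fc]
    simp only [inner_zero_left, Complex.ofReal_zero, mul_zero, Complex.exp_zero, one_mul]
    rw [integral_congr_ae hhat, integral_complex_ofReal]
    push_cast
    rfl
  rw [hval, Complex.ofReal_re, ← integral_ball_norm_rpow hμ, ← integral_const_mul,
    ← integral_indicator measurableSet_ball]
  refine mul_le_mul_of_nonneg_left ?_ hc.le
  refine integral_mono ((integrable_indicator_iff measurableSet_ball).2
    (((integrableOn_norm_rpow hd (by linarith) μ).mono_set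
      Metric.ball_subset_closedBall).const_mul _)) hki fun ξ => ?_
  by_cases hξ : ξ ∈ Metric.ball (0 : E d) μ
  · have hξ' : ‖ξ‖ < μ := mem_ball_zero_iff.1 hξ
    have hmem : ξ ∈ Metric.closedBall (0 : E d) 1 :=
      mem_closedBall_zero_iff.2 (hξ'.le.trans hμ1)
    -- the ball centered at `ξ / 2` of radius `μ / 2` lies in both balls
    have hsub : Metric.ball ((1 / 2 : ℝ) • ξ) (μ / 2) ⊆
        Metric.ball (0 : E d) μ ∩ Metric.ball ξ μ := by
      have hh : ‖(1 / 2 : ℝ) • ξ‖ = ‖ξ‖ / 2 := by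
        rw [norm_smul, Real.norm_of_nonneg (by norm_num)]; ring
      refine subset_inter (Metric.ball_subset_ball' ?_) (Metric.ball_subset_ball' ?_)
      · rw [dist_zero_right, hh]; linarith
      · have e : (1 / 2 : ℝ) • ξ - ξ = -((1 / 2 : ℝ) • ξ) := by
          rw [← sub_eq_zero]; module
        rw [dist_eq_norm, e, norm_neg, hh]; linarith
    have hvol : (μ / 2) ^ d * volume.real (Metric.ball (0 : E d) 1) ≤
        volume.real (Metric.ball (0 : E d) μ ∩ Metric.ball ξ μ) := by
      rw [← volume_real_ball ((1 / 2 : ℝ) • ξ) (half_pos hμ)]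
      exact measureReal_mono hsub
        ((measure_mono inter_subset_left).trans_lt measure_ball_lt_top).ne
    rw [indicator_of_mem hξ, hk]
    simp only [indicator_of_mem hmem]
    rw [mul_comm]
    gcongr
  · rw [indicator_of_notMem hξ]
    exact mul_nonneg (indicator_nonneg (fun _ _ => by positivity) _) (by positivity)

/-! ### Ill-posedness in the Wiener algebra -/

open L2Wiener in
/-- The band-limited functions of `L² ∩ W` that do not vanish at the origin are dense in `W`. -/
theorem exists_bandLimited_mem_ball (φ₀ : Wiener d) {r : ℝ} (hr : 0 < r) :
    ∃ (f : L2Wiener d) (ρ : ℝ), 1 ≤ ρ ∧ Wiener.BandLimited ρ (toW f) ∧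
      toW f ∈ Metric.ball φ₀ r ∧ f 0 ≠ 0 := by
  have hc := fc_pos d
  have hv := volume_real_ball_pos d
  obtain ⟨g, hgc, hgd, hg, hgi⟩ := (Wiener.integrable_hat φ₀).exists_hasCompactSupport_integral_sub_le
    (half_pos (half_pos hr))
  obtain ⟨ρ, hρ⟩ := hgc.isCompact.isBounded.exists_norm_le
  set f₁ : L2Wiener d := ofW (Wiener.ofIntegrable g hgi)
    ((memLp_congr_ae (Wiener.hat_ofIntegrable hgi)).2 (hg.memLp_of_hasCompactSupport hgc)) with hf₁
  have hhat : (Wiener.hat (toW f₁) : E d → ℂ) =ᵐ[volume] g := Wiener.hat_ofIntegrable hgi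
  have hband : Wiener.BandLimited (max ρ 1) (toW f₁) := by
    filter_upwards [hhat] with ξ h hξ
    rw [h]
    by_contra h0
    exact absurd (hρ ξ (subset_tsupport g h0)) (not_le.2 ((le_max_left _ _).trans_lt hξ))
  have hdist : ‖toW f₁ - φ₀‖ ≤ r / 2 / 2 := by
    rw [Wiener.norm_eq_integral]
    refine le_trans (le_of_eq (integral_congr_ae ?_)) hgd
    filter_upwards [Wiener.hat_sub (toW f₁) φ₀, hhat] with ξ h1 h2
    simp only [h1, h2]
    rw [norm_sub_rev]
  by_cases h0 : f₁ 0 = 0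
  · set A : ℝ := r / 2 / volume.real (Metric.ball (0 : E d) 1) with hA
    have hA0 : 0 < A := by positivity
    have hAv : A * (1 ^ d * volume.real (Metric.ball (0 : E d) 1)) = r / 2 := by
      rw [hA, one_pow, one_mul]; field_simp
    refine ⟨f₁ + bump d 1 A, max ρ 1, le_max_right _ _, ?_, ?_, ?_⟩
    · rw [map_add]
      exact hband.add (bandLimited_bump 1 A) (le_max_right _ _)
    · rw [mem_ball_iff_norm, map_add, add_sub_right_comm]
      refine (norm_add_le _ _).trans_lt ?_
      rw [norm_toW_bump one_pos hA0.le, hAv]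
      linarith
    · rw [L2Wiener.add_apply, h0, zero_add, bump_apply_zero one_pos, hAv]
      exact Complex.ofReal_ne_zero.2 (by positivity)
  · exact ⟨f₁, max ρ 1, le_max_right _ _, hband,
      mem_ball_iff_norm.2 (hdist.trans_lt (by linarith)), h0⟩

open L2Wiener in
/-- The flow of the equation with the truncated Riesz kernel is not uniformly continuous on any
ball of `W`. -/
theorem Interaction.not_uniformContinuousOn (hd : 1 ≤ d) {γ : ℝ} (hγ : 0 < γ) (hγd : γ < d)
    (P : Interaction (truncatedRiesz d γ) (l2WienerSpace d)) {T : ℝ} (hT : 0 < T)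
    {Ψ : Wiener d → C(Icc (0 : ℝ) T, Wiener d)}
    (hΨ : ∀ φ : L2Wiener d, ∃ w : ℝ → L2Wiener d, Continuous w ∧ P.IsMild (Icc 0 T) φ w ∧
      ∀ t, Ψ (toW φ) t = toW (w t)) (φ₀ : Wiener d) {r : ℝ} (hr : 0 < r) :
    ¬ UniformContinuousOn Ψ (Metric.ball φ₀ r ∩ range toW) := by
  intro huc
  have hc := fc_pos d
  set v : ℝ := volume.real (Metric.ball (0 : E d) 1) with hvdef
  have hv : 0 < v := volume_real_ball_pos d
  set α : ℝ := (d : ℝ) - γ with hα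
  have hα0 : 0 < α := by linarith
  set I : ℝ := ∫ ξ in Metric.ball (0 : E d) 1, ‖ξ‖ ^ (-α) with hI
  have hI0 : 0 < I := integral_ball_one_norm_rpow_pos hd hγ
  have hsymm : ∀ᵐ ξ, truncatedRiesz d γ (-ξ) = starRingEnd ℂ (truncatedRiesz d γ ξ) :=
    Filter.Eventually.of_forall fun ξ => by rw [truncatedRiesz_neg, conj_truncatedRiesz]
  -- the datum `f`, at which continuity fails
  obtain ⟨f, ρ, hρ, hfband, hfball, hf0⟩ := exists_bandLimited_mem_ball φ₀ hr
  obtain ⟨wf, hwfc, hwfm, hwfΨ⟩ := hΨ f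
  set m : ℝ := ‖f 0‖ with hm
  have hm0 : 0 < m := norm_pos_iff.2 hf0
  have hη : 0 < m / 8 / fc d := by positivity
  obtain ⟨δ, hδ, hδΨ⟩ := Metric.uniformContinuousOn_iff.1 huc _ hη
  have hr' : 0 < r - dist (toW f) φ₀ := by rw [Metric.mem_ball] at hfball; linarith
  -- the size in `W` of the perturbation
  obtain ⟨ε, hε0, hε⟩ := exists_between
    (lt_min (lt_min hδ hr') (show (0 : ℝ) < m / 8 / fc d by positivity))
  have hεδ : ε < δ := hε.trans_le ((min_le_left _ _).trans (min_le_left _ _))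
  have hεr : ε < r - dist (toW f) φ₀ := hε.trans_le ((min_le_left _ _).trans (min_le_right _ _))
  have hεm : fc d * ε ≤ m / 8 := by
    have := hε.le.trans (min_le_right _ _)
    rwa [le_div_iff₀ hc, mul_comm] at this
  -- constants that do not depend on the scale `μ` of the perturbation
  set M : ℝ := ‖f‖ + max ε (ε / √v) with hM
  have hM0 : 0 ≤ M := add_nonneg (norm_nonneg _) (le_max_of_le_left hε0.le)
  obtain ⟨Bf, hBf⟩ := isCompact_Icc.exists_bound_of_continuousOn (hwfc.continuousOn (s := Icc 0 T))
  set R : ℝ := max (Bf + m / 8 / fc d) M with hR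
  set c₁ : ℝ := fc d * (ε ^ 2 * I / (v * 2 ^ d)) with hc₁
  have hc₁0 : 0 < c₁ := by positivity
  set c₀ : ℝ := |(P.pot f f 0).re| with hc₀
  set S : ℝ := 2 * Real.pi / c₁ * (1 + I) with hS
  have hS0 : 0 ≤ S := by have := Real.pi_pos; positivity
  obtain ⟨C, hC0, hC⟩ := exists_phase_approx d (R := R) hρ hM0 hS0
  have hwf0 : toW (wf 0) = toW f := by
    have := hwfm 0 ⟨le_rfl, hT.le⟩
    rw [intervalIntegral.integral_same, smul_zero, sub_zero, StateSpace.group_zero] at this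
    rw [this]
  -- a time up to which the solution with datum `f` stays near `f 0` at the origin
  obtain ⟨τ₀, hτ₀, hτ₀f⟩ : ∃ τ₀ : ℝ, 0 < τ₀ ∧ ∀ t ∈ Ico 0 τ₀, ‖wf t 0 - f 0‖ < m / 8 := by
    have hcont : Continuous fun t => wf t 0 :=
      ((Wiener.evalCLM (0 : E d)).comp toWL).continuous.comp hwfc
    obtain ⟨τ₀, hτ₀, h⟩ := Metric.continuousAt_iff.1 (hcont.continuousAt (x := 0)) (m / 8)
      (by positivity)
    refine ⟨τ₀, hτ₀, fun t ht => ?_⟩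
    have h1 := h (x := t) (by rw [Real.dist_eq, sub_zero, abs_of_nonneg ht.1]; exact ht.2)
    have h2 : wf 0 0 = f 0 := congrArg (fun g : Wiener d => g 0) hwf0
    rwa [dist_eq_norm, h2] at h1
  -- the scale `μ`, with `y = μ ^ α`
  obtain ⟨y, hy0, hy⟩ : ∃ y : ℝ, 0 < y ∧ y ≤ 1 ∧ y * (2 * c₀) ≤ c₁ ∧
      2 * Real.pi / c₁ * y < min (min T τ₀) (m / 8 / (C + 1)) := by
    have hpi := Real.pi_pos
    have hmin : 0 < min (min T τ₀) (m / 8 / (C + 1)) :=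
      lt_min (lt_min hT hτ₀) (by positivity)
    have e1 : ∀ᶠ y : ℝ in nhds 0, y < 1 := gt_mem_nhds one_pos
    have e2 : ∀ᶠ y : ℝ in nhds 0, y * (2 * c₀) < c₁ := by
      have : Continuous fun y : ℝ => y * (2 * c₀) := by fun_prop
      exact this.continuousAt.eventually_lt_const (by simpa using hc₁0)
    have e3 : ∀ᶠ y : ℝ in nhds 0, 2 * Real.pi / c₁ * y < min (min T τ₀) (m / 8 / (C + 1)) := by
      have : Continuous fun y : ℝ => 2 * Real.pi / c₁ * y := by fun_prop
      exact this.continuousAt.eventually_lt_const (by simpa using hmin)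
    have e4 : ∀ᶠ y : ℝ in nhdsWithin 0 (Ioi 0), 0 < y := self_mem_nhdsWithin
    obtain ⟨y, ⟨⟨h1, h2⟩, h3⟩, h4⟩ :=
      (((e1.and e2).and e3).filter_mono nhdsWithin_le_nhds |>.and e4).exists
    exact ⟨y, h4, h1.le, h2.le, h3⟩
  obtain ⟨hy1, hyc, hyt⟩ := hy
  set μ : ℝ := y ^ (1 / α) with hμdef
  have hμ : 0 < μ := Real.rpow_pos_of_pos hy0 _
  have hμ1 : μ ≤ 1 := Real.rpow_le_one hy0.le hy1 (by positivity)
  have hμy : μ ^ (-α) = y⁻¹ := by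
    rw [hμdef, ← Real.rpow_mul hy0.le, ← Real.rpow_neg_one]
    congr 1
    field_simp
  set s : ℝ := μ ^ ((d : ℝ) / 2) with hs
  have hs0 : 0 < s := Real.rpow_pos_of_pos hμ _
  have hs1 : s ≤ 1 := Real.rpow_le_one hμ.le hμ1 (by positivity)
  have hss : s ^ 2 = μ ^ d := by
    rw [hs, ← Real.rpow_natCast, ← Real.rpow_mul hμ.le, ← Real.rpow_natCast]
    congr 1
    push_cast
    ring
  -- the perturbation
  set A : ℝ := ε / (μ ^ d * v) with hA
  have hA0 : 0 < A := by positivity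
  have hAv : A * (μ ^ d * v) = ε := by rw [hA]; field_simp
  set a : L2Wiener d := bump d μ A with ha
  have haW : ‖toW a‖ = ε := by rw [ha, norm_toW_bump hμ hA0.le, ← hvdef, hAv]
  have haL : s * ‖toL2 a‖ = ε / √v := by
    refine (pow_left_inj₀ (by positivity) (by positivity) two_ne_zero).1 ?_
    rw [mul_pow, hss, ha, norm_toL2_bump_sq hμ, ← hvdef, div_pow ε (√v), Real.sq_sqrt hv.le, hA]
    field_simp
  have haN : ‖scaled s a‖ = max ε (ε / √v) := by rw [norm_scaled hs0.le, haW, haL]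
  have hpota : c₁ * y⁻¹ ≤ (P.pot a a 0).re := by
    refine le_trans (le_of_eq ?_) (P.le_re_pot_bump hd hγ hμ hμ1 (A := A))
    have hγα : μ ^ γ = μ ^ d * y⁻¹ := by
      rw [← hμy, ← Real.rpow_natCast, ← Real.rpow_add hμ, hα]
      congr 1
      ring
    rw [← hα, ← hI, ← hvdef, hγα, hc₁, hA, div_pow μ 2]
    field_simp
  -- by the parallelogram identity one of `f + a`, `f - a` has a large potential at the origin
  obtain ⟨b, hbW, hbN, hbband, hbpot⟩ : ∃ b : L2Wiener d, ‖toW b‖ = ε ∧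
      ‖scaled s b‖ = max ε (ε / √v) ∧ Wiener.BandLimited μ (toW b) ∧
      c₁ * y⁻¹ - c₀ ≤ (P.pot (f + b) (f + b) 0).re := by
    have hpar : P.pot (f + a) (f + a) + P.pot (f + -a) (f + -a) =
        P.pot f f + P.pot f f + (P.pot a a + P.pot a a) := by
      simp only [map_add, map_neg, _root_.add_apply, _root_.neg_apply]
      abel
    have hpar0 := congrArg (fun g : Wiener d => (g 0).re) hpar
    simp only [Wiener.add_apply, Complex.add_re] at hpar0
    have hf := neg_abs_le (P.pot f f 0).re
    rw [← hc₀] at hf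
    rcases le_total (c₁ * y⁻¹ - c₀) (P.pot (f + a) (f + a) 0).re with h | h
    · exact ⟨a, haW, haN, bandLimited_bump μ A, h⟩
    · refine ⟨-a, by rw [map_neg, norm_neg, haW], by rw [map_neg, norm_neg, haN], ?_, by linarith⟩
      have := (bandLimited_bump (d := d) μ A).smul (-1)
      rwa [neg_one_smul, ← map_neg] at this
  set φ : L2Wiener d := f + b with hφ
  have hφband : Wiener.BandLimited ρ (toW φ) := by
    rw [hφ, map_add]
    exact hfband.add hbband (hμ1.trans hρ)
  have hφN : ‖scaled s φ‖ ≤ M := by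
    rw [hφ, map_add]
    refine (norm_add_le _ _).trans (add_le_add ?_ hbN.le)
    rw [norm_scaled hs0.le]
    exact max_le (norm_toW_le f) ((mul_le_of_le_one_left (norm_nonneg _) hs1).trans
      (norm_toL2_le f))
  obtain ⟨w, hwc, hwm, hwΨ⟩ := hΨ φ
  have hclose : ∀ t ∈ Icc 0 T, ‖toW (w t) - toW (wf t)‖ ≤ m / 8 / fc d := by
    intro t ht
    have hdist : dist (toW φ) (toW f) = ε := by
      rw [dist_eq_norm, hφ, map_add, add_sub_cancel_left, hbW]
    have hφball : toW φ ∈ Metric.ball φ₀ r := by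
      rw [Metric.mem_ball]
      have := dist_triangle (toW φ) (toW f) φ₀
      linarith
    have h1 := hδΨ _ ⟨hφball, mem_range_self φ⟩ _ ⟨hfball, mem_range_self f⟩ (hdist.trans_lt hεδ)
    have h2 := (ContinuousMap.dist_apply_le_dist (f := Ψ (toW φ)) (g := Ψ (toW f))
      ⟨t, ht⟩).trans h1.le
    rwa [hwΨ, hwfΨ, dist_eq_norm] at h2
  -- the time at which the phase at the origin reaches `π`
  set V₀ : ℝ := (P.pot φ φ 0).re with hV₀
  have hV₀y : c₁ / 2 * y⁻¹ ≤ V₀ := by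
    have : c₀ ≤ c₁ / 2 * y⁻¹ := by
      rw [← div_eq_mul_inv, le_div_iff₀ hy0]
      linarith
    linarith
  have hV₀0 : 0 < V₀ := lt_of_lt_of_le (by positivity) hV₀y
  set t : ℝ := Real.pi / V₀ with ht
  have ht0 : 0 < t := div_pos Real.pi_pos hV₀0
  have hty : t ≤ 2 * Real.pi / c₁ * y := by
    rw [ht, div_le_iff₀ hV₀0]
    have hpi := Real.pi_pos
    calc Real.pi = 2 * Real.pi / c₁ * y * (c₁ / 2 * y⁻¹) := by field_simp
      _ ≤ _ := by gcongr
  have htlt := hty.trans_lt hyt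
  have htT : t ≤ T := (htlt.le.trans (min_le_left _ _)).trans (min_le_left _ _)
  have htτ : t < τ₀ := (htlt.trans_le (min_le_left _ _)).trans_le (min_le_right _ _)
  have hCt : C * t ≤ m / 8 := by
    have h1 := htlt.le.trans (min_le_right _ _)
    rw [le_div_iff₀ (by positivity)] at h1
    linarith
  have hsub : Icc 0 t ⊆ Icc 0 T := Icc_subset_Icc le_rfl htT
  -- the `W` norm of the solution is bounded by the supposed continuity of the flow, its `L²` norm
  -- by conservation
  have hwR : ∀ τ ∈ Icc 0 t, ‖scaled s (w τ)‖ ≤ R := by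
    intro τ hτ
    rw [norm_scaled hs0.le]
    refine max_le_max ?_ ?_
    · have h1 := hclose τ (hsub hτ)
      have h2 := (norm_toW_le _).trans (hBf τ (hsub hτ))
      have h3 := norm_add_le (toW (w τ) - toW (wf τ)) (toW (wf τ))
      rw [sub_add_cancel] at h3
      linarith
    · rw [IsMild.norm_toL2_eq P hsymm le_rfl hT.le hwc hwm τ (hsub hτ)]
      exact (norm_toL2_le_scaled hs0.le φ).trans hφN
  have hmain := hC P (s := s) (Λ := (1 + I) * μ ^ (-α)) (T := t) (φ := φ) (w := w) hs0.le
    (by positivity) (by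
      rw [hμy, hS]
      calc t * ((1 + I) * y⁻¹) ≤ 2 * Real.pi / c₁ * y * ((1 + I) * y⁻¹) := by gcongr
        _ = _ := by field_simp)
    hsymm (fun ξ hξ => truncatedRiesz_of_lt hξ)
    (fun u v => P.norm_pot_le_scaled hd hγ hγd hμ u v) hφband hφN hwc
    (IsMild.mono P hsub hwm) hwR t ⟨ht0.le, le_rfl⟩ 0
  have hphase : Complex.exp (-(Complex.I * (t * P.pot φ φ 0))) = -1 := by
    have h1 : P.pot φ φ 0 = (V₀ : ℂ) :=
      Complex.ext rfl (by simpa using P.im_pot_eq_zero hsymm φ 0)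
    have h2 : t * V₀ = Real.pi := by rw [ht]; field_simp
    rw [h1, ← Complex.ofReal_mul, h2, mul_comm, Complex.exp_neg, Complex.exp_pi_mul_I]
    norm_num
  rw [hphase] at hmain
  have h1 : ‖w t 0 - wf t 0‖ ≤ m / 8 := by
    have h2 := Wiener.norm_apply_le (toW (w t) - toW (wf t)) 0
    rw [Wiener.sub_apply] at h2
    refine h2.trans ?_
    calc _ ≤ fc d * (m / 8 / fc d) := by gcongr; exact hclose t ⟨ht0.le, htT⟩
      _ = _ := by field_simp
  have h2 : ‖b 0‖ ≤ m / 8 := by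
    refine (Wiener.norm_apply_le (toW b) 0).trans ?_
    rw [hbW]
    exact hεm
  have h3 := (hτ₀f t ⟨ht0.le, htτ⟩).le
  -- at that time `-φ 0`, the value of the other solution, `f 0` and `φ 0` are all close
  have hfin : ‖2 * f 0‖ ≤ m / 8 + m / 8 + m / 8 + m / 8 := by
    have e : 2 * f 0 = (w t 0 - -1 * φ 0) - (w t 0 - wf t 0) - (wf t 0 - f 0) - b 0 := by
      rw [hφ, L2Wiener.add_apply]; ring
    rw [e]
    refine (norm_sub_le _ _).trans (add_le_add ?_ h2)
    refine (norm_sub_le _ _).trans (add_le_add ?_ h3)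
    exact (norm_sub_le _ _).trans (add_le_add (hmain.trans hCt) h1)
  rw [norm_mul, Complex.norm_ofNat, ← hm] at hfin
  linarith

/-- The equation with the truncated Riesz kernel is well posed in `C([0,T]; W)` for data in
`L² ∩ W`, without uniform continuity in the `W` norm. -/
theorem exists_flow_truncatedRiesz (hd : 1 ≤ d) {γ : ℝ} (hγ : 0 < γ) (hγd : γ < d) {T : ℝ}
    (hT : 0 < T) : ∃ Ψ : Wiener d → C(Icc (0 : ℝ) T, Wiener d),
      (∀ (φ : L2Wiener d) (ψ : C(Icc (0 : ℝ) T, Wiener d)),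
        IsSolution (truncatedRiesz d γ) (Icc 0 T) φ.toW ψ ↔ ψ = Ψ φ.toW) ∧
      ∀ (φ₀ : Wiener d) (r : ℝ), 0 < r →
        ¬ UniformContinuousOn Ψ (Metric.ball φ₀ r ∩ range L2Wiener.toW) := by
  classical
  have hκ : MemLp (truncatedRiesz d γ) 1 volume :=
    memLp_truncatedRiesz hd le_rfl ENNReal.one_ne_top (by rw [ENNReal.toReal_one]; linarith)
  have hsymm : ∀ᵐ ξ, truncatedRiesz d γ (-ξ) = starRingEnd ℂ (truncatedRiesz d γ ξ) :=
    Filter.Eventually.of_forall fun ξ => by rw [truncatedRiesz_neg, conj_truncatedRiesz]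
  obtain ⟨P⟩ := nonempty_interaction_l2 le_rfl hκ
  have hex : ∀ φ : L2Wiener d, ∃ w : ℝ → L2Wiener d, Continuous w ∧ P.IsMild (Icc 0 T) φ w :=
    fun φ => by
      obtain ⟨w, hw, h⟩ := P.exists_isMild_of_integrable (memLp_one_iff_integrable.1 hκ) hsymm φ hT
      exact ⟨w, hw, Interaction.IsMild.mono P (Icc_subset_Icc (by linarith) le_rfl) h⟩
  choose w hwc hwm using hex
  let Φ : L2Wiener d → C(Icc (0 : ℝ) T, Wiener d) := fun φ =>
    ⟨fun t => (w φ t).toW, (L2Wiener.toWL.continuous.comp (hwc φ)).comp continuous_subtype_val⟩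
  have hΨ : ∀ φ, Function.extend L2Wiener.toW Φ 0 φ.toW = Φ φ := fun φ =>
    L2Wiener.toW_injective.extend_apply Φ 0 φ
  refine ⟨Function.extend L2Wiener.toW Φ 0, fun φ ψ => ?_, fun φ₀ r hr => ?_⟩
  · rw [hΨ]
    exact P.isSolution_wiener_iff_eq hT.le (hwc φ) (hwm φ) ψ
  · exact P.not_uniformContinuousOn hd hγ hγd hT
      (fun φ => ⟨w φ, hwc φ, hwm φ, fun t => by rw [hΨ]; rfl⟩) φ₀ hr

/-- Local well-posedness in `W` would make the flow of `exists_flow_truncatedRiesz` uniformly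
continuous on bounded sets. -/
theorem not_locallyWellPosed_wiener (hd : 1 ≤ d) {γ : ℝ} (hγ : 0 < γ) (hγd : γ < d) :
    ¬ LocallyWellPosed (truncatedRiesz d γ) (Wiener d) LinearMap.id := by
  intro h
  obtain ⟨T, hT, X, _, _, _, ι, -, Ψ', hΨ', huc⟩ := h (Metric.ball 0 1) Metric.isBounded_ball
  obtain ⟨Ψ, hΨ, hnot⟩ := exists_flow_truncatedRiesz hd hγ hγd hT
  refine hnot 0 1 one_pos ((huc.mono inter_subset_left).congr ?_)
  rintro _ ⟨hφ, φ, rfl⟩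
  exact (hΨ φ _).1 ((hΨ' _ hφ _).2 rfl)

end Hartree

end

open Hartree in
theorem theorem1p6 (d : ℕ) (hd : 1 ≤ d) :
    -- first part: data in `L² ∩ W`
    (∀ (p : ℝ≥0∞) (K : 𝓢'(E d, ℂ)) (κ : E d → ℂ), 1 ≤ p → HasFourierTransform K κ →
      MemLp κ p volume →
      (∀ u₀ : L2Wiener d, ∃ T : ℝ, 0 < T ∧ ∃ u : C(Icc (-T) T, L2Wiener d),
        (∀ v : C(Icc (-T) T, L2Wiener d),
          IsSolution κ (Icc (-T) T) u₀.toW (fun t => (v t).toW) ↔ v = u) ∧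
        (IsRealValued K → ∀ t, ‖(u t).toL2‖ = ‖u₀.toL2‖)) ∧
      LocallyWellPosed κ (L2Wiener d) L2Wiener.toW ∧
      (p = 1 → IsRealValued K → ∀ u₀ : L2Wiener d, ∃ u : C(ℝ, L2Wiener d),
        (∀ v : C(ℝ, L2Wiener d),
          IsSolution κ univ u₀.toW (fun t => (v t).toW) ↔ v = u) ∧
        ∀ t, ‖(u t).toL2‖ = ‖u₀.toL2‖)) ∧
    -- second part: data in `W`
    (∀ (K : 𝓢'(E d, ℂ)) (κ : E d → ℂ), HasFourierTransform K κ → MemLp κ ∞ volume →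
      (∀ u₀ : Wiener d, ∃ T : ℝ, 0 < T ∧ ∃ u : C(Icc (-T) T, Wiener d),
        ∀ v : C(Icc (-T) T, Wiener d), IsSolution κ (Icc (-T) T) u₀ v ↔ v = u) ∧
      LocallyWellPosed κ (Wiener d) LinearMap.id) ∧
    -- third part: ill-posedness in `W`
    (∀ p : ℝ≥0∞, 1 ≤ p → p ≠ ∞ → ∃ (γ : ℝ) (K : 𝓢'(E d, ℂ)), 0 < γ ∧ γ < d ∧
      IsRealValued K ∧ HasFourierTransform K (truncatedRiesz d γ) ∧
      MemLp (truncatedRiesz d γ) p volume ∧ ¬ MemLp (truncatedRiesz d γ) ∞ volume ∧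
      LocallyWellPosed (truncatedRiesz d γ) (L2Wiener d) L2Wiener.toW ∧
      ¬ LocallyWellPosed (truncatedRiesz d γ) (Wiener d) LinearMap.id ∧
      ∀ T : ℝ, 0 < T → ∃ Ψ : Wiener d → C(Icc (0 : ℝ) T, Wiener d),
        (∀ (φ : L2Wiener d) (ψ : C(Icc (0 : ℝ) T, Wiener d)),
          IsSolution (truncatedRiesz d γ) (Icc 0 T) φ.toW ψ ↔ ψ = Ψ φ.toW) ∧
        ∀ (φ₀ : Wiener d) (r : ℝ), 0 < r →
          ¬ UniformContinuousOn Ψ (Metric.ball φ₀ r ∩ range L2Wiener.toW)) := by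
  refine ⟨fun p K κ hp hK hκ => wellPosed_l2Wiener hp hK hκ,
    fun K κ _ hκ => wellPosed_wiener hκ, fun p hp hp' => ?_⟩
  have hq : 1 ≤ p.toReal := by
    have := ENNReal.toReal_mono hp' hp
    rwa [ENNReal.toReal_one] at this
  have hd' : (1 : ℝ) ≤ d := by exact_mod_cast hd
  -- the exponent `d - γ` of the singularity is `d / (2p)`
  have h0 : 0 < (d : ℝ) / (2 * p.toReal) := by positivity
  have h1 : (d : ℝ) / (2 * p.toReal) < d := div_lt_self (by linarith) (by linarith)
  have hγ : 0 < (d : ℝ) - d / (2 * p.toReal) := by linarith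
  have hγd : (d : ℝ) - d / (2 * p.toReal) < d := by linarith
  have hκ : MemLp (truncatedRiesz d (d - d / (2 * p.toReal))) p volume := by
    refine memLp_truncatedRiesz hd hp hp' ?_
    have : ((d : ℝ) - (d - d / (2 * p.toReal))) * p.toReal = d / 2 := by field_simp; ring
    linarith
  obtain ⟨K, hKr, hK⟩ := exists_hasFourierTransform hp hκ
    (Filter.Eventually.of_forall fun ξ => by rw [truncatedRiesz_neg, conj_truncatedRiesz])
  exact ⟨_, K, hγ, hγd, hKr, hK, hκ, not_memLp_top_truncatedRiesz hd hγd,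
    (wellPosed_l2Wiener hp hK hκ).2.1, not_locallyWellPosed_wiener hd hγ hγd,
    fun T hT => exists_flow_truncatedRiesz hd hγ hγd hT⟩
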